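/- Let $(W,A,L,Y,C^L,C^Y)$ be the data of a trial participant: baseline variables $W$, study arm $A\in\{0,1\}$, short-term outcome $L$, real-valued primary outcome $Y$ with $E(Y^2)<\infty$, and indicators $C^L,C^Y\in\{0,1\}$ that $L$, respectively $Y$, has been observed by a given analysis time. The observed data of a participant are $W,A,C^L,C^Y$, together with $L$ if $C^L=1$ and $Y$ if $C^Y=1$; the data of $n$ enrolled participants are independent and identically distributed. Assume 1. (1:1 randomization) $A$ is independent of $W$ and $P(A=1)=P(A=0)=1/2$; 2. (independent censoring) $(C^L,C^Y)$ is independent of $(W,A,L,Y)$; 3. (monotone censoring) $C^L\ge C^Y$ with probability $1$. The semiparametric model consists of all joint distributions with these properties. Let $p_l$ and $p_y$ be the limits in probability, as $n\to\infty$, of the proportions of enrolled participants with $L$ and with $Y$ observed, and let $p_y>0$. Write $E_a$ and $\mathrm{Var}_a$ for expectation and variance given $A=a$, assume $\mathrm{Var}_1(Y)+\mathrm{Var}_0(Y)>0$, and put $$\Delta=E_1(Y)-E_0(Y),\qquad \gamma=\frac{\mathrm{Var}\{E_1(Y\mid W)-E_0(Y\mid W)\}}{\sum_{a}\mathrm{Var}_a(Y)},$$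 $$R^2_W=\frac{\sum_{a}\mathrm{Var}\{E_a(Y\mid W)\}}{\sum_{a}\mathrm{Var}_a(Y)},\qquad R^2_{L\mid W}=\frac{\sum_{a}\mathrm{Var}_a\{E_a(Y\mid L,W)-E_a(Y\mid W)\}}{\sum_{a}\mathrm{Var}_a(Y)},$$ where the sums are over $a\in\{0,1\}$. The asymptotic variance $\mathrm{AVar}(\widehat\Delta)$ of an estimator is the variance $\sigma^2$ for which $\sqrt n(\widehat\Delta-\Delta)\to N(0,\sigma^2)$ in distribution. A regular, asymptotically linear (RAL) estimator of $\Delta$ is efficient if its asymptotic variance equals the semiparametric lower bound, that is, the supremum of the Cramér–Rao bounds for $\Delta$ over all regular one-dimensional parametric submodels (submodels through the true distribution whose observed-data laws are differentiable in quadratic mean with positive information, and along which $E(Y^2)$ is locally bounded). The unadjusted estimator is $$\frac{\sum_i A_iC^Y_iY_i}{\sum_i A_iC^Y_i}-\frac{\sum_i(1-A_i)C^Y_iY_i}{\sum_i(1-A_i)C^Y_i}.$$ Theorem. If $\widehat\Delta$ is any efficient RAL estimator of $\Delta$, then the unadjusted estimator has an asymptotic variance and $$\mathrm{ARE}(\widehat\Delta,\text{unadjusted})=\frac{\mathrm{AVar}(\text{unadjusted})}{\mathrm{AVar}(\widehat\Delta)}=\frac{1}{1+(p_y/2)\gamma-R^2_W-(1-p_y/p_l)R^2_{L\mid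 W}}.$$ (If $\mathrm{AVar}(\widehat\Delta)=0$, then the denominators on both sides are $0$ and both quotients are given the value $0$.) -/

import Mathlib

open MeasureTheory ProbabilityTheory Filter Topology
open scoped NNReal ENNReal

noncomputable section

namespace Trial

variable {𝓦 𝓛 : Type*} [MeasurableSpace 𝓦] [MeasurableSpace 𝓛]

/-! ### Full data and observed data -/

/-- Full data `((W, A, L, Y), (C^L, C^Y))` of one participant: baseline variables `W`, study arm
`A` (`true` is treatment), short-term outcome `L`, primary outcome `Y`, and the indicators that
`L`, respectively `Y`, has been observed by the analysis time. -/
abbrev Full (𝓦 𝓛 : Type*) := (𝓦 × Bool × 𝓛 × ℝ) × (Bool × Bool)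

/-- Observed data of one participant: `W`, `A`, and `L` and `Y` where they are observed
(`Sum.inr ()` stands for "not observed"). -/
abbrev Obs (𝓦 𝓛 : Type*) := 𝓦 × Bool × (𝓛 ⊕ Unit) × (ℝ ⊕ Unit)

/-- The baseline variables `W`. -/
def baseline (o : Full 𝓦 𝓛) : 𝓦 := o.1.1

/-- The study arm `A`. -/
def arm (o : Full 𝓦 𝓛) : Bool := o.1.2.1

/-- The short-term outcome `L`. -/
def short (o : Full 𝓦 𝓛) : 𝓛 := o.1.2.2.1

/-- The primary outcome `Y`. -/
def outcome (o : Full 𝓦 𝓛) : ℝ := o.1.2.2.2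

/-- The indicator `C^L`. -/
def seenL (o : Full 𝓦 𝓛) : Bool := o.2.1

/-- The indicator `C^Y`. -/
def seenY (o : Full 𝓦 𝓛) : Bool := o.2.2

/-- What is observed of a participant with given full data. -/
def observe (o : Full 𝓦 𝓛) : Obs 𝓦 𝓛 :=
  (baseline o, arm o,
    (if seenL o = true then Sum.inl (short o) else Sum.inr ()),
    (if seenY o = true then Sum.inl (outcome o) else Sum.inr ()))

theorem measurable_observe : Measurable (observe : Full 𝓦 𝓛 → Obs 𝓦 𝓛) := by
  have hL : MeasurableSet {o : Full 𝓦 𝓛 | seenL o = true} := by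
    have : Measurable (seenL : Full 𝓦 𝓛 → Bool) := by unfold seenL; fun_prop
    exact this (measurableSet_singleton true)
  have hY : MeasurableSet {o : Full 𝓦 𝓛 | seenY o = true} := by
    have : Measurable (seenY : Full 𝓦 𝓛 → Bool) := by unfold seenY; fun_prop
    exact this (measurableSet_singleton true)
  have h1 : Measurable (fun o : Full 𝓦 𝓛 => (Sum.inl (short o) : 𝓛 ⊕ Unit)) :=
    measurable_inl.comp (by unfold short; fun_prop)
  have h2 : Measurable (fun o : Full 𝓦 𝓛 => (Sum.inl (outcome o) : ℝ ⊕ Unit)) :=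
    measurable_inl.comp (by unfold outcome; fun_prop)
  have hW : Measurable (baseline : Full 𝓦 𝓛 → 𝓦) := by unfold baseline; fun_prop
  have hA : Measurable (arm : Full 𝓦 𝓛 → Bool) := by unfold arm; fun_prop
  exact hW.prodMk (hA.prodMk
    ((Measurable.ite hL h1 measurable_const).prodMk (Measurable.ite hY h2 measurable_const)))

/-- The law of the observed data of one participant. -/
def obsLaw (P : ProbabilityMeasure (Full 𝓦 𝓛)) : Measure (Obs 𝓦 𝓛) :=
  (P : Measure (Full 𝓦 𝓛)).map observe

instance (P : ProbabilityMeasure (Full 𝓦 𝓛)) : IsProbabilityMeasure (obsLaw P) :=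
  Measure.isProbabilityMeasure_map measurable_observe.aemeasurable

/-- The law of the observed data of `n` independent, identically distributed participants. -/
def sampleLaw (P : ProbabilityMeasure (Full 𝓦 𝓛)) (n : ℕ) : Measure (Fin n → Obs 𝓦 𝓛) :=
  Measure.pi (fun _ => obsLaw P)

instance (P : ProbabilityMeasure (Full 𝓦 𝓛)) (n : ℕ) : IsProbabilityMeasure (sampleLaw P n) := by
  unfold sampleLaw; infer_instance

/-! ### The semiparametric model and the estimand -/

/-- The semiparametric model: all laws of the full data (with `Y` of finite variance) that satisfy
1:1 randomization, independent censoring and monotone censoring. -/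
structure InModel (P : ProbabilityMeasure (Full 𝓦 𝓛)) : Prop where
  outcome_memLp : MemLp outcome 2 (P : Measure (Full 𝓦 𝓛))
  randomization_indep : IndepFun arm baseline (P : Measure (Full 𝓦 𝓛))
  randomization_half : ∀ a : Bool, (P : Measure (Full 𝓦 𝓛)).real {o | arm o = a} = 1 / 2
  independent_censoring : IndepFun (fun o : Full 𝓦 𝓛 => (seenL o, seenY o))
    (fun o : Full 𝓦 𝓛 => (baseline o, arm o, short o, outcome o)) (P : Measure (Full 𝓦 𝓛))
  monotone_censoring : ∀ᵐ o ∂(P : Measure (Full 𝓦 𝓛)), seenY o = true → seenL o = true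

/-- The conditional law of the full data given `A = a`. -/
def armLaw (P : ProbabilityMeasure (Full 𝓦 𝓛)) (a : Bool) : Measure (Full 𝓦 𝓛) :=
  ProbabilityTheory.cond (P : Measure (Full 𝓦 𝓛)) {o | arm o = a}

/-- The average treatment effect `Δ = E(Y | A = 1) - E(Y | A = 0)`. -/
def ate (P : ProbabilityMeasure (Full 𝓦 𝓛)) : ℝ :=
  (∫ o, outcome o ∂(armLaw P true)) - ∫ o, outcome o ∂(armLaw P false)

/-- `E_a(Y | W)`, as a `W`-measurable function. -/
def meanW (P : ProbabilityMeasure (Full 𝓦 𝓛)) (a : Bool) : Full 𝓦 𝓛 → ℝ :=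
  condExp (MeasurableSpace.comap baseline inferInstance) (armLaw P a) outcome

/-- `E_a(Y | L, W)`, as an `(L, W)`-measurable function. -/
def meanLW (P : ProbabilityMeasure (Full 𝓦 𝓛)) (a : Bool) : Full 𝓦 𝓛 → ℝ :=
  condExp (MeasurableSpace.comap (fun o : Full 𝓦 𝓛 => (short o, baseline o)) inferInstance)
    (armLaw P a) outcome

/-- `Var_1(Y) + Var_0(Y)`. -/
def totalVar (P : ProbabilityMeasure (Full 𝓦 𝓛)) : ℝ :=
  ∑ a : Bool, variance outcome (armLaw P a)

/-- Treatment effect heterogeneity `γ`. -/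
def heterogeneity (P : ProbabilityMeasure (Full 𝓦 𝓛)) : ℝ :=
  variance (fun o => meanW P true o - meanW P false o) (P : Measure (Full 𝓦 𝓛)) / totalVar P

/-- `R²_W`. -/
def rSqW (P : ProbabilityMeasure (Full 𝓦 𝓛)) : ℝ :=
  (∑ a : Bool, variance (meanW P a) (P : Measure (Full 𝓦 𝓛))) / totalVar P

/-- `R²_{L|W}`. -/
def rSqLW (P : ProbabilityMeasure (Full 𝓦 𝓛)) : ℝ :=
  (∑ a : Bool, variance (fun o => meanLW P a o - meanW P a o) (armLaw P a)) / totalVar P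

/-! ### Estimators -/

/-- An estimator: for every sample size, a real function of the observed data. -/
abbrev Estimator (𝓦 𝓛 : Type*) := ∀ n : ℕ, (Fin n → Obs 𝓦 𝓛) → ℝ

/-- The indicator of `A = a` and `C^Y = 1`. -/
def indAC (a : Bool) (x : Obs 𝓦 𝓛) : ℝ :=
  if x.2.1 = a then Sum.elim (fun _ => 1) (fun _ => 0) x.2.2.2 else 0

/-- `Y` times the indicator of `A = a` and `C^Y = 1`. -/
def indACY (a : Bool) (x : Obs 𝓦 𝓛) : ℝ :=
  if x.2.1 = a then Sum.elim (fun y => y) (fun _ => 0) x.2.2.2 else 0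

/-- The unadjusted estimator: the difference between the arms of the sample means of `Y` over the
participants with `Y` observed. -/
def unadjusted : Estimator 𝓦 𝓛 := fun _ x =>
  (∑ i, indACY true (x i)) / (∑ i, indAC true (x i))
    - (∑ i, indACY false (x i)) / (∑ i, indAC false (x i))

/-- The proportion of the participants of a sample whose observed data satisfy `S` converges in
probability to `p`. -/
def HasLimitProportion (P : ProbabilityMeasure (Full 𝓦 𝓛)) (S : Set (Obs 𝓦 𝓛)) (p : ℝ) : Prop :=
  ∀ ε : ℝ, 0 < ε → Tendsto
    (fun n : ℕ => (sampleLaw P n).real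
      {x | ε ≤ |(∑ i, S.indicator (fun _ => (1 : ℝ)) (x i)) / n - p|}) atTop (𝓝 0)

/-- The observed data in which `L` is observed. -/
def observedL : Set (Obs 𝓦 𝓛) := {x | x.2.2.1.isLeft = true}

/-- The observed data in which `Y` is observed. -/
def observedY : Set (Obs 𝓦 𝓛) := {x | x.2.2.2.isLeft = true}

/-- `√n (T_n - Δ) → N(0, v)` in distribution under `P`: `v` is the asymptotic variance of `T`. -/
def HasAVar (T : Estimator 𝓦 𝓛) (P : ProbabilityMeasure (Full 𝓦 𝓛)) (v : ℝ≥0) : Prop :=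
  TendstoInDistribution (fun (n : ℕ) (x : Fin n → Obs 𝓦 𝓛) => √(n : ℝ) * (T n x - ate P))
    atTop (id : ℝ → ℝ) (fun n => sampleLaw P n) (gaussianReal 0 v)

/-- `r` is the asymptotic relative efficiency `AVar(T₂) / AVar(T₁)` of `T₁` and `T₂` at `P`. -/
def HasARE (T₁ T₂ : Estimator 𝓦 𝓛) (P : ProbabilityMeasure (Full 𝓦 𝓛)) (r : ℝ) : Prop :=
  ∃ v₁ v₂ : ℝ≥0, HasAVar T₁ P v₁ ∧ HasAVar T₂ P v₂ ∧ r = (v₂ : ℝ) / (v₁ : ℝ)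

/-! ### Regular parametric submodels, RAL estimators and efficiency -/

/-- The observed-data laws of the path `Q` are differentiable in quadratic mean at `t = 0`, with
score `s`. -/
def IsDQM (Q : ℝ → ProbabilityMeasure (Full 𝓦 𝓛)) (s : Obs 𝓦 𝓛 → ℝ) : Prop :=
  ∃ μ : Measure (Obs 𝓦 𝓛), SigmaFinite μ ∧ (∀ᶠ t in 𝓝 (0 : ℝ), obsLaw (Q t) ≪ μ) ∧
    Tendsto (fun t : ℝ =>
      (∫ x, (√((obsLaw (Q t)).rnDeriv μ x).toReal - √((obsLaw (Q 0)).rnDeriv μ x).toReal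
          - t / 2 * s x * √((obsLaw (Q 0)).rnDeriv μ x).toReal) ^ 2 ∂μ) / t ^ 2)
      (𝓝[≠] 0) (𝓝 0)

/-- `Q` is a regular one-dimensional parametric submodel through `P`, with score `s` and positive
Fisher information `∫ s²` at `P`. The second moment of `Y` is locally bounded, as is needed for
`Δ` to be differentiable along `Q`. -/
structure IsRegularSubmodel (P : ProbabilityMeasure (Full 𝓦 𝓛))
    (Q : ℝ → ProbabilityMeasure (Full 𝓦 𝓛)) (s : Obs 𝓦 𝓛 → ℝ) : Prop where
  base : Q 0 = P
  mem_model : ∀ᶠ t in 𝓝 (0 : ℝ), InModel (Q t)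
  moment : ∃ K : ℝ, ∀ᶠ t in 𝓝 (0 : ℝ), ∫ o, outcome o ^ 2 ∂(Q t : Measure (Full 𝓦 𝓛)) ≤ K
  score_memLp : MemLp s 2 (obsLaw P)
  information_pos : 0 < ∫ x, s x ^ 2 ∂(obsLaw P)
  dqm : IsDQM Q s

/-- The Cramér-Rao bounds `(dΔ/dt)² / ∫ s²` at `P` for estimating `Δ` in the regular parametric
submodels through `P`. -/
def cramerRaoBounds (P : ProbabilityMeasure (Full 𝓦 𝓛)) : Set ℝ :=
  {b | ∃ (Q : ℝ → ProbabilityMeasure (Full 𝓦 𝓛)) (s : Obs 𝓦 𝓛 → ℝ) (d : ℝ),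
    IsRegularSubmodel P Q s ∧ HasDerivAt (fun t => ate (Q t)) d 0 ∧
      b = d ^ 2 / ∫ x, s x ^ 2 ∂(obsLaw P)}

/-- Asymptotic linearity at `P`, with some influence function `ψ`. -/
def IsAsymptoticallyLinear (T : Estimator 𝓦 𝓛) (P : ProbabilityMeasure (Full 𝓦 𝓛)) : Prop :=
  ∃ ψ : Obs 𝓦 𝓛 → ℝ, Measurable ψ ∧ MemLp ψ 2 (obsLaw P) ∧ ∫ x, ψ x ∂(obsLaw P) = 0 ∧
    ∀ ε : ℝ, 0 < ε → Tendsto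
      (fun n : ℕ => (sampleLaw P n).real
        {x | ε ≤ |√(n : ℝ) * (T n x - ate P) - (√(n : ℝ))⁻¹ * ∑ i, ψ (x i)|}) atTop (𝓝 0)

/-- Regularity at `P`: under every sequence of local alternatives `Q (t n)`, `t n = O(n^{-1/2})`,
in a regular parametric submodel `Q` through `P`, the law of `√n (T_n - Δ(Q (t n)))` converges
weakly to one and the same limit. -/
def IsRegularEstimator (T : Estimator 𝓦 𝓛) (P : ProbabilityMeasure (Full 𝓦 𝓛)) : Prop :=
  ∃ R : ProbabilityMeasure ℝ,
    ∀ (Q : ℝ → ProbabilityMeasure (Full 𝓦 𝓛)) (s : Obs 𝓦 𝓛 → ℝ), IsRegularSubmodel P Q s →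
      ∀ t : ℕ → ℝ, (∃ B : ℝ, ∀ n : ℕ, √(n : ℝ) * |t n| ≤ B) → Tendsto t atTop (𝓝 0) →
        TendstoInDistribution
          (fun (n : ℕ) (x : Fin n → Obs 𝓦 𝓛) => √(n : ℝ) * (T n x - ate (Q (t n))))
          atTop (id : ℝ → ℝ) (fun n => sampleLaw (Q (t n)) n) (R : Measure ℝ)

/-- Regular, asymptotically linear (RAL) estimators of `Δ` at `P`. -/
structure IsRAL (T : Estimator 𝓦 𝓛) (P : ProbabilityMeasure (Full 𝓦 𝓛)) : Prop where
  measurable : ∀ n, Measurable (T n)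
  linear : IsAsymptoticallyLinear T P
  regular : IsRegularEstimator T P

/-- A RAL estimator is efficient at `P` if its asymptotic variance is the semiparametric lower
bound: the supremum of the Cramér-Rao bounds over the regular parametric submodels. -/
structure IsEfficient (T : Estimator 𝓦 𝓛) (P : ProbabilityMeasure (Full 𝓦 𝓛)) : Prop where
  ral : IsRAL T P
  attains : ∃ v : ℝ≥0, HasAVar T P v ∧ IsLUB (cramerRaoBounds P) (v : ℝ)

end Trial

end

noncomputable section

namespace Trial

/-! ### Cauchy-Schwarz and truncation -/

section L2

variable {α : Type*} [MeasurableSpace α] {μ : Measure α}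

/-! By randomization, `Z = 2(2A-1)Y` has mean `Δ`. Let `G = E(Z | A, W)` and `H = E(Z | A, L, W)`.
The efficient influence function is `φ = {E_1(Y|W) - E_0(Y|W) - Δ} + C^L (H - G) / p_l + C^Y (Z - H)
/ p_y`. Its three terms are uncorrelated, so its second moment is the sum of the three second
moments (`effBound`). The core of the proof is that `effBound` is the supremum of the Cramér-Rao
bounds.

Upper bound. Randomization and independent, monotone censoring are expressed by identities between
expectations of bounded functions of the observed data. Differentiability in quadratic mean allows
these identities to be differentiated along any regular submodel, which gives linear identities for
its score `s`. Together with the derivative of `E(C^Y Z) = p_y Δ` they yield `dΔ/dt = E(φ s)`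
(`IsRegularSubmodel.deriv_ate_eq`), and Cauchy-Schwarz bounds the Cramér-Rao quotient by `E(φ²)`.
The tangent space never has to be computed.

Lower bound. For bounded `u(W)`, `v(A, L, W)`, `r(W, A, L, Y)` with vanishing (conditional) means,
the laws with density `1 + t(u + v + r)` stay in the model, and the observed data have score `u +
C^L v + C^Y r`. Truncating and recentring the components of `φ` gives such a triple, for which the
derivative of `Δ` equals `truncBound` and the information is at most `truncBound`
(`exists_scoreTriple`). The Cramér-Rao quotient is then at least `truncBound`, which tends to
`effBound` as the truncation is removed.

Closed form. Decomposing `Var_a(Y)` along the σ-algebras of `W` and `(L, W)` turns `effBound` into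
`(2/p_y) (Var_1 Y + Var_0 Y)` times the denominator of the theorem (`effBound_of_mean`). The
prefactor is the asymptotic variance of the unadjusted estimator, by the central limit theorem and
the delta method (`InModel.hasAVar_unadjusted`), so it cancels in the quotient. -/

theorem integrable_mul_of_memLp_two {f g : α → ℝ} (hf : MemLp f 2 μ) (hg : MemLp g 2 μ) :
    Integrable (fun x => f x * g x) μ :=
  hf.integrable_mul hg

theorem integrable_fun_sub {f g : α → ℝ} (hf : Integrable f μ) (hg : Integrable g μ) :
    Integrable (fun x => f x - g x) μ :=
  hf.sub hg

theorem sq_integral_mul_le {f g : α → ℝ} (hf : MemLp f 2 μ) (hg : MemLp g 2 μ) :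
    (∫ x, f x * g x ∂μ) ^ 2 ≤ (∫ x, f x ^ 2 ∂μ) * ∫ x, g x ^ 2 ∂μ := by
  have hff := hf.integrable_sq
  have hgg := hg.integrable_sq
  have hfg := integrable_mul_of_memLp_two hf hg
  -- The quadratic polynomial `r ↦ ∫ (f + r g)²` is nonnegative, so its discriminant is not
  -- positive.
  have key : ∀ r : ℝ, 0 ≤ (∫ x, g x ^ 2 ∂μ) * (r * r) + (2 * ∫ x, f x * g x ∂μ) * r
      + ∫ x, f x ^ 2 ∂μ := by
    intro r
    have h0 : 0 ≤ ∫ x, (f x + r * g x) ^ 2 ∂μ := integral_nonneg fun x => sq_nonneg _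
    have e : (fun x => (f x + r * g x) ^ 2)
        = fun x => (r * r) * g x ^ 2 + (2 * r) * (f x * g x) + f x ^ 2 := by
      ext x; ring
    rw [e, integral_add ((hgg.const_mul _).fun_add (hfg.const_mul _)) hff,
      integral_add (hgg.const_mul _) (hfg.const_mul _), integral_const_mul,
      integral_const_mul] at h0
    linarith
  have h := discrim_le_zero key
  simp only [discrim] at h
  nlinarith

theorem abs_integral_mul_le {f g : α → ℝ} (hf : MemLp f 2 μ) (hg : MemLp g 2 μ) :
    |∫ x, f x * g x ∂μ| ≤ √(∫ x, f x ^ 2 ∂μ) * √(∫ x, g x ^ 2 ∂μ) := by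
  rw [← Real.sqrt_mul (integral_nonneg fun x => sq_nonneg _)]
  exact Real.abs_le_sqrt (sq_integral_mul_le hf hg)

theorem integral_add_sq_le {f g : α → ℝ} (hf : MemLp f 2 μ) (hg : MemLp g 2 μ) :
    ∫ x, (f x + g x) ^ 2 ∂μ ≤ 2 * ∫ x, f x ^ 2 ∂μ + 2 * ∫ x, g x ^ 2 ∂μ := by
  rw [← integral_const_mul, ← integral_const_mul,
    ← integral_add (hf.integrable_sq.const_mul _) (hg.integrable_sq.const_mul _)]
  refine integral_mono (hf.add hg).integrable_sq
    ((hf.integrable_sq.const_mul _).add (hg.integrable_sq.const_mul _)) fun x => ?_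
  simp only
  nlinarith [sq_nonneg (f x - g x)]

theorem tendsto_setIntegral_abs_gt {f w : α → ℝ} (hf : Measurable f) (hw : Integrable w μ) :
    Tendsto (fun M : ℕ => ∫ x in {x | (M : ℝ) < |f x|}, w x ∂μ) atTop (𝓝 0) := by
  have hm : ∀ M : ℕ, MeasurableSet {x | (M : ℝ) < |f x|} := fun M =>
    measurableSet_lt measurable_const hf.abs
  have h : Tendsto (fun M : ℕ => ∫ x, {x | (M : ℝ) < |f x|}.indicator w x ∂μ) atTop
      (𝓝 (∫ _, (0 : ℝ) ∂μ)) := by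
    refine tendsto_integral_of_dominated_convergence (fun x => ‖w x‖)
      (fun M => hw.aestronglyMeasurable.indicator (hm M)) hw.norm
      (fun M => ae_of_all _ fun x => norm_indicator_le_norm_self _ _) (ae_of_all _ fun x => ?_)
    obtain ⟨N, hN⟩ := exists_nat_ge |f x|
    refine tendsto_const_nhds.congr' ?_
    filter_upwards [eventually_ge_atTop N] with M hM
    rw [Set.indicator_of_notMem]
    simp only [Set.mem_ofPred_eq, not_lt]
    exact hN.trans (by exact_mod_cast hM)
  simp only [integral_zero] at h
  refine h.congr fun M => ?_
  rw [integral_indicator (hm M)]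

/-- A sequence that is small in `L²` and stays bounded in `L²` after multiplication by `f` is,
after multiplication by `f`, weakly null in `L²`. -/
theorem tendsto_integral_mul_mul_zero {l : Filter ℝ} {f w : α → ℝ} {v : ℝ → α → ℝ} {K : ℝ}
    (hf : Measurable f) (hw : MemLp w 2 μ) (hv : ∀ᶠ t in l, MemLp (v t) 2 μ)
    (hfv : ∀ᶠ t in l, MemLp (fun x => f x * v t x) 2 μ)
    (hK : ∀ᶠ t in l, ∫ x, (f x * v t x) ^ 2 ∂μ ≤ K)
    (h0 : Tendsto (fun t => ∫ x, v t x ^ 2 ∂μ) l (𝓝 0)) :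
    Tendsto (fun t => ∫ x, w x * (f x * v t x) ∂μ) l (𝓝 0) := by
  have hm : ∀ M : ℕ, MeasurableSet {x | (M : ℝ) < |f x|} := fun M =>
    measurableSet_lt measurable_const hf.abs
  rw [Metric.tendsto_nhds]
  intro ε hε
  have htail := tendsto_setIntegral_abs_gt (μ := μ) hf hw.integrable_sq
  have htail' : Tendsto (fun M : ℕ => √(∫ x in {x | (M : ℝ) < |f x|}, w x ^ 2 ∂μ) * √K) atTop
      (𝓝 0) := by
    simpa using (htail.sqrt).mul_const (√K)
  -- `M` is fixed before `t`. Where `|f| > M`, `w` has little mass and `f * v t` stays bounded by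
  -- `K`. Where `|f| ≤ M`, the factor `f` is harmless and `v t` itself is small.
  obtain ⟨M, hM⟩ := ((tendsto_order.1 htail').2 (ε / 2) (by positivity)).exists
  set B := {x | (M : ℝ) < |f x|} with hB
  have h1 : Tendsto (fun t => √(∫ x, w x ^ 2 ∂μ) * (M * √(∫ x, v t x ^ 2 ∂μ))) l (𝓝 0) := by
    simpa using (h0.sqrt.const_mul (M : ℝ)).const_mul (√(∫ x, w x ^ 2 ∂μ))
  filter_upwards [hv, hfv, hK, (tendsto_order.1 h1).2 (ε / 2) (by positivity)]
    with t hvt hfvt hKt h1t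
  rw [Real.dist_eq, sub_zero]
  have hint := integrable_mul_of_memLp_two hw hfvt
  rw [← integral_add_compl (hm M) hint]
  refine (abs_add_le _ _).trans_lt ?_
  have b1 : |∫ x in B, w x * (f x * v t x) ∂μ| < ε / 2 := by
    refine (abs_integral_mul_le (hw.restrict B) (hfvt.restrict B)).trans_lt ?_
    refine lt_of_le_of_lt ?_ hM
    gcongr
    refine (setIntegral_le_integral hfvt.integrable_sq ?_).trans hKt
    exact ae_of_all _ fun x => sq_nonneg _
  have b2 : |∫ x in Bᶜ, w x * (f x * v t x) ∂μ| < ε / 2 := by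
    refine (abs_integral_mul_le (hw.restrict Bᶜ) (hfvt.restrict Bᶜ)).trans_lt ?_
    refine lt_of_le_of_lt ?_ h1t
    have e1 : ∫ x in Bᶜ, w x ^ 2 ∂μ ≤ ∫ x, w x ^ 2 ∂μ :=
      setIntegral_le_integral hw.integrable_sq (ae_of_all _ fun x => sq_nonneg _)
    have e2 : ∫ x in Bᶜ, (f x * v t x) ^ 2 ∂μ ≤ (M : ℝ) ^ 2 * ∫ x, v t x ^ 2 ∂μ := by
      rw [← integral_const_mul]
      refine (setIntegral_mono_on hfvt.integrable_sq.integrableOn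
        (hvt.integrable_sq.const_mul _).integrableOn (hm M).compl fun x hx => ?_).trans
        (setIntegral_le_integral (hvt.integrable_sq.const_mul _)
          (ae_of_all _ fun x => by positivity))
      have hx' : |f x| ≤ M := by simpa [hB] using hx
      rw [mul_pow]
      have : f x ^ 2 ≤ (M : ℝ) ^ 2 := by rw [← sq_abs]; gcongr
      gcongr
    have e3 : √(∫ x in Bᶜ, (f x * v t x) ^ 2 ∂μ) ≤ M * √(∫ x, v t x ^ 2 ∂μ) := by
      refine (Real.sqrt_le_sqrt e2).trans_eq ?_
      rw [Real.sqrt_mul (by positivity), Real.sqrt_sq (by positivity)]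
    gcongr
  linarith

/-- Differentiation of `∫ f u_t²` when `t ↦ u_t` is differentiable in `L²` with derivative
`s u_0 / 2`. -/
theorem hasDerivAt_integral_mul_sq {f s : α → ℝ} {u : ℝ → α → ℝ} {K : ℝ}
    (hf : Measurable f) (hu : ∀ᶠ t in 𝓝 (0 : ℝ), MemLp (u t) 2 μ)
    (hsu : MemLp (fun x => s x * u 0 x) 2 μ)
    (hfu : ∀ᶠ t in 𝓝 (0 : ℝ), MemLp (fun x => f x * u t x) 2 μ)
    (hK : ∀ᶠ t in 𝓝 (0 : ℝ), ∫ x, (f x * u t x) ^ 2 ∂μ ≤ K)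
    (hR : Tendsto (fun t : ℝ => (∫ x, (u t x - u 0 x - t / 2 * s x * u 0 x) ^ 2 ∂μ) / t ^ 2)
      (𝓝[≠] 0) (𝓝 0)) :
    HasDerivAt (fun t => ∫ x, f x * u t x ^ 2 ∂μ) (∫ x, f x * s x * u 0 x ^ 2 ∂μ) 0 := by
  have hu0 := hu.self_of_nhds
  have hfu0 := hfu.self_of_nhds
  have hK0 := hK.self_of_nhds
  have hRL : ∀ᶠ t in 𝓝 (0 : ℝ), MemLp (fun x => u t x - u 0 x - t / 2 * s x * u 0 x) 2 μ := by
    filter_upwards [hu] with t ht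
    have := (ht.sub hu0).sub (hsu.const_mul (t / 2))
    convert this using 2 with x
    simp [mul_assoc]
  have hle : 𝓝[≠] (0 : ℝ) ≤ 𝓝 0 := nhdsWithin_le_nhds
  have hconv : Tendsto (fun t => ∫ x, (u t x - u 0 x) ^ 2 ∂μ) (𝓝[≠] 0) (𝓝 0) := by
    have hb : Tendsto (fun t : ℝ => 2 * (((∫ x, (u t x - u 0 x - t / 2 * s x * u 0 x) ^ 2 ∂μ)
        / t ^ 2) * t ^ 2) + 2 * ((t / 2) ^ 2 * ∫ x, (s x * u 0 x) ^ 2 ∂μ)) (𝓝[≠] 0) (𝓝 0) := by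
      have ht : Tendsto (fun t : ℝ => t) (𝓝[≠] 0) (𝓝 0) := hle
      have h1 := (hR.mul (ht.pow 2)).const_mul 2
      have h2 := ((((ht.div_const 2).pow 2)).mul_const (∫ x, (s x * u 0 x) ^ 2 ∂μ)).const_mul 2
      simpa using h1.add h2
    refine tendsto_of_tendsto_of_tendsto_of_le_of_le' tendsto_const_nhds hb
      (Eventually.of_forall fun t => integral_nonneg fun x => sq_nonneg _) ?_
    filter_upwards [hle hRL, self_mem_nhdsWithin] with t ht ht0
    have ht0' : t ^ 2 ≠ 0 := pow_ne_zero _ ht0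
    rw [div_mul_cancel₀ _ ht0', ← integral_const_mul ((t / 2) ^ 2)]
    have := integral_add_sq_le ht (hsu.const_mul (t / 2))
    refine le_trans (le_of_eq ?_) (this.trans (le_of_eq ?_))
    · refine integral_congr_ae (ae_of_all _ fun x => ?_)
      simp only; ring
    · congr 3
      ext x
      ring
  -- For unbounded `f` the functions `f * (u t - u 0)` need not tend to zero in `L²`. They are
  -- bounded in `L²`, and weak convergence against `s * u 0` is enough.
  have hweak : Tendsto (fun t => ∫ x, (s x * u 0 x) * (f x * (u t x - u 0 x)) ∂μ)
      (𝓝[≠] 0) (𝓝 0) := by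
    refine tendsto_integral_mul_mul_zero (K := 4 * K) hf hsu ?_ ?_ ?_ hconv
    · filter_upwards [hle hu] with t ht using ht.sub hu0
    · filter_upwards [hle hfu] with t ht
      convert ht.sub hfu0 using 2 with x
      simp [mul_sub]
    · filter_upwards [hle hfu, hle hK] with t ht hKt
      have := integral_add_sq_le ht hfu0.neg
      refine le_trans (le_of_eq ?_) (this.trans ?_)
      · refine integral_congr_ae (ae_of_all _ fun x => ?_)
        simp only [Pi.neg_apply]; ring
      · simp only [Pi.neg_apply, neg_sq]
        linarith
  have hfirst : Tendsto (fun t : ℝ => t⁻¹ * ∫ x, (u t x - u 0 x - t / 2 * s x * u 0 x)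
      * (f x * u t x + f x * u 0 x) ∂μ) (𝓝[≠] 0) (𝓝 0) := by
    have hb : Tendsto (fun t : ℝ => √((∫ x, (u t x - u 0 x - t / 2 * s x * u 0 x) ^ 2 ∂μ)
        / t ^ 2) * √(4 * K)) (𝓝[≠] 0) (𝓝 0) := by
      simpa only [Real.sqrt_zero, zero_mul] using hR.sqrt.mul_const (√(4 * K))
    refine squeeze_zero_norm' ?_ hb
    filter_upwards [hle hRL, hle hfu, hle hK] with t ht hft hKt
    rw [Real.norm_eq_abs, abs_mul, abs_inv, Real.sqrt_div' _ (sq_nonneg t), Real.sqrt_sq_eq_abs]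
    have h1 := abs_integral_mul_le ht (hft.add hfu0)
    have h2 : √(∫ x, ((fun x => f x * u t x) + fun x => f x * u 0 x) x ^ 2 ∂μ) ≤ √(4 * K) := by
      refine Real.sqrt_le_sqrt ((integral_add_sq_le hft hfu0).trans ?_)
      linarith
    rw [div_mul_eq_mul_div _ |t|, div_eq_inv_mul _ |t|]
    refine mul_le_mul_of_nonneg_left ?_ (by positivity)
    exact h1.trans (mul_le_mul_of_nonneg_left h2 (Real.sqrt_nonneg _))
  rw [hasDerivAt_iff_tendsto_slope]
  -- With `R` the remainder of the quadratic-mean expansion, `u t ^ 2 - u 0 ^ 2 = (R + (t/2) s u 0)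
  -- (u t + u 0)` and `u t + u 0 = (u t - u 0) + 2 u 0`. The difference quotient thus splits into
  -- `hfirst`, half of `hweak`, and the claimed derivative.
  have hsum := (hfirst.add (hweak.const_mul (1 / 2))).add_const (∫ x, f x * s x * u 0 x ^ 2 ∂μ)
  simp only [mul_zero, add_zero, zero_add] at hsum
  refine hsum.congr' ?_
  filter_upwards [hle hRL, hle hu, hle hfu, self_mem_nhdsWithin] with t ht hut hft ht0
  have ht0' : t ≠ 0 := ht0
  have i1 := integrable_mul_of_memLp_two ht (hft.add hfu0)
  have hd : MemLp (fun x => f x * (u t x - u 0 x)) 2 μ := by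
    convert hft.sub hfu0 using 2 with x
    simp [mul_sub]
  have i2 := integrable_mul_of_memLp_two hsu hd
  have i3 : Integrable (fun x => f x * s x * u 0 x ^ 2) μ := by
    convert integrable_mul_of_memLp_two hsu hfu0 using 2 with x
    ring
  have i4 : Integrable (fun x => f x * u t x ^ 2) μ := by
    convert integrable_mul_of_memLp_two hft hut using 2 with x
    ring
  have i5 : Integrable (fun x => f x * u 0 x ^ 2) μ := by
    convert integrable_mul_of_memLp_two hfu0 hu0 using 2 with x
    ring
  simp only [Pi.add_apply] at i1
  rw [slope_def_field, sub_zero, ← integral_sub i4 i5, ← integral_const_mul, ← integral_const_mul,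
    ← integral_add (i1.const_mul _) (i2.const_mul _),
    ← integral_add ((i1.const_mul _).fun_add (i2.const_mul _)) i3, div_eq_inv_mul _ t,
    ← integral_const_mul]
  refine integral_congr_ae (ae_of_all _ fun x => ?_)
  simp only
  field_simp
  ring

end L2

/-! ### Clamping -/

/-- The truncation of `x` to the interval `[-N, N]`. -/
def clamp (N : ℕ) (x : ℝ) : ℝ := max (-(N : ℝ)) (min x N)

theorem measurable_clamp (N : ℕ) : Measurable (clamp N) := by
  unfold clamp; fun_prop

theorem abs_clamp_le (N : ℕ) (x : ℝ) : |clamp N x| ≤ N := by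
  have hN : (0 : ℝ) ≤ N := Nat.cast_nonneg N
  unfold clamp
  rw [abs_le]
  exact ⟨le_max_left _ _, max_le (by linarith) (min_le_right _ _)⟩

theorem abs_clamp_le_abs (N : ℕ) (x : ℝ) : |clamp N x| ≤ |x| := by
  have hN : (0 : ℝ) ≤ N := Nat.cast_nonneg N
  unfold clamp
  rcases max_cases (-(N : ℝ)) (min x N) with h | h <;>
  rcases min_cases x (N : ℝ) with h' | h' <;> rw [h.1] <;> try rw [h'.1]
  all_goals rcases abs_cases x with h'' | h'' <;> rw [abs_le] <;> constructor <;> linarith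

theorem clamp_zero (N : ℕ) : clamp N 0 = 0 := by
  have := abs_clamp_le_abs N 0
  simpa using this

/-- Truncation keeps the sign and shrinks the modulus. This inequality is what later puts the
information of a truncated score below the derivative of `Δ` in its direction. -/
theorem clamp_sq_le (N : ℕ) (x : ℝ) : clamp N x ^ 2 ≤ x * clamp N x := by
  have hN : (0 : ℝ) ≤ N := Nat.cast_nonneg N
  unfold clamp
  rcases max_cases (-(N : ℝ)) (min x N) with h | h <;>
  rcases min_cases x (N : ℝ) with h' | h' <;> rw [h.1] <;> try rw [h'.1]
  all_goals nlinarith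

theorem clamp_eventually_eq (x : ℝ) : ∀ᶠ N : ℕ in atTop, clamp N x = x := by
  obtain ⟨M, hM⟩ := exists_nat_ge |x|
  filter_upwards [eventually_ge_atTop M] with N hN
  have h : |x| ≤ N := hM.trans (by exact_mod_cast hN)
  rw [abs_le] at h
  unfold clamp
  rw [min_eq_left h.2, max_eq_right h.1]

theorem tendsto_integral_mul_clamp {α : Type*} [MeasurableSpace α] {μ : Measure α}
    {f g : α → ℝ} (hf : AEStronglyMeasurable f μ) (hg : AEStronglyMeasurable g μ)
    (hfg : Integrable (fun x => g x * f x) μ) :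
    Tendsto (fun N => ∫ x, g x * clamp N (f x) ∂μ) atTop (𝓝 (∫ x, g x * f x ∂μ)) := by
  refine tendsto_integral_of_dominated_convergence (fun x => ‖g x * f x‖)
    (fun N => hg.mul ((measurable_clamp N).comp_aemeasurable hf.aemeasurable).aestronglyMeasurable)
    hfg.norm (fun N => ae_of_all _ fun x => ?_) (ae_of_all _ fun x => ?_)
  · rw [norm_mul, norm_mul]
    exact mul_le_mul_of_nonneg_left (abs_clamp_le_abs N _) (norm_nonneg _)
  · refine tendsto_const_nhds.congr' ?_
    filter_upwards [clamp_eventually_eq (f x)] with N hN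
    rw [hN]

/-! ### Differentiability in quadratic mean -/

section DQM

variable {α : Type*} [MeasurableSpace α]

/-- The square of the product is `F²` times the density. `F` is only `ν`-a.e. equal to a measurable
function, which suffices because the product vanishes where the density does. -/
theorem memLp_mul_sqrt_rnDeriv {ν μ : Measure α} [SigmaFinite ν] [SigmaFinite μ] (h : ν ≪ μ)
    {F : α → ℝ} (hF : MemLp F 2 ν) :
    MemLp (fun x => F x * √(ν.rnDeriv μ x).toReal) 2 μ := by
  set F' := hF.1.mk F with hF'
  have hae : F =ᵐ[ν] F' := hF.1.ae_eq_mk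
  have hm : StronglyMeasurable F' := hF.1.stronglyMeasurable_mk
  have hae' : (fun x => F' x * √(ν.rnDeriv μ x).toReal)
      =ᵐ[μ] fun x => F x * √(ν.rnDeriv μ x).toReal := by
    filter_upwards [Measure.ae_rnDeriv_ne_zero_imp_of_ae (ν := μ) hae] with x hx
    by_cases h0 : ν.rnDeriv μ x = 0
    · simp [h0]
    · rw [hx h0]
  refine MemLp.ae_eq hae' ?_
  have hmeas : Measurable fun x => F' x * √(ν.rnDeriv μ x).toReal :=
    hm.measurable.mul (Measure.measurable_rnDeriv ν μ).ennreal_toReal.sqrt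
  rw [memLp_two_iff_integrable_sq hmeas.aestronglyMeasurable]
  have hint : Integrable (fun x => F' x ^ 2) ν := (hF.ae_eq hae).integrable_sq
  refine ((integrable_rnDeriv_smul_iff h).2 hint).congr (ae_of_all _ fun x => ?_)
  simp only [smul_eq_mul]
  rw [mul_pow, Real.sq_sqrt ENNReal.toReal_nonneg, mul_comm]

theorem integral_mul_sq_sqrt_rnDeriv {ν μ : Measure α} [SigmaFinite ν] [SigmaFinite μ]
    (h : ν ≪ μ) (F : α → ℝ) :
    ∫ x, F x * √(ν.rnDeriv μ x).toReal ^ 2 ∂μ = ∫ x, F x ∂ν := by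
  rw [← integral_rnDeriv_smul h]
  refine integral_congr_ae (ae_of_all _ fun x => ?_)
  simp only [smul_eq_mul]
  rw [Real.sq_sqrt ENNReal.toReal_nonneg, mul_comm]

variable {𝓦 𝓛 : Type*} [MeasurableSpace 𝓦] [MeasurableSpace 𝓛]

/-- This is `hasDerivAt_integral_mul_sq` for the root densities `u t`. A local bound on second
moments replaces boundedness of `f`, so that the unbounded `obsZ` is covered. -/
theorem IsRegularSubmodel.hasDerivAt_integral {P : ProbabilityMeasure (Full 𝓦 𝓛)}
    {Q : ℝ → ProbabilityMeasure (Full 𝓦 𝓛)} {s : Obs 𝓦 𝓛 → ℝ} (hQ : IsRegularSubmodel P Q s)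
    {f : Obs 𝓦 𝓛 → ℝ} (hf : Measurable f) {K : ℝ}
    (hfL : ∀ᶠ t in 𝓝 (0 : ℝ), MemLp f 2 (obsLaw (Q t)))
    (hK : ∀ᶠ t in 𝓝 (0 : ℝ), ∫ x, f x ^ 2 ∂(obsLaw (Q t)) ≤ K) :
    HasDerivAt (fun t => ∫ x, f x ∂(obsLaw (Q t))) (∫ x, f x * s x ∂(obsLaw P)) 0 := by
  obtain ⟨μ, hμ, hac, hR⟩ := hQ.dqm
  have hac0 := hac.self_of_nhds
  have hs : MemLp s 2 (obsLaw (Q 0)) := by rw [hQ.base]; exact hQ.score_memLp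
  have key := hasDerivAt_integral_mul_sq (μ := μ) (f := f) (s := s) (K := K)
    (u := fun t x => √((obsLaw (Q t)).rnDeriv μ x).toReal) hf ?_
    (memLp_mul_sqrt_rnDeriv hac0 hs) ?_ ?_ hR
  · rw [integral_mul_sq_sqrt_rnDeriv hac0, hQ.base] at key
    refine key.congr_of_eventuallyEq ?_
    filter_upwards [hac] with t ht
    rw [integral_mul_sq_sqrt_rnDeriv ht]
  · filter_upwards [hac] with t ht
    simpa using memLp_mul_sqrt_rnDeriv ht (memLp_const (1 : ℝ))
  · filter_upwards [hac, hfL] with t ht hft using memLp_mul_sqrt_rnDeriv ht hft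
  · filter_upwards [hac, hK] with t ht hKt
    simp_rw [mul_pow]
    rwa [integral_mul_sq_sqrt_rnDeriv ht]

theorem IsRegularSubmodel.hasDerivAt_integral_of_bounded {P : ProbabilityMeasure (Full 𝓦 𝓛)}
    {Q : ℝ → ProbabilityMeasure (Full 𝓦 𝓛)} {s : Obs 𝓦 𝓛 → ℝ} (hQ : IsRegularSubmodel P Q s)
    {f : Obs 𝓦 𝓛 → ℝ} (hf : Measurable f) {C : ℝ} (hC : ∀ x, |f x| ≤ C) :
    HasDerivAt (fun t => ∫ x, f x ∂(obsLaw (Q t))) (∫ x, f x * s x ∂(obsLaw P)) 0 := by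
  have hL : ∀ t, MemLp f 2 (obsLaw (Q t)) := fun t =>
    MemLp.of_bound hf.aestronglyMeasurable C (ae_of_all _ hC)
  refine hQ.hasDerivAt_integral hf (K := C ^ 2) (Eventually.of_forall hL)
    (Eventually.of_forall fun t => ?_)
  have h := integral_mono (hL t).integrable_sq (integrable_const (C ^ 2)) fun x => by
    have := hC x
    rw [← sq_abs]
    gcongr
  simpa using h

end DQM

/-! ### Functions of the full data as functions of the observed data -/

section Lifts

variable {𝓦 𝓛 : Type*}

/-- The sign of an arm: `1` for treatment and `-1` for control. -/
def armSign (a : Bool) : ℝ := if a = true then 1 else -1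

/-- `(A, W)`. -/
def armBase (o : Full 𝓦 𝓛) : Bool × 𝓦 := (arm o, baseline o)

/-- `(A, L, W)`. -/
def armShortBase (o : Full 𝓦 𝓛) : Bool × 𝓛 × 𝓦 := (arm o, short o, baseline o)

/-- The indicator `C^L` as a real number. -/
def cL (o : Full 𝓦 𝓛) : ℝ := if seenL o = true then 1 else 0

/-- The indicator `C^Y` as a real number. -/
def cY (o : Full 𝓦 𝓛) : ℝ := if seenY o = true then 1 else 0

/-- A function of `(A, W)` as a function of the observed data. -/
def liftAW (k : Bool × 𝓦 → ℝ) (x : Obs 𝓦 𝓛) : ℝ := k (x.2.1, x.1)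

/-- `C^L` times a function of `(A, L, W)`, as a function of the observed data. -/
def liftALW (k : Bool × 𝓛 × 𝓦 → ℝ) (x : Obs 𝓦 𝓛) : ℝ :=
  Sum.elim (fun l => k (x.2.1, l, x.1)) (fun _ => 0) x.2.2.1

/-- `C^L` as a function of the observed data. -/
def obsCL (x : Obs 𝓦 𝓛) : ℝ := Sum.elim (fun _ => 1) (fun _ => 0) x.2.2.1

/-- `C^Y` as a function of the observed data. -/
def obsCY (x : Obs 𝓦 𝓛) : ℝ := Sum.elim (fun _ => 1) (fun _ => 0) x.2.2.2

/-- `C^Y Y` as a function of the observed data. -/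
def obsY (x : Obs 𝓦 𝓛) : ℝ := Sum.elim (fun y => y) (fun _ => 0) x.2.2.2

theorem cL_mem (o : Full 𝓦 𝓛) : cL o = 0 ∨ cL o = 1 := by
  unfold cL; split <;> simp

theorem cY_mem (o : Full 𝓦 𝓛) : cY o = 0 ∨ cY o = 1 := by
  unfold cY; split <;> simp

theorem abs_cL_le (o : Full 𝓦 𝓛) : |cL o| ≤ 1 := by
  rcases cL_mem o with h | h <;> simp [h]

theorem abs_cY_le (o : Full 𝓦 𝓛) : |cY o| ≤ 1 := by
  rcases cY_mem o with h | h <;> simp [h]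

theorem liftAW_observe (k : Bool × 𝓦 → ℝ) (o : Full 𝓦 𝓛) :
    liftAW k (observe o) = k (armBase o) := rfl

theorem liftALW_observe (k : Bool × 𝓛 × 𝓦 → ℝ) (o : Full 𝓦 𝓛) :
    liftALW k (observe o) = cL o * k (armShortBase o) := by
  unfold liftALW observe cL
  split <;> simp_all [armShortBase]

theorem obsCL_observe (o : Full 𝓦 𝓛) : obsCL (observe o) = cL o := by
  unfold obsCL observe cL
  split <;> simp_all

theorem obsCY_observe (o : Full 𝓦 𝓛) : obsCY (observe o) = cY o := by
  unfold obsCY observe cY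
  split_ifs <;> simp_all

theorem obsY_observe (o : Full 𝓦 𝓛) : obsY (observe o) = cY o * outcome o := by
  unfold obsY observe cY
  split_ifs <;> simp_all

theorem abs_obsCL_le (x : Obs 𝓦 𝓛) : |obsCL x| ≤ 1 := by
  rcases h : x.2.2.1 with l | l <;> simp [obsCL, h]

theorem abs_obsCY_le (x : Obs 𝓦 𝓛) : |obsCY x| ≤ 1 := by
  rcases h : x.2.2.2 with l | l <;> simp [obsCY, h]

theorem abs_liftALW_le {k : Bool × 𝓛 × 𝓦 → ℝ} {C : ℝ} (hC0 : 0 ≤ C) (hC : ∀ z, |k z| ≤ C)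
    (x : Obs 𝓦 𝓛) : |liftALW k x| ≤ C := by
  rcases h : x.2.2.1 with l | l
  · simpa [liftALW, h] using hC _
  · simpa [liftALW, h] using hC0

theorem ite_arm_eq_indicator (a : Bool) (F : Full 𝓦 𝓛 → ℝ) :
    (fun o => if arm o = a then F o else 0) = {o | arm o = a}.indicator F := by
  ext o
  simp [Set.indicator]

variable [MeasurableSpace 𝓦] [MeasurableSpace 𝓛]

theorem measurable_baseline : Measurable (baseline : Full 𝓦 𝓛 → 𝓦) := by
  unfold baseline; fun_prop

theorem measurable_arm : Measurable (arm : Full 𝓦 𝓛 → Bool) := by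
  unfold arm; fun_prop

theorem measurable_short : Measurable (short : Full 𝓦 𝓛 → 𝓛) := by
  unfold short; fun_prop

theorem measurable_outcome : Measurable (outcome : Full 𝓦 𝓛 → ℝ) := by
  unfold outcome; fun_prop

theorem measurable_armBase : Measurable (armBase : Full 𝓦 𝓛 → Bool × 𝓦) :=
  measurable_arm.prodMk measurable_baseline

theorem measurable_armShortBase : Measurable (armShortBase : Full 𝓦 𝓛 → Bool × 𝓛 × 𝓦) :=
  measurable_arm.prodMk (measurable_short.prodMk measurable_baseline)

theorem measurable_armSign : Measurable armSign := measurable_of_finite _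

theorem measurable_ite_snd {β : Type*} [MeasurableSpace β] (φ : Bool × Bool → Bool) :
    Measurable fun o : β × (Bool × Bool) => if φ o.2 = true then (1 : ℝ) else 0 :=
  (measurable_of_finite fun c : Bool × Bool => if φ c = true then (1 : ℝ) else 0).comp
    measurable_snd

theorem measurable_cL : Measurable (cL : Full 𝓦 𝓛 → ℝ) := measurable_ite_snd Prod.fst

theorem measurable_cY : Measurable (cY : Full 𝓦 𝓛 → ℝ) := measurable_ite_snd Prod.snd

/-- Distributing the product over the sum type turns the case distinction into a `Sum.elim` of
measurable functions. -/
theorem measurable_sum_elim_comp {β γ δ : Type*} [MeasurableSpace β] [MeasurableSpace γ]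
    [MeasurableSpace δ] {k : δ × β → ℝ} (hk : Measurable k) {p : γ → δ} (hp : Measurable p)
    {q : γ → β ⊕ Unit} (hq : Measurable q) :
    Measurable fun x => Sum.elim (fun l => k (p x, l)) (fun _ => 0) (q x) := by
  have h : Measurable fun z : δ × (β ⊕ Unit) =>
      Sum.elim (fun l => k (z.1, l)) (fun _ => (0 : ℝ)) z.2 := by
    have h2 : Measurable fun z : (δ × β) ⊕ (δ × Unit) => Sum.elim k (fun _ => (0 : ℝ)) z :=
      hk.sumElim measurable_const
    have h3 := h2.comp (MeasurableEquiv.prodSumDistrib δ β Unit).measurable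
    convert h3 using 1
    ext ⟨d, b | u⟩ <;> rfl
  exact h.comp (hp.prodMk hq)

theorem measurable_liftAW {k : Bool × 𝓦 → ℝ} (hk : Measurable k) :
    Measurable (liftAW k : Obs 𝓦 𝓛 → ℝ) := by
  unfold liftAW; fun_prop

theorem measurable_liftALW {k : Bool × 𝓛 × 𝓦 → ℝ} (hk : Measurable k) :
    Measurable (liftALW k : Obs 𝓦 𝓛 → ℝ) :=
  measurable_sum_elim_comp (k := fun z : (Bool × 𝓦) × 𝓛 => k (z.1.1, z.2, z.1.2)) (by fun_prop)
    (p := fun x : Obs 𝓦 𝓛 => (x.2.1, x.1)) (by fun_prop) (by fun_prop)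

theorem measurable_obsCL : Measurable (obsCL : Obs 𝓦 𝓛 → ℝ) :=
  (measurable_const.sumElim measurable_const).comp (by fun_prop)

theorem measurable_obsCY : Measurable (obsCY : Obs 𝓦 𝓛 → ℝ) :=
  (measurable_const.sumElim measurable_const).comp (by fun_prop)

theorem measurable_obsY : Measurable (obsY : Obs 𝓦 𝓛 → ℝ) :=
  (measurable_id.sumElim measurable_const).comp (by fun_prop)

end Lifts


/-! ### Consequences of independent censoring and randomization -/

section Model

variable {𝓦 𝓛 : Type*} [MeasurableSpace 𝓦] [MeasurableSpace 𝓛]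
  {P : ProbabilityMeasure (Full 𝓦 𝓛)}

theorem integral_obsLaw (P : ProbabilityMeasure (Full 𝓦 𝓛)) {f : Obs 𝓦 𝓛 → ℝ}
    (hf : Measurable f) :
    ∫ x, f x ∂(obsLaw P) = ∫ o, f (observe o) ∂(P : Measure (Full 𝓦 𝓛)) :=
  integral_map measurable_observe.aemeasurable hf.aestronglyMeasurable

theorem memLp_obsLaw {f : Obs 𝓦 𝓛 → ℝ} (hf : Measurable f) {p : ℝ≥0∞} :
    MemLp f p (obsLaw P) ↔ MemLp (fun o => f (observe o)) p (P : Measure (Full 𝓦 𝓛)) :=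
  memLp_map_measure_iff hf.aestronglyMeasurable measurable_observe.aemeasurable

theorem InModel.integral_censor_mul (hP : InModel P) (φ : Bool × Bool → ℝ)
    {u : 𝓦 × Bool × 𝓛 × ℝ → ℝ} (hu : Measurable u) :
    ∫ o, φ o.2 * u o.1 ∂(P : Measure (Full 𝓦 𝓛))
      = (∫ o, φ o.2 ∂(P : Measure (Full 𝓦 𝓛))) * ∫ o, u o.1 ∂(P : Measure (Full 𝓦 𝓛)) := by
  have h := hP.independent_censoring.comp (measurable_of_finite φ) hu
  exact h.integral_mul_eq_mul_integral
    ((measurable_of_finite φ).comp measurable_snd).aestronglyMeasurable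
    (hu.comp measurable_fst).aestronglyMeasurable

theorem InModel.integral_cL_mul (hP : InModel P) {u : 𝓦 × Bool × 𝓛 × ℝ → ℝ} (hu : Measurable u) :
    ∫ o, cL o * u o.1 ∂(P : Measure (Full 𝓦 𝓛))
      = (∫ o, cL o ∂(P : Measure (Full 𝓦 𝓛))) * ∫ o, u o.1 ∂(P : Measure (Full 𝓦 𝓛)) :=
  hP.integral_censor_mul (fun c => if c.1 = true then 1 else 0) hu

theorem InModel.integral_cY_mul (hP : InModel P) {u : 𝓦 × Bool × 𝓛 × ℝ → ℝ} (hu : Measurable u) :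
    ∫ o, cY o * u o.1 ∂(P : Measure (Full 𝓦 𝓛))
      = (∫ o, cY o ∂(P : Measure (Full 𝓦 𝓛))) * ∫ o, u o.1 ∂(P : Measure (Full 𝓦 𝓛)) :=
  hP.integral_censor_mul (fun c => if c.2 = true then 1 else 0) hu

theorem InModel.cY_mul_cL (hP : InModel P) :
    ∀ᵐ o ∂(P : Measure (Full 𝓦 𝓛)), cY o * cL o = cY o := by
  filter_upwards [hP.monotone_censoring] with o ho
  unfold cY cL
  split_ifs <;> simp_all

theorem measurableSet_arm (a : Bool) : MeasurableSet {o : Full 𝓦 𝓛 | arm o = a} :=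
  measurable_arm (measurableSet_singleton a)

theorem integrable_ite_arm (a : Bool) {F : Full 𝓦 𝓛 → ℝ} {μ : Measure (Full 𝓦 𝓛)}
    (hF : Integrable F μ) : Integrable (fun o => if arm o = a then F o else 0) μ := by
  rw [ite_arm_eq_indicator]
  exact hF.indicator (measurableSet_arm a)

theorem InModel.integral_armLaw (hP : InModel P) (a : Bool) (F : Full 𝓦 𝓛 → ℝ) :
    ∫ o, F o ∂(armLaw P a)
      = 2 * ∫ o, (if arm o = a then F o else 0) ∂(P : Measure (Full 𝓦 𝓛)) := by
  have hhalf := hP.randomization_half a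
  have hne : (P : Measure (Full 𝓦 𝓛)) {o | arm o = a} ≠ ∞ := measure_ne_top _ _
  have e : (∫ o, (if arm o = a then F o else 0) ∂(P : Measure (Full 𝓦 𝓛)))
      = ∫ o in {o | arm o = a}, F o ∂(P : Measure (Full 𝓦 𝓛)) := by
    rw [← integral_indicator (measurableSet_arm a), ite_arm_eq_indicator]
  rw [e, armLaw, ProbabilityTheory.cond, integral_smul_measure, ENNReal.toReal_inv,
    ← measureReal_def, hhalf]
  norm_num

theorem InModel.isProbabilityMeasure_armLaw (hP : InModel P) (a : Bool) :
    IsProbabilityMeasure (armLaw P a) := by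
  refine cond_isProbabilityMeasure fun h => ?_
  have := hP.randomization_half a
  rw [measureReal_def, h] at this
  norm_num at this

theorem armLaw_le (P : ProbabilityMeasure (Full 𝓦 𝓛)) (a : Bool) :
    armLaw P a ≤ ((P : Measure (Full 𝓦 𝓛)) {o | arm o = a})⁻¹ • (P : Measure (Full 𝓦 𝓛)) := by
  unfold armLaw ProbabilityTheory.cond
  gcongr
  exact Measure.restrict_le_self

theorem InModel.memLp_armLaw (hP : InModel P) (a : Bool) {F : Full 𝓦 𝓛 → ℝ} {p : ℝ≥0∞}
    (hF : MemLp F p (P : Measure (Full 𝓦 𝓛))) : MemLp F p (armLaw P a) := by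
  refine hF.of_measure_le_smul ?_ (armLaw_le P a)
  intro h
  have := hP.randomization_half a
  rw [ENNReal.inv_eq_top] at h
  rw [measureReal_def, h] at this
  norm_num at this

theorem InModel.integrable_outcome (hP : InModel P) :
    Integrable outcome (P : Measure (Full 𝓦 𝓛)) :=
  hP.outcome_memLp.integrable (by norm_num)

theorem InModel.ate_eq (hP : InModel P) :
    ate P = ∫ o, 2 * armSign (arm o) * outcome o ∂(P : Measure (Full 𝓦 𝓛)) := by
  have hi : ∀ a : Bool, Integrable (fun o => if arm o = a then outcome o else 0)
      (P : Measure (Full 𝓦 𝓛)) := fun a =>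
    integrable_ite_arm a hP.integrable_outcome
  unfold ate
  rw [hP.integral_armLaw, hP.integral_armLaw, ← mul_sub, ← integral_sub (hi _) (hi _),
    ← integral_const_mul]
  refine integral_congr_ae (ae_of_all _ fun o => ?_)
  unfold armSign
  cases h : arm o <;> simp [h]

/-- `E{1(A = a) k(W)} = E{k(W)} / 2`. -/
theorem InModel.integral_ite_arm (hP : InModel P) (a : Bool) {k : 𝓦 → ℝ} (hk : Measurable k) :
    ∫ o, (if arm o = a then k (baseline o) else 0) ∂(P : Measure (Full 𝓦 𝓛))
      = 1 / 2 * ∫ o, k (baseline o) ∂(P : Measure (Full 𝓦 𝓛)) := by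
  have hφ : Measurable fun b : Bool => if b = a then (1 : ℝ) else 0 := measurable_of_finite _
  have h := (hP.randomization_indep.comp hφ hk).integral_mul_eq_mul_integral
    (hφ.comp measurable_arm).aestronglyMeasurable
    (hk.comp measurable_baseline).aestronglyMeasurable
  have e : ∫ o, ((fun b : Bool => if b = a then (1 : ℝ) else 0) ∘ arm) o
      ∂(P : Measure (Full 𝓦 𝓛)) = 1 / 2 := by
    rw [← hP.randomization_half a, ← integral_indicator_one (measurableSet_arm a),
      ← ite_arm_eq_indicator]
    rfl
  rw [e] at h
  rw [← Function.comp_def k baseline, ← h]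
  refine integral_congr_ae (ae_of_all _ fun o => ?_)
  simp

theorem InModel.integral_armLaw_baseline (hP : InModel P) (a : Bool) {k : 𝓦 → ℝ}
    (hk : Measurable k) :
    ∫ o, k (baseline o) ∂(armLaw P a) = ∫ o, k (baseline o) ∂(P : Measure (Full 𝓦 𝓛)) := by
  rw [hP.integral_armLaw, hP.integral_ite_arm a hk]
  ring

/-- This is what lets variances of functions of `W` be computed under the whole population or within
an arm, as needed to mix `Var E_a(Y | W)` with `Var_a(Y)`. -/
theorem InModel.map_baseline_armLaw (hP : InModel P) (a : Bool) :
    (armLaw P a).map baseline = (P : Measure (Full 𝓦 𝓛)).map baseline := by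
  have := hP.isProbabilityMeasure_armLaw a
  ext B hB
  have h := hP.integral_armLaw_baseline a (k := B.indicator 1) (measurable_one.indicator hB)
  have e : ∀ μ : Measure (Full 𝓦 𝓛), ∫ o, (B.indicator (1 : 𝓦 → ℝ)) (baseline o) ∂μ
      = μ.real (baseline ⁻¹' B) := fun μ => by
    rw [← integral_indicator_one (measurable_baseline hB)]
    rfl
  rw [e, e, measureReal_def, measureReal_def,
    ENNReal.toReal_eq_toReal_iff' (measure_ne_top _ _) (measure_ne_top _ _)] at h
  rwa [Measure.map_apply measurable_baseline hB, Measure.map_apply measurable_baseline hB]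

theorem InModel.memLp_baseline_iff (hP : InModel P) (a : Bool) {k : 𝓦 → ℝ} (hk : Measurable k)
    {p : ℝ≥0∞} : MemLp (fun o => k (baseline o)) p (armLaw P a)
      ↔ MemLp (fun o => k (baseline o)) p (P : Measure (Full 𝓦 𝓛)) := by
  have h1 := memLp_map_measure_iff (p := p) (μ := armLaw P a) hk.aestronglyMeasurable
    measurable_baseline.aemeasurable
  have h2 := memLp_map_measure_iff (p := p) (μ := (P : Measure (Full 𝓦 𝓛)))
    hk.aestronglyMeasurable measurable_baseline.aemeasurable
  rw [hP.map_baseline_armLaw] at h1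
  exact h1.symm.trans h2

/-- Randomization in the form of a linear identity between means. Its derivative along a submodel is
`score_ortho_arm`. -/
theorem InModel.integral_armBase (hP : InModel P) {k : Bool × 𝓦 → ℝ} (hk : Measurable k)
    (hi : ∀ a, Integrable (fun o => k (a, baseline o)) (P : Measure (Full 𝓦 𝓛))) :
    ∫ o, k (armBase o) ∂(P : Measure (Full 𝓦 𝓛))
      = 1 / 2 * ∫ o, (k (true, baseline o) + k (false, baseline o))
          ∂(P : Measure (Full 𝓦 𝓛)) := by
  have hi' : ∀ a, Integrable (fun o => if arm o = a then k (a, baseline o) else 0)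
      (P : Measure (Full 𝓦 𝓛)) := fun a => integrable_ite_arm a (hi a)
  rw [integral_add (hi _) (hi _), mul_add,
    ← hP.integral_ite_arm true (k := fun w => k (true, w)) (by fun_prop),
    ← hP.integral_ite_arm false (k := fun w => k (false, w)) (by fun_prop),
    ← integral_add (hi' _) (hi' _)]
  refine integral_congr_ae (ae_of_all _ fun o => ?_)
  unfold armBase
  cases h : arm o <;> simp [h]

theorem memLp_armBase {k : Bool × 𝓦 → ℝ} (hk : Measurable k) {p : ℝ≥0∞}
    (hi : ∀ a, MemLp (fun o => k (a, baseline o)) p (P : Measure (Full 𝓦 𝓛))) :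
    MemLp (fun o => k (armBase o)) p (P : Measure (Full 𝓦 𝓛)) := by
  refine ((hi true).norm.add (hi false).norm).mono
    (hk.comp measurable_armBase).aestronglyMeasurable (ae_of_all _ fun o => ?_)
  unfold armBase
  simp only [Pi.add_apply, Real.norm_eq_abs]
  rw [abs_of_nonneg (a := |_| + |_|) (by positivity)]
  cases arm o
  · exact le_add_of_nonneg_left (abs_nonneg _)
  · exact le_add_of_nonneg_right (abs_nonneg _)

end Model

theorem memLp_mul_of_abs_le_one {α : Type*} [MeasurableSpace α] {μ : Measure α} {p : ℝ≥0∞}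
    {c f : α → ℝ} (hc : Measurable c) (hc1 : ∀ x, |c x| ≤ 1) (hf : MemLp f p μ) :
    MemLp (fun x => c x * f x) p μ := by
  refine hf.mono (hc.aestronglyMeasurable.mul hf.aestronglyMeasurable) (ae_of_all _ fun x => ?_)
  rw [norm_mul]
  exact mul_le_of_le_one_left (norm_nonneg _) (hc1 x)

/-! ### The signed outcome and its conditional means -/

variable {𝓦 𝓛 : Type*}

/-- `Z = 2 (2A - 1) Y`, whose mean is the average treatment effect. -/
def signedOutcome (o : Full 𝓦 𝓛) : ℝ := 2 * armSign (arm o) * outcome o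

/-- `C^Y Z` as a function of the observed data. -/
def obsZ (x : Obs 𝓦 𝓛) : ℝ := 2 * armSign x.2.1 * obsY x

theorem obsZ_observe (o : Full 𝓦 𝓛) : obsZ (observe o) = cY o * signedOutcome o := by
  unfold obsZ signedOutcome
  rw [obsY_observe]
  simp only [observe]
  ring

theorem abs_signedOutcome (o : Full 𝓦 𝓛) : |signedOutcome o| = 2 * |outcome o| := by
  unfold signedOutcome armSign
  split <;> simp [abs_mul]

theorem liftALW_clamp (N : ℕ) (k : Bool × 𝓛 × 𝓦 → ℝ) (x : Obs 𝓦 𝓛) :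
    liftALW (fun z => clamp N (k z)) x = clamp N (liftALW k x) := by
  rcases h : x.2.2.1 with l | l <;> simp [liftALW, h, clamp_zero]

variable [MeasurableSpace 𝓦] [MeasurableSpace 𝓛]
  {P : ProbabilityMeasure (Full 𝓦 𝓛)}

theorem measurable_signedOutcome : Measurable (signedOutcome : Full 𝓦 𝓛 → ℝ) :=
  (measurable_const.mul (measurable_armSign.comp measurable_arm)).mul measurable_outcome

theorem measurable_obsZ : Measurable (obsZ : Obs 𝓦 𝓛 → ℝ) :=
  (measurable_const.mul (measurable_armSign.comp (by fun_prop))).mul measurable_obsY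

theorem InModel.memLp_signedOutcome (hP : InModel P) :
    MemLp signedOutcome 2 (P : Measure (Full 𝓦 𝓛)) := by
  refine (hP.outcome_memLp.const_mul 2).mono measurable_signedOutcome.aestronglyMeasurable
    (ae_of_all _ fun o => ?_)
  simp [abs_signedOutcome]

theorem InModel.ate_eq_integral_signedOutcome (hP : InModel P) :
    ate P = ∫ o, signedOutcome o ∂(P : Measure (Full 𝓦 𝓛)) := hP.ate_eq

/-- `G` and `H` are versions of the conditional means of `Z` given `(A, W)` and `(A, L, W)`. -/
structure IsNuisance (P : ProbabilityMeasure (Full 𝓦 𝓛)) (G : Bool × 𝓦 → ℝ)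
    (H : Bool × 𝓛 × 𝓦 → ℝ) : Prop where
  measurable_left : Measurable G
  measurable_right : Measurable H
  memLp_left : ∀ a, MemLp (fun o => G (a, baseline o)) 2 (P : Measure (Full 𝓦 𝓛))
  memLp_right : MemLp (fun o => H (armShortBase o)) 2 (P : Measure (Full 𝓦 𝓛))
  ortho_left : ∀ m : Bool × 𝓦 → ℝ, Measurable m →
    MemLp (fun o => m (armBase o)) 2 (P : Measure (Full 𝓦 𝓛)) →
      ∫ o, (signedOutcome o - G (armBase o)) * m (armBase o) ∂(P : Measure (Full 𝓦 𝓛)) = 0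
  ortho_right : ∀ m : Bool × 𝓛 × 𝓦 → ℝ, Measurable m →
    MemLp (fun o => m (armShortBase o)) 2 (P : Measure (Full 𝓦 𝓛)) →
      ∫ o, (signedOutcome o - H (armShortBase o)) * m (armShortBase o)
        ∂(P : Measure (Full 𝓦 𝓛)) = 0

/-! ### Identities satisfied by the scores of regular submodels -/

section Scores

variable {Q : ℝ → ProbabilityMeasure (Full 𝓦 𝓛)} {s : Obs 𝓦 𝓛 → ℝ}

theorem IsRegularSubmodel.base_inModel (hQ : IsRegularSubmodel P Q s) : InModel P := by
  have := hQ.mem_model.self_of_nhds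
  rwa [hQ.base] at this

/-- The censoring constraints equate two products of means throughout the model; the product rule at
`t = 0` differentiates both sides. -/
theorem IsRegularSubmodel.score_mul_eq (hQ : IsRegularSubmodel P Q s)
    {f₁ f₂ c₁ c₂ : Obs 𝓦 𝓛 → ℝ} (hf₁ : Measurable f₁) (hf₂ : Measurable f₂)
    (hc₁ : Measurable c₁) (hc₂ : Measurable c₂) {C : ℝ} (bf₁ : ∀ x, |f₁ x| ≤ C)
    (bf₂ : ∀ x, |f₂ x| ≤ C) (bc₁ : ∀ x, |c₁ x| ≤ 1) (bc₂ : ∀ x, |c₂ x| ≤ 1)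
    (h : ∀ R : ProbabilityMeasure (Full 𝓦 𝓛), InModel R →
      (∫ x, f₁ x ∂(obsLaw R)) * ∫ x, c₂ x ∂(obsLaw R)
        = (∫ x, f₂ x ∂(obsLaw R)) * ∫ x, c₁ x ∂(obsLaw R)) :
    (∫ x, f₁ x * s x ∂(obsLaw P)) * (∫ x, c₂ x ∂(obsLaw P))
        + (∫ x, f₁ x ∂(obsLaw P)) * (∫ x, c₂ x * s x ∂(obsLaw P))
      = (∫ x, f₂ x * s x ∂(obsLaw P)) * (∫ x, c₁ x ∂(obsLaw P))
        + (∫ x, f₂ x ∂(obsLaw P)) * (∫ x, c₁ x * s x ∂(obsLaw P)) := by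
  have h1 := (hQ.hasDerivAt_integral_of_bounded hf₁ bf₁).mul
    (hQ.hasDerivAt_integral_of_bounded hc₂ bc₂)
  have h2 := (hQ.hasDerivAt_integral_of_bounded hf₂ bf₂).mul
    (hQ.hasDerivAt_integral_of_bounded hc₁ bc₁)
  rw [hQ.base] at h1 h2
  refine h1.unique (h2.congr_of_eventuallyEq ?_)
  filter_upwards [hQ.mem_model] with t ht using h _ ht

/-- The total mass is constant along the submodel. -/
theorem IsRegularSubmodel.integral_score (hQ : IsRegularSubmodel P Q s) :
    ∫ x, s x ∂(obsLaw P) = 0 := by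
  have h := hQ.hasDerivAt_integral_of_bounded (f := fun _ => 1) measurable_const (C := 1)
    (fun _ => by simp)
  simp only [one_mul, integral_const, probReal_univ, smul_eq_mul] at h
  exact h.unique (hasDerivAt_const _ _)

theorem integral_obsCL (P : ProbabilityMeasure (Full 𝓦 𝓛)) :
    ∫ x, obsCL x ∂(obsLaw P) = ∫ o, cL o ∂(P : Measure (Full 𝓦 𝓛)) := by
  simp_rw [integral_obsLaw P measurable_obsCL, obsCL_observe]

theorem integral_obsCY (P : ProbabilityMeasure (Full 𝓦 𝓛)) :
    ∫ x, obsCY x ∂(obsLaw P) = ∫ o, cY o ∂(P : Measure (Full 𝓦 𝓛)) := by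
  simp_rw [integral_obsLaw P measurable_obsCY, obsCY_observe]

theorem integral_liftAW (P : ProbabilityMeasure (Full 𝓦 𝓛)) {k : Bool × 𝓦 → ℝ}
    (hk : Measurable k) :
    ∫ x, liftAW k x ∂(obsLaw P) = ∫ o, k (armBase o) ∂(P : Measure (Full 𝓦 𝓛)) := by
  simp_rw [integral_obsLaw P (measurable_liftAW hk), liftAW_observe]

theorem InModel.integral_liftALW (hP : InModel P) {k : Bool × 𝓛 × 𝓦 → ℝ} (hk : Measurable k) :
    ∫ x, liftALW k x ∂(obsLaw P)
      = (∫ o, cL o ∂(P : Measure (Full 𝓦 𝓛))) * ∫ o, k (armShortBase o)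
        ∂(P : Measure (Full 𝓦 𝓛)) := by
  simp_rw [integral_obsLaw P (measurable_liftALW hk), liftALW_observe]
  exact hP.integral_cL_mul (u := fun z => k (z.2.1, z.2.2.1, z.1)) (by fun_prop)

theorem InModel.integral_obsCY_mul_liftALW (hP : InModel P) {k : Bool × 𝓛 × 𝓦 → ℝ}
    (hk : Measurable k) :
    ∫ x, obsCY x * liftALW k x ∂(obsLaw P)
      = (∫ o, cY o ∂(P : Measure (Full 𝓦 𝓛))) * ∫ o, k (armShortBase o)
        ∂(P : Measure (Full 𝓦 𝓛)) := by
  simp_rw [integral_obsLaw P (f := fun x => obsCY x * liftALW k x)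
    (measurable_obsCY.mul (measurable_liftALW hk)), liftALW_observe,
    obsCY_observe]
  refine Eq.trans ?_
    (hP.integral_cY_mul (u := fun z => k (z.2.1, z.2.2.1, z.1)) (by fun_prop))
  refine integral_congr_ae ?_
  -- By monotone censoring, `C^Y` absorbs the factor `C^L` contained in `liftALW`.
  filter_upwards [hP.cY_mul_cL] with o ho
  rw [← mul_assoc, ho]
  rfl

theorem InModel.integral_obsCL_mul_liftAW (hP : InModel P) {k : Bool × 𝓦 → ℝ}
    (hk : Measurable k) :
    ∫ x, obsCL x * liftAW k x ∂(obsLaw P)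
      = (∫ o, cL o ∂(P : Measure (Full 𝓦 𝓛))) * ∫ o, k (armBase o)
        ∂(P : Measure (Full 𝓦 𝓛)) := by
  simp_rw [integral_obsLaw P (f := fun x => obsCL x * liftAW k x)
    (measurable_obsCL.mul (measurable_liftAW hk)), liftAW_observe,
    obsCL_observe]
  exact hP.integral_cL_mul (u := fun z => k (z.2.1, z.1)) (by fun_prop)

/-- Here `Δ` is identified from the observed data. The derivative of `Δ` along a submodel is
obtained from this equation. -/
theorem InModel.integral_obsZ (hP : InModel P) :
    ∫ x, obsZ x ∂(obsLaw P) = (∫ o, cY o ∂(P : Measure (Full 𝓦 𝓛))) * ate P := by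
  simp_rw [integral_obsLaw P measurable_obsZ, obsZ_observe]
  rw [hP.ate_eq_integral_signedOutcome]
  exact hP.integral_cY_mul (u := fun z => 2 * armSign z.2.1 * z.2.2.2)
    ((measurable_const.mul (measurable_armSign.comp (by fun_prop))).mul (by fun_prop))

theorem memLp_liftAW {k : Bool × 𝓦 → ℝ} (hk : Measurable k) {p : ℝ≥0∞}
    (h : MemLp (fun o => k (armBase o)) p (P : Measure (Full 𝓦 𝓛))) :
    MemLp (liftAW k) p (obsLaw P) :=
  (memLp_obsLaw (measurable_liftAW hk)).2 h

theorem memLp_liftALW {k : Bool × 𝓛 × 𝓦 → ℝ} (hk : Measurable k) {p : ℝ≥0∞}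
    (h : MemLp (fun o => k (armShortBase o)) p (P : Measure (Full 𝓦 𝓛))) :
    MemLp (liftALW k) p (obsLaw P) := by
  rw [memLp_obsLaw (measurable_liftALW hk)]
  simp_rw [liftALW_observe]
  exact memLp_mul_of_abs_le_one measurable_cL abs_cL_le h

theorem InModel.memLp_obsZ (hP : InModel P) : MemLp obsZ 2 (obsLaw P) := by
  rw [memLp_obsLaw measurable_obsZ]
  simp_rw [obsZ_observe]
  exact memLp_mul_of_abs_le_one measurable_cY abs_cY_le hP.memLp_signedOutcome

theorem tendsto_integral_clamp {α : Type*} [MeasurableSpace α] {μ : Measure α}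
    {f : α → ℝ} (hf : Integrable f μ) :
    Tendsto (fun N => ∫ x, clamp N (f x) ∂μ) atTop (𝓝 (∫ x, f x ∂μ)) := by
  have := tendsto_integral_mul_clamp (g := fun _ => (1 : ℝ)) hf.aestronglyMeasurable
    aestronglyMeasurable_const (by simpa using hf)
  simpa using this

/-- Limit passage from bounded functions to square integrable ones in `∫ c f s`. -/
theorem tendsto_integral_mul_clamp_mul {α : Type*} [MeasurableSpace α] {μ : Measure α}
    {c f s : α → ℝ} (hc : Measurable c) (hc1 : ∀ x, |c x| ≤ 1) (hf : MemLp f 2 μ)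
    (hs : MemLp s 2 μ) :
    Tendsto (fun N => ∫ x, c x * clamp N (f x) * s x ∂μ) atTop
      (𝓝 (∫ x, c x * f x * s x ∂μ)) := by
  have hcs := memLp_mul_of_abs_le_one hc hc1 hs
  have h := tendsto_integral_mul_clamp hf.aestronglyMeasurable hcs.aestronglyMeasurable
    (integrable_mul_of_memLp_two hcs hf)
  have e : ∀ a b d : ℝ, a * d * b = a * b * d := fun a b d => by ring
  simpa only [e] using h

/-- In every regular submodel the score is compatible with the independence of `C^Y` and
`(A, L, W)` relative to `C^L`. -/
theorem IsRegularSubmodel.score_ortho_short (hQ : IsRegularSubmodel P Q s)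
    {k : Bool × 𝓛 × 𝓦 → ℝ} (hk : Measurable k)
    (hkL : MemLp (fun o => k (armShortBase o)) 2 (P : Measure (Full 𝓦 𝓛))) :
    (∫ x, obsCY x * liftALW k x * s x ∂(obsLaw P)) * (∫ o, cL o ∂(P : Measure (Full 𝓦 𝓛)))
        + (∫ o, cY o ∂(P : Measure (Full 𝓦 𝓛)))
          * (∫ o, k (armShortBase o) ∂(P : Measure (Full 𝓦 𝓛)))
          * (∫ x, obsCL x * s x ∂(obsLaw P))
      = (∫ x, liftALW k x * s x ∂(obsLaw P)) * (∫ o, cY o ∂(P : Measure (Full 𝓦 𝓛)))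
        + (∫ o, cL o ∂(P : Measure (Full 𝓦 𝓛)))
          * (∫ o, k (armShortBase o) ∂(P : Measure (Full 𝓦 𝓛)))
          * (∫ x, obsCY x * s x ∂(obsLaw P)) := by
  have hs := hQ.score_memLp
  have hlk := memLp_liftALW hk hkL
  have t1 := tendsto_integral_mul_clamp_mul measurable_obsCY abs_obsCY_le hlk hs
  have t2 := tendsto_integral_mul_clamp_mul (c := fun _ => (1 : ℝ)) measurable_const
    (fun _ => by simp) hlk hs
  have t3 := tendsto_integral_clamp (hkL.integrable (by norm_num))
  simp only [one_mul] at t2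
  refine tendsto_nhds_unique
    ((t1.mul_const _).add ((t3.const_mul _).mul_const _))
    (((t2.mul_const _).add ((t3.const_mul _).mul_const _)).congr fun N => ?_)
  have hkN : Measurable fun z => clamp N (k z) := (measurable_clamp N).comp hk
  have bN : ∀ x : Obs 𝓦 𝓛, |liftALW (fun z => clamp N (k z)) x| ≤ N :=
    abs_liftALW_le (Nat.cast_nonneg N) fun z => abs_clamp_le N _
  -- The constraint differentiated here is `E(C^Y k) E(C^L) = E(C^L k) E(C^Y)`. It is applied to the
  -- truncated `k`; truncation commutes with the factor `C^L` because `clamp N 0 = 0`.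
  have key := hQ.score_mul_eq (f₁ := fun x => obsCY x * liftALW (fun z => clamp N (k z)) x)
    (f₂ := liftALW fun z => clamp N (k z)) (c₁ := obsCY) (c₂ := obsCL) (C := N)
    (measurable_obsCY.mul (measurable_liftALW hkN)) (measurable_liftALW hkN) measurable_obsCY
    measurable_obsCL (fun x => by
      rw [abs_mul]
      exact (mul_le_of_le_one_left (abs_nonneg _) (abs_obsCY_le x)).trans (bN x)) bN
    abs_obsCY_le abs_obsCL_le (fun R hR => by
      rw [hR.integral_obsCY_mul_liftALW hkN, hR.integral_liftALW hkN, integral_obsCL,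
        integral_obsCY]
      ring)
  have hP := hQ.base_inModel
  rw [hP.integral_obsCY_mul_liftALW hkN, hP.integral_liftALW hkN, integral_obsCL,
    integral_obsCY] at key
  simp only [liftALW_clamp] at key
  linarith

/-- In every regular submodel the score is compatible with the independence of `C^L` and
`(A, W)`. -/
theorem IsRegularSubmodel.score_ortho_base (hQ : IsRegularSubmodel P Q s)
    {k : Bool × 𝓦 → ℝ} (hk : Measurable k)
    (hkL : MemLp (fun o => k (armBase o)) 2 (P : Measure (Full 𝓦 𝓛))) :
    ∫ x, obsCL x * liftAW k x * s x ∂(obsLaw P)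
      = (∫ x, liftAW k x * s x ∂(obsLaw P)) * (∫ o, cL o ∂(P : Measure (Full 𝓦 𝓛)))
        + (∫ o, k (armBase o) ∂(P : Measure (Full 𝓦 𝓛)))
          * (∫ x, obsCL x * s x ∂(obsLaw P)) := by
  have hs := hQ.score_memLp
  have hlk := memLp_liftAW hk hkL
  have t1 := tendsto_integral_mul_clamp_mul measurable_obsCL abs_obsCL_le hlk hs
  have t2 := tendsto_integral_mul_clamp_mul (c := fun _ => (1 : ℝ)) measurable_const
    (fun _ => by simp) hlk hs
  have t3 := tendsto_integral_clamp (hkL.integrable (by norm_num))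
  simp only [one_mul] at t2
  refine tendsto_nhds_unique t1
    (((t2.mul_const _).add (t3.mul_const _)).congr fun N => ?_)
  have hkN : Measurable fun z => clamp N (k z) := (measurable_clamp N).comp hk
  have bN : ∀ x : Obs 𝓦 𝓛, |liftAW (fun z => clamp N (k z)) x| ≤ N :=
    fun x => abs_clamp_le N _
  -- The constraint is `E(C^L k) = E(k) E(C^L)`; the constant `c₂ = 1` brings it into product form.
  have key := hQ.score_mul_eq (f₁ := fun x => obsCL x * liftAW (fun z => clamp N (k z)) x)
    (f₂ := liftAW fun z => clamp N (k z)) (c₁ := obsCL) (c₂ := fun _ => 1) (C := N)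
    (measurable_obsCL.mul (measurable_liftAW hkN)) (measurable_liftAW hkN) measurable_obsCL
    measurable_const (fun x => by
      rw [abs_mul]
      exact (mul_le_of_le_one_left (abs_nonneg _) (abs_obsCL_le x)).trans (bN x)) bN
    abs_obsCL_le (fun _ => by simp) (fun R hR => by
      rw [hR.integral_obsCL_mul_liftAW hkN, integral_liftAW R hkN, integral_obsCL]
      simp
      ring)
  have hP := hQ.base_inModel
  rw [hP.integral_obsCL_mul_liftAW hkN, integral_liftAW P hkN, integral_obsCL] at key
  simp only [one_mul, hQ.integral_score, integral_const, probReal_univ, smul_eq_mul, mul_one,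
    mul_zero, add_zero] at key
  exact key.symm

/-- In every regular submodel the score is compatible with 1:1 randomization. -/
theorem IsRegularSubmodel.score_ortho_arm (hQ : IsRegularSubmodel P Q s)
    {k : Bool × 𝓦 → ℝ} (hk : Measurable k)
    (hkL : ∀ a, MemLp (fun o => k (a, baseline o)) 2 (P : Measure (Full 𝓦 𝓛))) :
    2 * ∫ x, liftAW k x * s x ∂(obsLaw P)
      = (∫ x, liftAW (fun z => k (true, z.2)) x * s x ∂(obsLaw P))
        + ∫ x, liftAW (fun z => k (false, z.2)) x * s x ∂(obsLaw P) := by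
  have hs := hQ.score_memLp
  have hka : ∀ a, Measurable fun z : Bool × 𝓦 => k (a, z.2) := fun a => by fun_prop
  have hone : ∀ x : Obs 𝓦 𝓛, |(fun _ => (1 : ℝ)) x| ≤ 1 := fun _ => by simp
  have t0 := tendsto_integral_mul_clamp_mul (c := fun _ => (1 : ℝ)) measurable_const hone
    (memLp_liftAW hk (memLp_armBase hk hkL)) hs
  have ta := fun a => tendsto_integral_mul_clamp_mul (c := fun _ => (1 : ℝ)) measurable_const hone
    (memLp_liftAW (hka a) (hkL a)) hs
  simp only [one_mul] at t0 ta
  refine tendsto_nhds_unique (t0.const_mul 2) (((ta true).add (ta false)).congr fun N => ?_)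
  have hkN : Measurable fun z => clamp N (k z) := (measurable_clamp N).comp hk
  have hkaN : ∀ a, Measurable fun z : Bool × 𝓦 => clamp N (k (a, z.2)) := fun a =>
    (measurable_clamp N).comp (hka a)
  have d0 := (hQ.hasDerivAt_integral_of_bounded (measurable_liftAW hkN)
    (fun x => abs_clamp_le N _)).const_mul 2
  have da := fun a => hQ.hasDerivAt_integral_of_bounded (measurable_liftAW (hkaN a))
    (fun x => abs_clamp_le N _)
  refine ((da true).add (da false)).unique (d0.congr_of_eventuallyEq ?_)
  filter_upwards [hQ.mem_model] with t ht
  have hi : ∀ a, Integrable (fun o => clamp N (k (a, baseline o)))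
      (Q t : Measure (Full 𝓦 𝓛)) := fun a =>
    Integrable.of_bound ((hkaN a).comp measurable_armBase).aestronglyMeasurable N
      (ae_of_all _ fun o => abs_clamp_le N _)
  have h := ht.integral_armBase hkN hi
  rw [integral_add (hi _) (hi _)] at h
  simp only [Pi.add_apply]
  rw [integral_liftAW _ hkN, integral_liftAW _ (hkaN true), integral_liftAW _ (hkaN false), h]
  simp only [armBase]
  ring

/-- The derivative of the average treatment effect in a regular submodel, from the participants
whose primary outcome has been observed. -/
theorem IsRegularSubmodel.cY_mul_deriv_ate (hQ : IsRegularSubmodel P Q s) {d : ℝ}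
    (hd : HasDerivAt (fun t => ate (Q t)) d 0) :
    (∫ o, cY o ∂(P : Measure (Full 𝓦 𝓛))) * d
      = (∫ x, obsZ x * s x ∂(obsLaw P)) - ate P * ∫ x, obsCY x * s x ∂(obsLaw P) := by
  obtain ⟨K, hK⟩ := hQ.moment
  have h1 : HasDerivAt (fun t => ∫ x, obsZ x ∂(obsLaw (Q t)))
      (∫ x, obsZ x * s x ∂(obsLaw P)) 0 := by
    -- The constant comes from `|Z| = 2 |Y|`. The locally bounded second moment of `Y` along the
    -- submodel enters here.
    refine hQ.hasDerivAt_integral (K := 4 * K) measurable_obsZ ?_ ?_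
    · filter_upwards [hQ.mem_model] with t ht using ht.memLp_obsZ
    · filter_upwards [hQ.mem_model, hK] with t ht hKt
      rw [integral_obsLaw _ (measurable_obsZ.pow_const 2)]
      refine le_trans ?_ (mul_le_mul_of_nonneg_left hKt (by norm_num))
      rw [← integral_const_mul]
      refine integral_mono ?_ (ht.outcome_memLp.integrable_sq.const_mul 4) fun o => ?_
      · exact ((memLp_obsLaw measurable_obsZ).1 ht.memLp_obsZ).integrable_sq
      · simp only [obsZ_observe]
        rw [mul_pow, ← sq_abs (signedOutcome o), abs_signedOutcome, mul_pow, sq_abs]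
        rcases cY_mem o with h | h <;> rw [h] <;> nlinarith [sq_nonneg (outcome o)]
  have h2 := (hQ.hasDerivAt_integral_of_bounded measurable_obsCY abs_obsCY_le).mul hd
  rw [hQ.base, integral_obsCY] at h2
  have h3 := h1.unique (h2.congr_of_eventuallyEq ?_)
  · rw [h3]; ring
  · filter_upwards [hQ.mem_model] with t ht
    rw [ht.integral_obsZ]
    simp only [Pi.mul_apply, integral_obsCY]

end Scores

/-! ### The efficient influence function and the upper bound -/

variable {𝓦 𝓛 : Type*} [MeasurableSpace 𝓦] [MeasurableSpace 𝓛]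
  {P : ProbabilityMeasure (Full 𝓦 𝓛)}

/-- The baseline part `E_1(Y | W) - E_0(Y | W) - Δ` of the efficient influence function. -/
def effBase (P : ProbabilityMeasure (Full 𝓦 𝓛)) (G : Bool × 𝓦 → ℝ) (w : 𝓦) : ℝ :=
  (G (true, w) + G (false, w)) / 2 - ate P

/-- The semiparametric lower bound. -/
def effBound (P : ProbabilityMeasure (Full 𝓦 𝓛)) (G : Bool × 𝓦 → ℝ)
    (H : Bool × 𝓛 × 𝓦 → ℝ) : ℝ :=
  (∫ o, effBase P G (baseline o) ^ 2 ∂(P : Measure (Full 𝓦 𝓛)))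
    + (∫ o, (H (armShortBase o) - G (armBase o)) ^ 2 ∂(P : Measure (Full 𝓦 𝓛)))
      / (∫ o, cL o ∂(P : Measure (Full 𝓦 𝓛)))
    + (∫ o, (signedOutcome o - H (armShortBase o)) ^ 2 ∂(P : Measure (Full 𝓦 𝓛)))
      / (∫ o, cY o ∂(P : Measure (Full 𝓦 𝓛)))

/-- The efficient influence function. -/
def effInfluence (P : ProbabilityMeasure (Full 𝓦 𝓛)) (G : Bool × 𝓦 → ℝ)
    (H : Bool × 𝓛 × 𝓦 → ℝ) (x : Obs 𝓦 𝓛) : ℝ :=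
  effBase P G x.1
    + (∫ o, cL o ∂(P : Measure (Full 𝓦 𝓛)))⁻¹ * (liftALW H x - obsCL x * liftAW G x)
    + (∫ o, cY o ∂(P : Measure (Full 𝓦 𝓛)))⁻¹ * (obsZ x - obsCY x * liftALW H x)

namespace IsNuisance

variable {G : Bool × 𝓦 → ℝ} {H : Bool × 𝓛 × 𝓦 → ℝ}

theorem memLp_armBase (hN : IsNuisance P G H) :
    MemLp (fun o => G (armBase o)) 2 (P : Measure (Full 𝓦 𝓛)) :=
  Trial.memLp_armBase hN.measurable_left hN.memLp_left

theorem integral_left (hN : IsNuisance P G H) (hP : InModel P) :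
    ∫ o, G (armBase o) ∂(P : Measure (Full 𝓦 𝓛)) = ate P := by
  have h := hN.ortho_left (fun _ => 1) measurable_const (memLp_const _)
  simp only [mul_one] at h
  rw [integral_sub (hP.memLp_signedOutcome.integrable (by norm_num))
    (hN.memLp_armBase.integrable (by norm_num))] at h
  rw [hP.ate_eq_integral_signedOutcome]
  linarith

theorem integral_right (hN : IsNuisance P G H) (hP : InModel P) :
    ∫ o, H (armShortBase o) ∂(P : Measure (Full 𝓦 𝓛)) = ate P := by
  have h := hN.ortho_right (fun _ => 1) measurable_const (memLp_const _)
  simp only [mul_one] at h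
  rw [integral_sub (hP.memLp_signedOutcome.integrable (by norm_num))
    (hN.memLp_right.integrable (by norm_num))] at h
  rw [hP.ate_eq_integral_signedOutcome]
  linarith

theorem measurable_effBase (hN : IsNuisance P G H) : Measurable (effBase P G) := by
  have := hN.measurable_left
  unfold effBase; fun_prop

theorem memLp_effBase (hN : IsNuisance P G H) :
    MemLp (fun o => effBase P G (baseline o)) 2 (P : Measure (Full 𝓦 𝓛)) := by
  have := (((hN.memLp_left true).add (hN.memLp_left false)).const_mul (1 / 2)).sub
    (memLp_const (ate P))
  convert this using 2 with o
  simp [effBase]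
  ring

theorem integral_effBase (hN : IsNuisance P G H) (hP : InModel P) :
    ∫ o, effBase P G (baseline o) ∂(P : Measure (Full 𝓦 𝓛)) = 0 := by
  have i := fun a => (hN.memLp_left a).integrable one_le_two
  have h := hP.integral_armBase hN.measurable_left i
  rw [hN.integral_left hP] at h
  simp only [effBase]
  rw [integral_sub (((i true).fun_add (i false)).div_const 2) (integrable_const _), integral_div]
  simp only [integral_const, probReal_univ, one_smul]
  linarith

theorem memLp_residual_short (hN : IsNuisance P G H) :
    MemLp (fun o => H (armShortBase o) - G (armBase o)) 2 (P : Measure (Full 𝓦 𝓛)) :=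
  hN.memLp_right.sub hN.memLp_armBase

theorem memLp_residual_outcome (hN : IsNuisance P G H) (hP : InModel P) :
    MemLp (fun o => signedOutcome o - H (armShortBase o)) 2 (P : Measure (Full 𝓦 𝓛)) :=
  hP.memLp_signedOutcome.sub hN.memLp_right

/-- `H - G` is the difference of the residuals `Z - G` and `Z - H`, and both are orthogonal to
functions of `(A, W)`. -/
theorem ortho_short (hN : IsNuisance P G H) (hP : InModel P) {m : Bool × 𝓦 → ℝ}
    (hm : Measurable m) (hmL : MemLp (fun o => m (armBase o)) 2 (P : Measure (Full 𝓦 𝓛))) :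
    ∫ o, (H (armShortBase o) - G (armBase o)) * m (armBase o) ∂(P : Measure (Full 𝓦 𝓛)) = 0 := by
  have h1 := hN.ortho_left m hm hmL
  have h2 : ∫ o, (signedOutcome o - H (armShortBase o)) * m (armBase o)
      ∂(P : Measure (Full 𝓦 𝓛)) = 0 :=
    hN.ortho_right (fun z => m (z.1, z.2.2)) (by fun_prop) hmL
  have i1 := integrable_mul_of_memLp_two (hP.memLp_signedOutcome.sub hN.memLp_armBase) hmL
  have i2 := integrable_mul_of_memLp_two (hN.memLp_residual_outcome hP) hmL
  have h3 := integral_sub i1 i2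
  simp only [Pi.sub_apply] at h3
  rw [h1, h2, sub_zero] at h3
  rw [← h3]
  refine integral_congr_ae (ae_of_all _ fun o => ?_)
  simp only
  ring

end IsNuisance

/-- The second moment of a sum of a function of `W`, of `C^L` times a function with mean zero
given `(A, W)`, and of `C^Y` times a function with mean zero given `(A, L, W)`. -/
theorem InModel.integral_sum_sq (hP : InModel P) {u : 𝓦 → ℝ} {v : Bool × 𝓛 × 𝓦 → ℝ}
    {r : 𝓦 × Bool × 𝓛 × ℝ → ℝ} (hu : Measurable u) (hv : Measurable v) (hr : Measurable r)
    (huL : MemLp (fun o => u (baseline o)) 2 (P : Measure (Full 𝓦 𝓛)))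
    (hvL : MemLp (fun o => v (armShortBase o)) 2 (P : Measure (Full 𝓦 𝓛)))
    (hrL : MemLp (fun o => r o.1) 2 (P : Measure (Full 𝓦 𝓛)))
    (huv : ∫ o, v (armShortBase o) * u (baseline o) ∂(P : Measure (Full 𝓦 𝓛)) = 0)
    (hur : ∫ o, r o.1 * u (baseline o) ∂(P : Measure (Full 𝓦 𝓛)) = 0)
    (hvr : ∫ o, r o.1 * v (armShortBase o) ∂(P : Measure (Full 𝓦 𝓛)) = 0) :
    ∫ o, (u (baseline o) + cL o * v (armShortBase o) + cY o * r o.1) ^ 2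
        ∂(P : Measure (Full 𝓦 𝓛))
      = (∫ o, u (baseline o) ^ 2 ∂(P : Measure (Full 𝓦 𝓛)))
        + (∫ o, cL o ∂(P : Measure (Full 𝓦 𝓛)))
          * (∫ o, v (armShortBase o) ^ 2 ∂(P : Measure (Full 𝓦 𝓛)))
        + (∫ o, cY o ∂(P : Measure (Full 𝓦 𝓛)))
          * ∫ o, r o.1 ^ 2 ∂(P : Measure (Full 𝓦 𝓛)) := by
  have bL : ∀ {F : Full 𝓦 𝓛 → ℝ}, Integrable F (P : Measure (Full 𝓦 𝓛)) →
      Integrable (fun o => cL o * F o) (P : Measure (Full 𝓦 𝓛)) := fun h =>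
    h.bdd_mul measurable_cL.aestronglyMeasurable (c := 1) (ae_of_all _ abs_cL_le)
  have bY : ∀ {F : Full 𝓦 𝓛 → ℝ}, Integrable F (P : Measure (Full 𝓦 𝓛)) →
      Integrable (fun o => cY o * F o) (P : Measure (Full 𝓦 𝓛)) := fun h =>
    h.bdd_mul measurable_cY.aestronglyMeasurable (c := 1) (ae_of_all _ abs_cY_le)
  have e1 : (∫ o, cL o * (v (armShortBase o) * u (baseline o)) ∂(P : Measure (Full 𝓦 𝓛)))
      = _ * ∫ o, v (armShortBase o) * u (baseline o) ∂(P : Measure (Full 𝓦 𝓛)) :=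
    hP.integral_cL_mul (u := fun z => v (z.2.1, z.2.2.1, z.1) * u z.1) (by fun_prop)
  have e2 : (∫ o, cL o * v (armShortBase o) ^ 2 ∂(P : Measure (Full 𝓦 𝓛)))
      = _ * ∫ o, v (armShortBase o) ^ 2 ∂(P : Measure (Full 𝓦 𝓛)) :=
    hP.integral_cL_mul (u := fun z => v (z.2.1, z.2.2.1, z.1) ^ 2) (by fun_prop)
  have e3 : (∫ o, cY o * (r o.1 * u (baseline o)) ∂(P : Measure (Full 𝓦 𝓛)))
      = _ * ∫ o, r o.1 * u (baseline o) ∂(P : Measure (Full 𝓦 𝓛)) :=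
    hP.integral_cY_mul (u := fun z => r z * u z.1) (by fun_prop)
  have e4 : (∫ o, cY o * (r o.1 * v (armShortBase o)) ∂(P : Measure (Full 𝓦 𝓛)))
      = _ * ∫ o, r o.1 * v (armShortBase o) ∂(P : Measure (Full 𝓦 𝓛)) :=
    hP.integral_cY_mul (u := fun z => r z * v (z.2.1, z.2.2.1, z.1)) (by fun_prop)
  have e5 := hP.integral_cY_mul (u := fun z => r z ^ 2) (by fun_prop)
  -- Independent censoring pulls the indicators out of the cross terms, and the orthogonality
  -- hypotheses make what remains vanish.
  rw [huv, mul_zero] at e1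
  rw [hur, mul_zero] at e3
  rw [hvr, mul_zero] at e4
  have i1 := bL (integrable_mul_of_memLp_two hvL huL)
  have i2 := bL hvL.integrable_sq
  have i3 := bY (integrable_mul_of_memLp_two hrL huL)
  have i4 := bY (integrable_mul_of_memLp_two hrL hvL)
  have i5 := bY hrL.integrable_sq
  rw [← e2, ← e5]
  have z : ∫ o, (u (baseline o) ^ 2 + cL o * v (armShortBase o) ^ 2 + cY o * r o.1 ^ 2
      + (2 * (cL o * (v (armShortBase o) * u (baseline o)))
        + 2 * (cY o * (r o.1 * u (baseline o)))
        + 2 * (cY o * (r o.1 * v (armShortBase o))))) ∂(P : Measure (Full 𝓦 𝓛))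
      = _ := integral_add ((huL.integrable_sq.fun_add i2).fun_add i5)
        (((i1.const_mul 2).fun_add (i3.const_mul 2)).fun_add (i4.const_mul 2))
  rw [integral_add (huL.integrable_sq.fun_add i2) i5, integral_add huL.integrable_sq i2,
    integral_add ((i1.const_mul 2).fun_add (i3.const_mul 2)) (i4.const_mul 2),
    integral_add (i1.const_mul 2) (i3.const_mul 2), integral_const_mul, integral_const_mul,
    integral_const_mul] at z
  rw [e1, e3, e4, mul_zero, add_zero, add_zero, add_zero] at z
  rw [← z]
  refine integral_congr_ae ?_
  filter_upwards [hP.cY_mul_cL] with o ho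
  have hL : cL o ^ 2 = cL o := by rcases cL_mem o with h | h <;> simp [h]
  have hY : cY o ^ 2 = cY o := by rcases cY_mem o with h | h <;> simp [h]
  -- Indicators are idempotent, and the product of the last two terms carries `C^L C^Y = C^Y`.
  linear_combination v (armShortBase o) ^ 2 * hL + r o.1 ^ 2 * hY
    + 2 * v (armShortBase o) * r o.1 * ho

/-- The efficient influence function represents the derivative of the average treatment effect
in every regular submodel. -/
theorem IsRegularSubmodel.deriv_ate_eq {Q : ℝ → ProbabilityMeasure (Full 𝓦 𝓛)}
    {s : Obs 𝓦 𝓛 → ℝ} (hQ : IsRegularSubmodel P Q s) {G : Bool × 𝓦 → ℝ}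
    {H : Bool × 𝓛 × 𝓦 → ℝ} (hN : IsNuisance P G H)
    (hL : 0 < ∫ o, cL o ∂(P : Measure (Full 𝓦 𝓛)))
    (hY : 0 < ∫ o, cY o ∂(P : Measure (Full 𝓦 𝓛))) {d : ℝ}
    (hd : HasDerivAt (fun t => ate (Q t)) d 0) :
    d = ∫ x, effInfluence P G H x * s x ∂(obsLaw P) := by
  have hP := hQ.base_inModel
  have hs := hQ.score_memLp
  have h0 := hQ.cY_mul_deriv_ate hd
  have h1 := hQ.score_ortho_short hN.measurable_right hN.memLp_right
  have h2 := hQ.score_ortho_base hN.measurable_left hN.memLp_armBase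
  have h3 := hQ.score_ortho_arm hN.measurable_left hN.memLp_left
  rw [hN.integral_right hP] at h1
  rw [hN.integral_left hP] at h2
  set pl := ∫ o, cL o ∂(P : Measure (Full 𝓦 𝓛)) with hpl
  set py := ∫ o, cY o ∂(P : Measure (Full 𝓦 𝓛)) with hpy
  have mL := memLp_liftALW hN.measurable_right hN.memLp_right
  have mG := memLp_liftAW hN.measurable_left hN.memLp_armBase
  have ma : ∀ a, MemLp (liftAW fun z => G (a, z.2)) 2 (obsLaw P) := fun a =>
    memLp_liftAW (by have := hN.measurable_left; fun_prop) (hN.memLp_left a)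
  have i0 := integrable_mul_of_memLp_two hP.memLp_obsZ hs
  have i1 := integrable_mul_of_memLp_two (memLp_mul_of_abs_le_one measurable_obsCY abs_obsCY_le mL)
    hs
  have i2 := integrable_mul_of_memLp_two mL hs
  have i3 := integrable_mul_of_memLp_two (memLp_mul_of_abs_le_one measurable_obsCL abs_obsCL_le mG)
    hs
  have i4 := fun a => integrable_mul_of_memLp_two (ma a) hs
  have i5 := hs.integrable (q := 2) (by norm_num)
  have e : ∀ x, effInfluence P G H x * s x
      = ((1 / 2 * (liftAW (fun z => G (true, z.2)) x * s x)
          + 1 / 2 * (liftAW (fun z => G (false, z.2)) x * s x)) - ate P * s x)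
        + pl⁻¹ * (liftALW H x * s x - obsCL x * liftAW G x * s x)
        + py⁻¹ * (obsZ x * s x - obsCY x * liftALW H x * s x) := fun x => by
    simp only [effInfluence, effBase, liftAW, ← hpl, ← hpy]
    ring
  simp_rw [e]
  have j1 := integrable_fun_sub (((i4 true).const_mul (1 / 2)).fun_add ((i4 false).const_mul (1 / 2)))
    (i5.const_mul (ate P))
  have j2 := (integrable_fun_sub i2 i3).const_mul pl⁻¹
  have j3 := (integrable_fun_sub i0 i1).const_mul py⁻¹
  rw [integral_add (j1.fun_add j2) j3, integral_add j1 j2,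
    integral_sub (((i4 true).const_mul _).fun_add ((i4 false).const_mul _)) (i5.const_mul _),
    integral_add ((i4 true).const_mul _) ((i4 false).const_mul _)]
  simp only [integral_const_mul]
  rw [integral_sub i2 i3, integral_sub i0 i1, hQ.integral_score]
  have hpl0 : pl * pl⁻¹ = 1 := mul_inv_cancel₀ hL.ne'
  have hpy0 : py * py⁻¹ = 1 := mul_inv_cancel₀ hY.ne'
  -- Multiplication by `p_l p_y` clears the inverses.
  refine mul_left_cancel₀ (mul_ne_zero hL.ne' hY.ne') ?_
  generalize (∫ x, obsZ x * s x ∂(obsLaw P)) = SZ at *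
  generalize (∫ x, obsCY x * liftALW H x * s x ∂(obsLaw P)) = SYL at *
  generalize (∫ x, liftALW H x * s x ∂(obsLaw P)) = SL at *
  generalize (∫ x, obsCL x * liftAW G x * s x ∂(obsLaw P)) = SG at *
  -- The terms `Δ E(C^L s)` and `Δ E(C^Y s)` cancel between the identities: a change of the
  -- censoring law does not move `Δ`.
  linear_combination pl * h0 + h1 + py * h2 + pl * py / 2 * h3
    - py * (SL - SG) * hpl0 - pl * (SZ - SYL) * hpy0

theorem memLp_effInfluence (hP : InModel P) {G : Bool × 𝓦 → ℝ}
    {H : Bool × 𝓛 × 𝓦 → ℝ} (hN : IsNuisance P G H) :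
    MemLp (effInfluence P G H) 2 (obsLaw P) := by
  have mL := memLp_liftALW hN.measurable_right hN.memLp_right
  have mG := memLp_liftAW hN.measurable_left hN.memLp_armBase
  have m0 : MemLp (fun x : Obs 𝓦 𝓛 => effBase P G x.1) 2 (obsLaw P) :=
    (memLp_obsLaw (hN.measurable_effBase.comp measurable_fst)).2 hN.memLp_effBase
  exact (m0.add ((mL.sub
    (memLp_mul_of_abs_le_one measurable_obsCL abs_obsCL_le mG)).const_mul _)).add
    ((hP.memLp_obsZ.sub
      (memLp_mul_of_abs_le_one measurable_obsCY abs_obsCY_le mL)).const_mul _)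

/-- The three terms are uncorrelated. An indicator with mean `p` and weight `1/p` contributes the
factor `p (1/p)² = 1/p`. -/
theorem integral_effInfluence_sq (hP : InModel P) {G : Bool × 𝓦 → ℝ}
    {H : Bool × 𝓛 × 𝓦 → ℝ} (hN : IsNuisance P G H)
    (hL : 0 < ∫ o, cL o ∂(P : Measure (Full 𝓦 𝓛)))
    (hY : 0 < ∫ o, cY o ∂(P : Measure (Full 𝓦 𝓛))) :
    ∫ x, effInfluence P G H x ^ 2 ∂(obsLaw P) = effBound P G H := by
  have mG := hN.measurable_left
  have mH := hN.measurable_right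
  set pl := ∫ o, cL o ∂(P : Measure (Full 𝓦 𝓛)) with hpl
  set py := ∫ o, cY o ∂(P : Measure (Full 𝓦 𝓛)) with hpy
  have hm : Measurable (effInfluence P G H) := by
    have := hN.measurable_effBase
    have := measurable_liftALW (𝓦 := 𝓦) mH
    have := measurable_liftAW (𝓛 := 𝓛) mG
    have := measurable_obsZ (𝓦 := 𝓦) (𝓛 := 𝓛)
    have := measurable_obsCY (𝓦 := 𝓦) (𝓛 := 𝓛)
    have := measurable_obsCL (𝓦 := 𝓦) (𝓛 := 𝓛)
    unfold effInfluence
    fun_prop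
  have mS : Measurable fun z : 𝓦 × Bool × 𝓛 × ℝ => 2 * armSign z.2.1 * z.2.2.2 :=
    (measurable_const.mul (measurable_armSign.comp (by fun_prop))).mul (by fun_prop)
  have key := hP.integral_sum_sq (u := effBase P G)
    (v := fun z => pl⁻¹ * (H z - G (z.1, z.2.2)))
    (r := fun z => py⁻¹ * (2 * armSign z.2.1 * z.2.2.2 - H (z.2.1, z.2.2.1, z.1)))
    hN.measurable_effBase (by fun_prop) (by fun_prop) hN.memLp_effBase
    (hN.memLp_residual_short.const_mul _) ((hN.memLp_residual_outcome hP).const_mul _) ?_ ?_ ?_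
  · rw [integral_obsLaw P (hm.pow_const 2)]
    refine Eq.trans ?_ (key.trans ?_)
    · refine integral_congr_ae ?_
      filter_upwards [hP.cY_mul_cL] with o ho
      simp only [effInfluence, obsZ_observe, obsCL_observe, obsCY_observe, liftAW_observe,
        liftALW_observe, ← hpl, ← hpy]
      congr 1
      rw [← mul_assoc (cY o), ho]
      simp only [observe, signedOutcome, armShortBase, armBase, outcome, arm, short, baseline]
      ring
    · simp only [mul_pow, integral_const_mul]
      unfold effBound
      rw [← hpl, ← hpy]
      have hpl0 := hL.ne'
      have hpy0 := hY.ne'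
      simp only [armShortBase, armBase, signedOutcome, arm, baseline, short, outcome]
      field_simp
  · simp only [mul_assoc, integral_const_mul]
    have h := hN.ortho_short hP (m := fun z => effBase P G z.2)
      (hN.measurable_effBase.comp measurable_snd) hN.memLp_effBase
    exact mul_eq_zero_of_right _ h
  · simp only [mul_assoc, integral_const_mul]
    have h := hN.ortho_right (fun z => effBase P G z.2.2)
      (hN.measurable_effBase.comp (by fun_prop)) hN.memLp_effBase
    simp only [signedOutcome, mul_assoc] at h
    exact mul_eq_zero_of_right _ h
  · have h := hN.ortho_right (fun z => pl⁻¹ * (H z - G (z.1, z.2.2))) (by fun_prop)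
      (hN.memLp_residual_short.const_mul _)
    simp only [signedOutcome, mul_assoc] at h
    simp only [mul_assoc, integral_const_mul]
    exact mul_eq_zero_of_right _ h

/-- The Cramér-Rao bounds do not exceed the second moment of the efficient influence function. -/
theorem effBound_mem_upperBounds (hP : InModel P) {G : Bool × 𝓦 → ℝ}
    {H : Bool × 𝓛 × 𝓦 → ℝ} (hN : IsNuisance P G H)
    (hL : 0 < ∫ o, cL o ∂(P : Measure (Full 𝓦 𝓛)))
    (hY : 0 < ∫ o, cY o ∂(P : Measure (Full 𝓦 𝓛))) :
    effBound P G H ∈ upperBounds (cramerRaoBounds P) := by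
  rintro b ⟨Q, s, d, hQ, hd, rfl⟩
  rw [div_le_iff₀ hQ.information_pos, hQ.deriv_ate_eq hN hL hY hd,
    ← integral_effInfluence_sq hP hN hL hY]
  exact sq_integral_mul_le (memLp_effInfluence hP hN) hQ.score_memLp

/-! ### Conditional expectations and decomposition of variance -/

section CondExp

variable {α : Type*} {m m₁ m₂ m₀ : MeasurableSpace α} {ν : Measure α}

theorem integral_sub_condExp_mul [IsFiniteMeasure ν] (hm : m ≤ m₀) {f k : α → ℝ}
    (hf : MemLp f 2 ν) (hk : StronglyMeasurable[m] k) (hkL : MemLp k 2 ν) :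
    ∫ x, (f x - (ν[f | m]) x) * k x ∂ν = 0 := by
  have hfk : Integrable (f * k) ν := hf.integrable_mul hkL
  have hck : Integrable (ν[f | m] * k) ν := (MemLp.condExp (m := m) one_le_two hf).integrable_mul hkL
  have h := condExp_mul_of_stronglyMeasurable_right hk hfk (hf.integrable (by norm_num))
  have e : ∫ x, (f * k) x ∂ν = ∫ x, (ν[f | m] * k) x ∂ν := by
    rw [← integral_condExp hm]
    exact integral_congr_ae h
  have h2 := integral_sub hfk hck
  rw [e, sub_self] at h2
  rw [← h2]
  refine integral_congr_ae (ae_of_all _ fun x => ?_)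
  simp only [Pi.mul_apply]
  ring

theorem variance_condExp_sub_condExp [IsProbabilityMeasure ν] (h₁ : m₁ ≤ m₀) (h₂ : m₂ ≤ m₀)
    {f : α → ℝ} :
    variance (fun x => (ν[f | m₂]) x - (ν[f | m₁]) x) ν
      = ∫ x, ((ν[f | m₂]) x - (ν[f | m₁]) x) ^ 2 ∂ν := by
  have i1 : Integrable (ν[f | m₁]) ν := integrable_condExp
  have i2 : Integrable (ν[f | m₂]) ν := integrable_condExp
  have h0 : ∫ x, ((ν[f | m₂]) x - (ν[f | m₁]) x) ∂ν = 0 := by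
    rw [integral_sub i2 i1, integral_condExp h₁, integral_condExp h₂, sub_self]
  exact variance_of_integral_eq_zero (i2.aemeasurable.sub i1.aemeasurable) h0

/-- Decomposition of the variance along two nested `σ`-algebras. -/
theorem variance_eq_add_add [IsProbabilityMeasure ν] (h₁₂ : m₁ ≤ m₂) (h₂ : m₂ ≤ m₀)
    {f : α → ℝ} (hf : MemLp f 2 ν) :
    variance f ν = (∫ x, (f x - (ν[f | m₂]) x) ^ 2 ∂ν)
      + (∫ x, ((ν[f | m₂]) x - (ν[f | m₁]) x) ^ 2 ∂ν) + variance (ν[f | m₁]) ν := by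
  have h₁ := h₁₂.trans h₂
  have L1 : MemLp (ν[f | m₁]) 2 ν := hf.condExp one_le_two
  have L2 : MemLp (ν[f | m₂]) 2 ν := hf.condExp one_le_two
  set c := ∫ x, f x ∂ν with hc
  have k1 : StronglyMeasurable[m₁] fun x => (ν[f | m₁]) x - c :=
    stronglyMeasurable_condExp.sub stronglyMeasurable_const
  have k2 : StronglyMeasurable[m₂] fun x => (ν[f | m₂]) x - (ν[f | m₁]) x :=
    stronglyMeasurable_condExp.sub (stronglyMeasurable_condExp.mono h₁₂)
  have Lk1 : MemLp (fun x => (ν[f | m₁]) x - c) 2 ν := L1.sub (memLp_const c)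
  have Lk2 : MemLp (fun x => (ν[f | m₂]) x - (ν[f | m₁]) x) 2 ν := L2.sub L1
  have Lr1 : MemLp (fun x => f x - (ν[f | m₁]) x) 2 ν := hf.sub L1
  have Lr2 : MemLp (fun x => f x - (ν[f | m₂]) x) 2 ν := hf.sub L2
  have o1 := integral_sub_condExp_mul h₁ hf k1 Lk1
  have o2 := integral_sub_condExp_mul h₂ hf (k1.mono h₁₂) Lk1
  have o3 := integral_sub_condExp_mul h₂ hf k2 Lk2
  have i1 := integrable_mul_of_memLp_two Lr1 Lk1
  have i3 := integrable_mul_of_memLp_two Lr2 Lk2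
  rw [variance_eq_integral hf.aestronglyMeasurable.aemeasurable,
    variance_eq_integral L1.aestronglyMeasurable.aemeasurable, integral_condExp h₁, ← hc,
    ← integral_add Lr2.integrable_sq Lk2.integrable_sq,
    ← integral_add (Lr2.integrable_sq.fun_add Lk2.integrable_sq) Lk1.integrable_sq]
  -- In the square of `(f - E₂) + (E₂ - E₁) + (E₁ - c)`, where `Eᵢ` is the conditional mean given
  -- `mᵢ`, the two cross terms with `E₁ - c` add up to `2 (f - E₁)(E₁ - c)`. So two orthogonality
  -- relations suffice.
  have z := integral_add ((Lr2.integrable_sq.fun_add Lk2.integrable_sq).fun_add Lk1.integrable_sq)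
    ((i1.const_mul 2).fun_add (i3.const_mul 2))
  rw [integral_add (i1.const_mul 2) (i3.const_mul 2), integral_const_mul, integral_const_mul, o1,
    o3, mul_zero, add_zero, add_zero] at z
  rw [← z]
  refine integral_congr_ae (ae_of_all _ fun x => ?_)
  simp only
  ring

end CondExp

/-! ### Armwise regressions and the closed form of the bound -/

section Nuisance

variable {𝓦 𝓛 : Type*} [MeasurableSpace 𝓦] [MeasurableSpace 𝓛]
  {P : ProbabilityMeasure (Full 𝓦 𝓛)}

theorem ae_armLaw_arm (P : ProbabilityMeasure (Full 𝓦 𝓛)) (a : Bool) :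
    ∀ᵐ o ∂(armLaw P a), arm o = a :=
  ae_cond_mem (measurableSet_arm a)

/-- Restricted to an arm, `P` is a finite multiple of the conditional law; the functions of the two
arms are glued along `A`. -/
theorem InModel.memLp_of_armLaw (hP : InModel P) {F : Bool → Full 𝓦 𝓛 → ℝ} {p : ℝ≥0∞}
    (hF : ∀ a, MemLp (F a) p (armLaw P a)) :
    MemLp (fun o => F (arm o) o) p (P : Measure (Full 𝓦 𝓛)) := by
  have h : ∀ a, MemLp (fun o => if arm o = a then F a o else 0) p
      (P : Measure (Full 𝓦 𝓛)) := fun a => by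
    rw [ite_arm_eq_indicator, memLp_indicator_iff_restrict (measurableSet_arm a)]
    have hne : (P : Measure (Full 𝓦 𝓛)) {o | arm o = a} ≠ 0 := fun h0 => by
      have := hP.randomization_half a
      rw [measureReal_def, h0] at this
      norm_num at this
    have e : (P : Measure (Full 𝓦 𝓛)).restrict {o | arm o = a}
        = (P : Measure (Full 𝓦 𝓛)) {o | arm o = a} • armLaw P a := by
      rw [armLaw, ProbabilityTheory.cond, smul_smul,
        ENNReal.mul_inv_cancel hne (measure_ne_top _ _), one_smul]
    rw [e]
    exact (hF a).smul_measure (measure_ne_top _ _)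
  refine ((h true).add (h false)).ae_eq (ae_of_all _ fun o => ?_)
  cases ha : arm o <;> simp [ha]

theorem InModel.integral_eq_armLaw (hP : InModel P) {F : Full 𝓦 𝓛 → ℝ}
    (hF : Integrable F (P : Measure (Full 𝓦 𝓛))) :
    ∫ o, F o ∂(P : Measure (Full 𝓦 𝓛))
      = 1 / 2 * ∑ a : Bool, ∫ o, F o ∂(armLaw P a) := by
  simp only [Fintype.sum_bool, hP.integral_armLaw]
  rw [← mul_add, ← integral_add (integrable_ite_arm _ hF) (integrable_ite_arm _ hF), ← mul_assoc]
  norm_num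
  refine integral_congr_ae (ae_of_all _ fun o => ?_)
  cases ha : arm o <;> simp [ha]

/-- Doob-Dynkin factorization. The equality is pointwise, not only almost sure under `armLaw P a`,
so the version can also be evaluated on participants of the other arm. -/
theorem exists_meanW_eq (P : ProbabilityMeasure (Full 𝓦 𝓛)) (a : Bool) :
    ∃ g : 𝓦 → ℝ, Measurable g ∧ meanW P a = fun o => g (baseline o) := by
  obtain ⟨g, hg, h⟩ := (stronglyMeasurable_condExp (μ := armLaw P a)
    (m := MeasurableSpace.comap (baseline : Full 𝓦 𝓛 → 𝓦) inferInstance)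
    (f := outcome)).exists_eq_measurable_comp
  exact ⟨g, hg.measurable, h⟩

theorem exists_meanLW_eq (P : ProbabilityMeasure (Full 𝓦 𝓛)) (a : Bool) :
    ∃ h : 𝓛 × 𝓦 → ℝ, Measurable h ∧ meanLW P a = fun o => h (short o, baseline o) := by
  obtain ⟨g, hg, h⟩ := (stronglyMeasurable_condExp (μ := armLaw P a)
    (m := MeasurableSpace.comap (fun o : Full 𝓦 𝓛 => (short o, baseline o)) inferInstance)
    (f := outcome)).exists_eq_measurable_comp
  exact ⟨g, hg.measurable, h⟩

theorem comap_baseline_le :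
    MeasurableSpace.comap (baseline : Full 𝓦 𝓛 → 𝓦) inferInstance ≤ Prod.instMeasurableSpace :=
  measurable_baseline.comap_le

theorem comap_short_baseline_le :
    MeasurableSpace.comap (fun o : Full 𝓦 𝓛 => (short o, baseline o)) inferInstance
      ≤ Prod.instMeasurableSpace :=
  (measurable_short.prodMk measurable_baseline).comap_le

theorem comap_baseline_le_comap :
    MeasurableSpace.comap (baseline : Full 𝓦 𝓛 → 𝓦) inferInstance
      ≤ MeasurableSpace.comap (fun o : Full 𝓦 𝓛 => (short o, baseline o)) inferInstance := by
  have : (baseline : Full 𝓦 𝓛 → 𝓦) = Prod.snd ∘ fun o : Full 𝓦 𝓛 => (short o, baseline o) := rfl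
  rw [this, ← MeasurableSpace.comap_comp]
  exact MeasurableSpace.comap_mono measurable_snd.comap_le

theorem InModel.memLp_outcome_armLaw (hP : InModel P) (a : Bool) :
    MemLp outcome 2 (armLaw P a) := hP.memLp_armLaw a hP.outcome_memLp

theorem armSign_sq (a : Bool) : armSign a ^ 2 = 1 := by
  cases a <;> simp [armSign]

/-- The nuisance functions built from versions of the conditional means in the two arms. -/
theorem isNuisance_of_mean (hP : InModel P) {g : Bool → 𝓦 → ℝ} {h : Bool → 𝓛 × 𝓦 → ℝ}
    (hg : ∀ a, Measurable (g a)) (hh : ∀ a, Measurable (h a))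
    (hgm : ∀ a, meanW P a = fun o => g a (baseline o))
    (hhm : ∀ a, meanLW P a = fun o => h a (short o, baseline o)) :
    IsNuisance P (fun z => 2 * armSign z.1 * g z.1 z.2) (fun z => 2 * armSign z.1 * h z.1 z.2) := by
  have mg : Measurable fun z : Bool × 𝓦 => 2 * armSign z.1 * g z.1 z.2 :=
    measurable_from_prod_countable_right fun a => (hg a).const_mul (2 * armSign a)
  have mh : Measurable fun z : Bool × 𝓛 × 𝓦 => 2 * armSign z.1 * h z.1 z.2 :=
    measurable_from_prod_countable_right fun a => (hh a).const_mul (2 * armSign a)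
  have pa := hP.isProbabilityMeasure_armLaw
  have Lg : ∀ a, MemLp (fun o => g a (baseline o)) 2 (P : Measure (Full 𝓦 𝓛)) := fun a => by
    rw [← hP.memLp_baseline_iff a (hg a), ← hgm a]
    exact (hP.memLp_outcome_armLaw a).condExp one_le_two
  have Lh : ∀ a, MemLp (fun o => h a (short o, baseline o)) 2 (armLaw P a) := fun a => by
    rw [← hhm a]
    exact (hP.memLp_outcome_armLaw a).condExp one_le_two
  have Lg' : ∀ a, MemLp (fun o => 2 * armSign a * g a (baseline o)) 2
      (P : Measure (Full 𝓦 𝓛)) := fun a => (Lg a).const_mul _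
  have LG := memLp_armBase (P := P) mg Lg'
  have LH : MemLp (fun o => 2 * armSign (arm o) * h (arm o) (short o, baseline o)) 2
      (P : Measure (Full 𝓦 𝓛)) :=
    hP.memLp_of_armLaw (F := fun a o => 2 * armSign a * h a (short o, baseline o))
      fun a => (Lh a).const_mul _
  refine ⟨mg, mh, Lg', LH, fun m hm hmL => ?_, fun m hm hmL => ?_⟩
  · refine (hP.integral_eq_armLaw
      (integrable_mul_of_memLp_two (hP.memLp_signedOutcome.sub LG) hmL)).trans ?_
    refine mul_eq_zero_of_right _ (Finset.sum_eq_zero fun a _ => ?_)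
    have hma : Measurable fun w => m (a, w) := by fun_prop
    have hmL' : MemLp (fun o => m (a, baseline o)) 2 (armLaw P a) := by
      refine (hP.memLp_armLaw a hmL).ae_eq ?_
      filter_upwards [ae_armLaw_arm P a] with o ho
      rw [armBase, ho]
    -- Within arm `a` the sign is constant, so `Z - G` is `2 * armSign a` times the residual of `Y`
    -- given `W`.
    have key := integral_sub_condExp_mul comap_baseline_le (hP.memLp_outcome_armLaw a)
      (hma.comp (comap_measurable _)).stronglyMeasurable hmL'
    rw [← mul_eq_zero_of_right (2 * armSign a) key, ← integral_const_mul]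
    refine integral_congr_ae ?_
    filter_upwards [ae_armLaw_arm P a] with o ho
    have e := congrFun (hgm a) o
    simp only [meanW] at e
    simp only [Pi.sub_apply, signedOutcome, armBase, ho, Function.comp_apply, e]
    ring
  · refine (hP.integral_eq_armLaw
      (integrable_mul_of_memLp_two (hP.memLp_signedOutcome.sub LH) hmL)).trans ?_
    refine mul_eq_zero_of_right _ (Finset.sum_eq_zero fun a _ => ?_)
    have hma : Measurable fun z => m (a, z) := by fun_prop
    have hmL' : MemLp (fun o => m (a, short o, baseline o)) 2 (armLaw P a) := by
      refine (hP.memLp_armLaw a hmL).ae_eq ?_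
      filter_upwards [ae_armLaw_arm P a] with o ho
      rw [armShortBase, ho]
    have key := integral_sub_condExp_mul comap_short_baseline_le (hP.memLp_outcome_armLaw a)
      (hma.comp (comap_measurable _)).stronglyMeasurable hmL'
    rw [← mul_eq_zero_of_right (2 * armSign a) key, ← integral_const_mul]
    refine integral_congr_ae ?_
    filter_upwards [ae_armLaw_arm P a] with o ho
    have e := congrFun (hhm a) o
    simp only [meanLW] at e
    simp only [Pi.sub_apply, signedOutcome, armShortBase, ho, Function.comp_apply, e]
    ring

/-- With `V` the total variance, the baseline term is `γ V`. The other two numerators are `2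
R²_{L|W} V` and `2 (1 - R²_W - R²_{L|W}) V`: the sign squares to one, and the factor 4 from `Z` is
halved by averaging over the arms. -/
theorem effBound_of_mean (hP : InModel P) (hvar : 0 < totalVar P) {g : Bool → 𝓦 → ℝ}
    {h : Bool → 𝓛 × 𝓦 → ℝ}
    (hg : ∀ a, Measurable (g a)) (hh : ∀ a, Measurable (h a))
    (hgm : ∀ a, meanW P a = fun o => g a (baseline o))
    (hhm : ∀ a, meanLW P a = fun o => h a (short o, baseline o))
    (hL : 0 < ∫ o, cL o ∂(P : Measure (Full 𝓦 𝓛)))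
    (hY : 0 < ∫ o, cY o ∂(P : Measure (Full 𝓦 𝓛))) :
    effBound P (fun z => 2 * armSign z.1 * g z.1 z.2) (fun z => 2 * armSign z.1 * h z.1 z.2)
      = 2 / (∫ o, cY o ∂(P : Measure (Full 𝓦 𝓛))) * totalVar P
        * (1 + (∫ o, cY o ∂(P : Measure (Full 𝓦 𝓛))) / 2 * heterogeneity P - rSqW P
          - (1 - (∫ o, cY o ∂(P : Measure (Full 𝓦 𝓛))) / (∫ o, cL o ∂(P : Measure (Full 𝓦 𝓛))))
            * rSqLW P) := by
  have hN := isNuisance_of_mean hP hg hh hgm hhm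
  have pa := hP.isProbabilityMeasure_armLaw
  set pl := ∫ o, cL o ∂(P : Measure (Full 𝓦 𝓛)) with hpl
  set py := ∫ o, cY o ∂(P : Measure (Full 𝓦 𝓛)) with hpy
  have eB : ∫ o, effBase P (fun z => 2 * armSign z.1 * g z.1 z.2) (baseline o) ^ 2
      ∂(P : Measure (Full 𝓦 𝓛)) = heterogeneity P * totalVar P := by
    rw [heterogeneity, div_mul_cancel₀ _ hvar.ne', hgm, hgm]
    have hz := hN.integral_effBase hP
    rw [← variance_of_integral_eq_zero hN.memLp_effBase.aestronglyMeasurable.aemeasurable hz]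
    -- The constant `Δ` in `effBase` does not affect the variance that defines `γ`.
    rw [← variance_sub_const (X := fun o => g true (baseline o) - g false (baseline o)) ?_ (ate P)]
    · congr 1
      ext o
      simp only [effBase, armSign]
      norm_num
      ring
    · exact (((hg true).comp measurable_baseline).sub
        ((hg false).comp measurable_baseline)).aestronglyMeasurable
  have eL : ∫ o, (2 * armSign (armShortBase o).1 * h (armShortBase o).1 (armShortBase o).2
        - 2 * armSign (armBase o).1 * g (armBase o).1 (armBase o).2) ^ 2
        ∂(P : Measure (Full 𝓦 𝓛))
      = 2 * ∑ a : Bool, ∫ o, (meanLW P a o - meanW P a o) ^ 2 ∂(armLaw P a) := by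
    rw [hP.integral_eq_armLaw hN.memLp_residual_short.integrable_sq, Finset.mul_sum, Finset.mul_sum]
    refine Finset.sum_congr rfl fun a _ => ?_
    rw [← integral_const_mul, ← integral_const_mul]
    refine integral_congr_ae ?_
    filter_upwards [ae_armLaw_arm P a] with o ho
    simp only [armShortBase, armBase, ho, hgm, hhm]
    linear_combination 2 * (h a (short o, baseline o) - g a (baseline o)) ^ 2 * armSign_sq a
  have eY : ∫ o, (signedOutcome o
        - 2 * armSign (armShortBase o).1 * h (armShortBase o).1 (armShortBase o).2) ^ 2
        ∂(P : Measure (Full 𝓦 𝓛))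
      = 2 * ∑ a : Bool, ∫ o, (outcome o - meanLW P a o) ^ 2 ∂(armLaw P a) := by
    rw [hP.integral_eq_armLaw (hN.memLp_residual_outcome hP).integrable_sq, Finset.mul_sum,
      Finset.mul_sum]
    refine Finset.sum_congr rfl fun a _ => ?_
    rw [← integral_const_mul, ← integral_const_mul]
    refine integral_congr_ae ?_
    filter_upwards [ae_armLaw_arm P a] with o ho
    simp only [armShortBase, signedOutcome, ho, hhm]
    linear_combination 2 * (outcome o - h a (short o, baseline o)) ^ 2 * armSign_sq a
  have vW : ∀ a, variance (meanW P a) (armLaw P a)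
      = variance (meanW P a) (P : Measure (Full 𝓦 𝓛)) := fun a => by
    have e := hP.map_baseline_armLaw a
    rw [hgm a]
    have v := fun μ : Measure (Full 𝓦 𝓛) => variance_map (μ := μ) (X := g a) (Y := baseline)
      (hg a).aemeasurable measurable_baseline.aemeasurable
    have v1 := v (armLaw P a)
    rw [e, v] at v1
    exact v1.symm
  have vL : rSqLW P * totalVar P
      = ∑ a : Bool, ∫ o, (meanLW P a o - meanW P a o) ^ 2 ∂(armLaw P a) := by
    rw [rSqLW, div_mul_cancel₀ _ hvar.ne']
    exact Finset.sum_congr rfl fun a _ => variance_condExp_sub_condExp comap_baseline_le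
      comap_short_baseline_le
  -- The unexplained part of `Y` is eliminated by decomposing each arm variance along `W` and `(L,
  -- W)`.
  have vT : totalVar P = (∑ a : Bool, ∫ o, (outcome o - meanLW P a o) ^ 2 ∂(armLaw P a))
      + rSqLW P * totalVar P + rSqW P * totalVar P := by
    rw [vL, rSqW, div_mul_cancel₀ _ hvar.ne', ← Finset.sum_add_distrib, ← Finset.sum_add_distrib]
    refine Finset.sum_congr rfl fun a _ => ?_
    rw [← vW a]
    exact variance_eq_add_add comap_baseline_le_comap comap_short_baseline_le
      (hP.memLp_outcome_armLaw a)
  rw [effBound, eB, eL, eY, ← vL, ← hpl, ← hpy]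
  have vT' : (∑ a : Bool, ∫ o, (outcome o - meanLW P a o) ^ 2 ∂(armLaw P a))
      = totalVar P - rSqLW P * totalVar P - rSqW P * totalVar P := by linarith
  rw [vT']
  have hpl0 := hL.ne'
  have hpy0 := hY.ne'
  field_simp
  ring

end Nuisance

/-! ### Bounded scores and tilted laws -/

theorem indepFun_of_integral_indicator {α β γ : Type*} [MeasurableSpace α] [MeasurableSpace β]
    [MeasurableSpace γ] {μ : Measure α} [IsFiniteMeasure μ] {f : α → β} {g : α → γ}
    (hf : Measurable f) (hg : Measurable g)
    (h : ∀ s t, MeasurableSet s → MeasurableSet t →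
      ∫ x, s.indicator (1 : β → ℝ) (f x) * t.indicator (1 : γ → ℝ) (g x) ∂μ
        = (∫ x, s.indicator (1 : β → ℝ) (f x) ∂μ) * ∫ x, t.indicator (1 : γ → ℝ) (g x) ∂μ) :
    IndepFun f g μ := by
  rw [indepFun_iff_measure_inter_preimage_eq_mul]
  intro s t hs ht
  have key := h s t hs ht
  have e1 : ∫ x, s.indicator (1 : β → ℝ) (f x) ∂μ = μ.real (f ⁻¹' s) := by
    rw [← integral_indicator_one (hf hs)]; rfl
  have e2 : ∫ x, t.indicator (1 : γ → ℝ) (g x) ∂μ = μ.real (g ⁻¹' t) := by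
    rw [← integral_indicator_one (hg ht)]; rfl
  have e3 : ∫ x, s.indicator (1 : β → ℝ) (f x) * t.indicator (1 : γ → ℝ) (g x) ∂μ
      = μ.real (f ⁻¹' s ∩ g ⁻¹' t) := by
    rw [← integral_indicator_one ((hf hs).inter (hg ht)), Set.inter_indicator_one]; rfl
  rw [e1, e2, e3, measureReal_def, measureReal_def, measureReal_def, ← ENNReal.toReal_mul,
    ENNReal.toReal_eq_toReal_iff' (measure_ne_top _ _)
      (ENNReal.mul_ne_top (measure_ne_top _ _) (measure_ne_top _ _))] at key
  exact key

theorem abs_indicator_one_le {β : Type*} (s : Set β) (x : β) :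
    |s.indicator (1 : β → ℝ) x| ≤ 1 := by
  by_cases h : x ∈ s <;> simp [h]

/-- With `y = √(1+x)` the remainder is `-(y-1)²/2`, while `x = (y-1)(y+1)` and `y + 1 ≥ 1`. This
gives the rate for differentiability in quadratic mean of the tilts. -/
theorem sq_sqrt_one_add_sub_le {x : ℝ} (hx : |x| ≤ 1 / 2) :
    (√(1 + x) - 1 - x / 2) ^ 2 ≤ x ^ 4 := by
  rw [abs_le] at hx
  have h0 : 0 ≤ √(1 + x) := Real.sqrt_nonneg _
  have h1 : √(1 + x) ^ 2 = 1 + x := Real.sq_sqrt (by linarith)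
  set y := √(1 + x)
  have hx' : x = y ^ 2 - 1 := by linarith
  have e1 : y - 1 - x / 2 = -((y - 1) ^ 2 / 2) := by rw [hx']; ring
  have e2 : x ^ 4 = ((y - 1) ^ 2) ^ 2 * ((y + 1) ^ 2) ^ 2 := by rw [hx']; ring
  rw [e1, e2]
  have h2 : 1 ≤ ((y + 1) ^ 2) ^ 2 := one_le_pow₀ (one_le_pow₀ (by linarith))
  nlinarith [sq_nonneg ((y - 1) ^ 2)]

variable {𝓦 𝓛 : Type*}

/-- `C^Y` times a function of `(W, A, L, Y)`, as a function of the observed data. -/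
def liftFull (r : 𝓦 × Bool × 𝓛 × ℝ → ℝ) (x : Obs 𝓦 𝓛) : ℝ :=
  Sum.elim (fun y => Sum.elim (fun l => r (x.1, x.2.1, l, y)) (fun _ => 0) x.2.2.1) (fun _ => 0)
    x.2.2.2

theorem liftFull_observe (r : 𝓦 × Bool × 𝓛 × ℝ → ℝ) (o : Full 𝓦 𝓛) :
    liftFull r (observe o) = cY o * cL o * r o.1 := by
  unfold liftFull observe cL cY
  split_ifs <;> simp_all [baseline, arm, short, outcome]

variable [MeasurableSpace 𝓦] [MeasurableSpace 𝓛]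
  {P : ProbabilityMeasure (Full 𝓦 𝓛)}

theorem measurable_liftFull {r : 𝓦 × Bool × 𝓛 × ℝ → ℝ} (hr : Measurable r) :
    Measurable (liftFull r : Obs 𝓦 𝓛 → ℝ) := by
  have h := measurable_sum_elim_comp (γ := ((𝓦 × Bool) × (𝓛 ⊕ Unit)) × ℝ)
    (k := fun z : ((𝓦 × Bool) × ℝ) × 𝓛 => r (z.1.1.1, z.1.1.2, z.2, z.1.2)) (by fun_prop)
    (p := fun z => (z.1.1, z.2)) (by fun_prop) (q := fun z => z.1.2) (by fun_prop)
  exact measurable_sum_elim_comp h (p := fun x : Obs 𝓦 𝓛 => ((x.1, x.2.1), x.2.2.1)) (by fun_prop)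
    (q := fun x : Obs 𝓦 𝓛 => x.2.2.2) (by fun_prop)

/-- Bounded functions `u(W)`, `v(A, L, W)`, `r(W, A, L, Y)` with (conditional) means zero, which
make up a score of the semiparametric model. -/
structure IsScoreTriple (P : ProbabilityMeasure (Full 𝓦 𝓛)) (u : 𝓦 → ℝ)
    (v : Bool × 𝓛 × 𝓦 → ℝ) (r : 𝓦 × Bool × 𝓛 × ℝ → ℝ) (C : ℝ) : Prop where
  measurable_u : Measurable u
  measurable_v : Measurable v
  measurable_r : Measurable r
  bound_u : ∀ z, |u z| ≤ C
  bound_v : ∀ z, |v z| ≤ C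
  bound_r : ∀ z, |r z| ≤ C
  mean_u : ∫ o, u (baseline o) ∂(P : Measure (Full 𝓦 𝓛)) = 0
  ortho_v : ∀ m : Bool × 𝓦 → ℝ, Measurable m →
    MemLp (fun o => m (armBase o)) 2 (P : Measure (Full 𝓦 𝓛)) →
      ∫ o, v (armShortBase o) * m (armBase o) ∂(P : Measure (Full 𝓦 𝓛)) = 0
  ortho_r : ∀ m : Bool × 𝓛 × 𝓦 → ℝ, Measurable m →
    MemLp (fun o => m (armShortBase o)) 2 (P : Measure (Full 𝓦 𝓛)) →
      ∫ o, r o.1 * m (armShortBase o) ∂(P : Measure (Full 𝓦 𝓛)) = 0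

/-- The score `u(W) + v(A, L, W) + r(W, A, L, Y)` of the full data. -/
def fullScore (u : 𝓦 → ℝ) (v : Bool × 𝓛 × 𝓦 → ℝ) (r : 𝓦 × Bool × 𝓛 × ℝ → ℝ)
    (z : 𝓦 × Bool × 𝓛 × ℝ) : ℝ := u z.1 + v (z.2.1, z.2.2.1, z.1) + r z

/-- The score `u(W) + C^L v(A, L, W) + C^Y r(W, A, L, Y)` of the observed data. -/
def obsScore (u : 𝓦 → ℝ) (v : Bool × 𝓛 × 𝓦 → ℝ) (r : 𝓦 × Bool × 𝓛 × ℝ → ℝ)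
    (x : Obs 𝓦 𝓛) : ℝ := u x.1 + liftALW v x + liftFull r x

/-- The law with density `1 + t S` with respect to `P`. -/
def tilt (P : ProbabilityMeasure (Full 𝓦 𝓛)) (S : 𝓦 × Bool × 𝓛 × ℝ → ℝ) (t : ℝ) :
    Measure (Full 𝓦 𝓛) :=
  (P : Measure (Full 𝓦 𝓛)).withDensity fun o => ENNReal.ofReal (1 + t * S o.1)

/-- A measure as a probability measure. -/
def toProb {α : Type*} [MeasurableSpace α] (μ : Measure α) (h : IsProbabilityMeasure μ) :
    ProbabilityMeasure α := ⟨μ, h⟩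

open Classical in
/-- The path of laws with densities `1 + t S` with respect to `P`. -/
def tiltPath (P : ProbabilityMeasure (Full 𝓦 𝓛)) (S : 𝓦 × Bool × 𝓛 × ℝ → ℝ) (t : ℝ) :
    ProbabilityMeasure (Full 𝓦 𝓛) :=
  if h : IsProbabilityMeasure (tilt P S t) then toProb (tilt P S t) h else P

theorem tiltPath_zero (P : ProbabilityMeasure (Full 𝓦 𝓛)) (S : 𝓦 × Bool × 𝓛 × ℝ → ℝ) :
    tiltPath P S 0 = P := by
  have h : tilt P S 0 = P := by simp [tilt]
  unfold tiltPath
  by_cases hp : IsProbabilityMeasure (tilt P S 0)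
  · rw [dif_pos hp]
    exact Subtype.ext h
  · rw [dif_neg hp]

section Tilt

variable {u : 𝓦 → ℝ} {v : Bool × 𝓛 × 𝓦 → ℝ} {r : 𝓦 × Bool × 𝓛 × ℝ → ℝ} {C : ℝ}

namespace IsScoreTriple

theorem measurable_fullScore (hS : IsScoreTriple P u v r C) : Measurable (fullScore u v r) := by
  have := hS.measurable_u
  have := hS.measurable_v
  have := hS.measurable_r
  unfold fullScore; fun_prop

theorem measurable_obsScore (hS : IsScoreTriple P u v r C) : Measurable (obsScore u v r) :=
  ((hS.measurable_u.comp measurable_fst).add (measurable_liftALW hS.measurable_v)).add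
    (measurable_liftFull hS.measurable_r)

theorem nonneg (hS : IsScoreTriple P u v r C) (z : 𝓦) : 0 ≤ C :=
  (abs_nonneg _).trans (hS.bound_u z)

theorem abs_fullScore_le (hS : IsScoreTriple P u v r C) (z : 𝓦 × Bool × 𝓛 × ℝ) :
    |fullScore u v r z| ≤ 3 * C := by
  have h1 := hS.bound_u z.1
  have h2 := hS.bound_v (z.2.1, z.2.2.1, z.1)
  have h3 := hS.bound_r z
  unfold fullScore
  have h4 := abs_add_le (u z.1 + v (z.2.1, z.2.2.1, z.1)) (r z)
  have h5 := abs_add_le (u z.1) (v (z.2.1, z.2.2.1, z.1))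
  linarith

theorem abs_obsScore_le (hS : IsScoreTriple P u v r C) (x : Obs 𝓦 𝓛) :
    |obsScore u v r x| ≤ 3 * C := by
  have h0 := hS.nonneg x.1
  have h1 := hS.bound_u x.1
  have h2 := abs_liftALW_le h0 hS.bound_v x
  have h3 : |liftFull r x| ≤ C := by
    rcases hl : x.2.2.1 with l | l <;> rcases hy : x.2.2.2 with y | y <;>
      simp [liftFull, hl, hy, h0, hS.bound_r]
  unfold obsScore
  have h4 := abs_add_le (u x.1 + liftALW v x) (liftFull r x)
  have h5 := abs_add_le (u x.1) (liftALW v x)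
  linarith

theorem memLp_u (hS : IsScoreTriple P u v r C) {p : ℝ≥0∞} :
    MemLp (fun o => u (baseline o)) p (P : Measure (Full 𝓦 𝓛)) :=
  MemLp.of_bound (hS.measurable_u.comp measurable_baseline).aestronglyMeasurable C
    (ae_of_all _ fun _ => hS.bound_u _)

theorem memLp_v (hS : IsScoreTriple P u v r C) {p : ℝ≥0∞} :
    MemLp (fun o => v (armShortBase o)) p (P : Measure (Full 𝓦 𝓛)) :=
  MemLp.of_bound (hS.measurable_v.comp measurable_armShortBase).aestronglyMeasurable C
    (ae_of_all _ fun _ => hS.bound_v _)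

theorem memLp_r (hS : IsScoreTriple P u v r C) {p : ℝ≥0∞} :
    MemLp (fun o : Full 𝓦 𝓛 => r o.1) p (P : Measure (Full 𝓦 𝓛)) :=
  MemLp.of_bound (hS.measurable_r.comp measurable_fst).aestronglyMeasurable C
    (ae_of_all _ fun _ => hS.bound_r _)

theorem obsScore_observe (hP : InModel P) (u : 𝓦 → ℝ) (v : Bool × 𝓛 × 𝓦 → ℝ)
    (r : 𝓦 × Bool × 𝓛 × ℝ → ℝ) :
    ∀ᵐ o ∂(P : Measure (Full 𝓦 𝓛)), obsScore u v r (observe o)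
      = u (baseline o) + cL o * v (armShortBase o) + cY o * r o.1 := by
  filter_upwards [hP.cY_mul_cL] with o ho
  rw [obsScore, liftALW_observe, liftFull_observe, ho]
  rfl

/-- Functions of `(A, W)` do not see `v` and `r`. -/
theorem integral_mul_fullScore (hS : IsScoreTriple P u v r C) {m : Bool × 𝓦 → ℝ}
    (hm : Measurable m) {D : ℝ} (hD : ∀ z, |m z| ≤ D) :
    ∫ o, m (armBase o) * fullScore u v r o.1 ∂(P : Measure (Full 𝓦 𝓛))
      = ∫ o, m (armBase o) * u (baseline o) ∂(P : Measure (Full 𝓦 𝓛)) := by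
  have mL : MemLp (fun o => m (armBase o)) 2 (P : Measure (Full 𝓦 𝓛)) :=
    MemLp.of_bound (hm.comp measurable_armBase).aestronglyMeasurable D (ae_of_all _ fun _ => hD _)
  have h1 := hS.ortho_v m hm mL
  have h2 : ∫ o, r o.1 * m (armBase o) ∂(P : Measure (Full 𝓦 𝓛)) = 0 :=
    hS.ortho_r (fun z => m (z.1, z.2.2)) (by fun_prop) mL
  have i0 := integrable_mul_of_memLp_two mL hS.memLp_u
  have i1 := integrable_mul_of_memLp_two hS.memLp_v mL
  have i2 := integrable_mul_of_memLp_two hS.memLp_r mL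
  have z := integral_add (i0.fun_add i1) i2
  rw [integral_add i0 i1, h1, h2, add_zero, add_zero] at z
  rw [← z]
  refine integral_congr_ae (ae_of_all _ fun o => ?_)
  simp only [fullScore]
  change _ * (u (baseline o) + v (armShortBase o) + r o.1) = _
  ring

theorem integral_fullScore (hS : IsScoreTriple P u v r C) :
    ∫ o, fullScore u v r o.1 ∂(P : Measure (Full 𝓦 𝓛)) = 0 := by
  have h := hS.integral_mul_fullScore (m := fun _ => 1) measurable_const (D := 1) (by simp)
  simpa [hS.mean_u] using h

/-- The condition on `t` makes the tilted law a measure dominated by `3/2` times `P`, so second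
moments are inherited. -/
theorem one_add_mem (hS : IsScoreTriple P u v r C) {t : ℝ} (ht : |t| * (3 * C) ≤ 1 / 2)
    (z : 𝓦 × Bool × 𝓛 × ℝ) :
    1 / 2 ≤ 1 + t * fullScore u v r z ∧ 1 + t * fullScore u v r z ≤ 3 / 2 := by
  have h : |t * fullScore u v r z| ≤ 1 / 2 := by
    rw [abs_mul]
    exact (mul_le_mul_of_nonneg_left (hS.abs_fullScore_le z) (abs_nonneg t)).trans ht
  rw [abs_le] at h
  constructor <;> linarith

theorem measurable_density (hS : IsScoreTriple P u v r C) (t : ℝ) :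
    Measurable fun o : Full 𝓦 𝓛 => ENNReal.ofReal (1 + t * fullScore u v r o.1) := by
  have := hS.measurable_fullScore
  fun_prop

theorem integrable_fullScore_mul (hS : IsScoreTriple P u v r C) {F : Full 𝓦 𝓛 → ℝ}
    (hF : Integrable F (P : Measure (Full 𝓦 𝓛))) :
    Integrable (fun o => fullScore u v r o.1 * F o) (P : Measure (Full 𝓦 𝓛)) :=
  hF.bdd_mul (hS.measurable_fullScore.comp measurable_fst).aestronglyMeasurable
    (ae_of_all _ fun _ => hS.abs_fullScore_le _)

theorem integral_tilt (hS : IsScoreTriple P u v r C) {t : ℝ} (ht : |t| * (3 * C) ≤ 1 / 2)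
    {F : Full 𝓦 𝓛 → ℝ} (hF : Integrable F (P : Measure (Full 𝓦 𝓛))) :
    ∫ o, F o ∂(tilt P (fullScore u v r) t)
      = (∫ o, F o ∂(P : Measure (Full 𝓦 𝓛)))
        + t * ∫ o, fullScore u v r o.1 * F o ∂(P : Measure (Full 𝓦 𝓛)) := by
  rw [tilt, integral_withDensity_eq_integral_toReal_smul (hS.measurable_density t)
    (ae_of_all _ fun _ => ENNReal.ofReal_lt_top), ← integral_const_mul,
    ← integral_add hF ((hS.integrable_fullScore_mul hF).const_mul t)]
  refine integral_congr_ae (ae_of_all _ fun o => ?_)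
  simp only [smul_eq_mul]
  rw [ENNReal.toReal_ofReal (by linarith [(hS.one_add_mem ht o.1).1])]
  ring

theorem tilt_le (hS : IsScoreTriple P u v r C) {t : ℝ} (ht : |t| * (3 * C) ≤ 1 / 2) :
    tilt P (fullScore u v r) t ≤ ENNReal.ofReal (3 / 2) • (P : Measure (Full 𝓦 𝓛)) := by
  rw [← withDensity_const]
  exact withDensity_mono (ae_of_all _ fun o => ENNReal.ofReal_le_ofReal (hS.one_add_mem ht o.1).2)

theorem isProbabilityMeasure_tilt (hS : IsScoreTriple P u v r C) {t : ℝ}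
    (ht : |t| * (3 * C) ≤ 1 / 2) : IsProbabilityMeasure (tilt P (fullScore u v r) t) := by
  have hfin : IsFiniteMeasure (tilt P (fullScore u v r) t) := by
    have : IsFiniteMeasure (ENNReal.ofReal (3 / 2) • (P : Measure (Full 𝓦 𝓛))) :=
      Measure.smul_finite _ ENNReal.ofReal_ne_top
    exact isFiniteMeasure_of_le _ (hS.tilt_le ht)
  have h := hS.integral_tilt ht (integrable_const (1 : ℝ))
  simp only [mul_one, hS.integral_fullScore, integral_const, smul_eq_mul, probReal_univ,
    mul_zero, add_zero] at h
  rw [isProbabilityMeasure_iff_real]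
  exact h

theorem tiltPath_eq (hS : IsScoreTriple P u v r C) {t : ℝ} (ht : |t| * (3 * C) ≤ 1 / 2) :
    (tiltPath P (fullScore u v r) t : Measure (Full 𝓦 𝓛)) = tilt P (fullScore u v r) t := by
  unfold tiltPath
  rw [dif_pos (hS.isProbabilityMeasure_tilt ht)]
  rfl

end IsScoreTriple

end Tilt

/-! ### Tilted laws stay in the model -/

variable {𝓦 𝓛 : Type*} [MeasurableSpace 𝓦] [MeasurableSpace 𝓛]
  {P : ProbabilityMeasure (Full 𝓦 𝓛)}
  {u : 𝓦 → ℝ} {v : Bool × 𝓛 × 𝓦 → ℝ} {r : 𝓦 × Bool × 𝓛 × ℝ → ℝ} {C : ℝ} {t : ℝ}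

namespace IsScoreTriple

/-- Since `v` and `r` have mean zero given `(A, W)`, the law of `(A, W)` is tilted by `u(W)` alone.
This does not disturb randomization. -/
theorem integral_tilt_armBase (hS : IsScoreTriple P u v r C) (ht : |t| * (3 * C) ≤ 1 / 2)
    {m : Bool × 𝓦 → ℝ} (hm : Measurable m) {D : ℝ} (hD : ∀ z, |m z| ≤ D) :
    ∫ o, m (armBase o) ∂(tilt P (fullScore u v r) t)
      = ∫ o, m (armBase o) * (1 + t * u (baseline o)) ∂(P : Measure (Full 𝓦 𝓛)) := by
  have mL : MemLp (fun o => m (armBase o)) 2 (P : Measure (Full 𝓦 𝓛)) :=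
    MemLp.of_bound (hm.comp measurable_armBase).aestronglyMeasurable D (ae_of_all _ fun _ => hD _)
  have e : ∀ o : Full 𝓦 𝓛, fullScore u v r o.1 * m (armBase o)
      = m (armBase o) * fullScore u v r o.1 := fun o => mul_comm _ _
  rw [hS.integral_tilt ht (mL.integrable one_le_two)]
  simp_rw [e]
  rw [hS.integral_mul_fullScore hm hD, ← integral_const_mul,
    ← integral_add (mL.integrable one_le_two)
      ((integrable_mul_of_memLp_two mL hS.memLp_u).const_mul t)]
  refine integral_congr_ae (ae_of_all _ fun o => ?_)
  simp only
  ring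

theorem integral_tilt_arm_mul (hS : IsScoreTriple P u v r C) (hP : InModel P)
    (ht : |t| * (3 * C) ≤ 1 / 2) {φ : Bool → ℝ} {k : 𝓦 → ℝ} (hk : Measurable k) {D : ℝ}
    (hD : ∀ z : Bool × 𝓦, |φ z.1 * k z.2| ≤ D) :
    ∫ o, φ (arm o) * k (baseline o) ∂(tilt P (fullScore u v r) t)
      = (∫ o, φ (arm o) ∂(P : Measure (Full 𝓦 𝓛)))
        * ∫ o, k (baseline o) * (1 + t * u (baseline o)) ∂(P : Measure (Full 𝓦 𝓛)) := by
  have hφ : Measurable φ := measurable_of_finite _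
  have hk' : Measurable fun w => k w * (1 + t * u w) := by
    have := hS.measurable_u
    fun_prop
  have h := (hP.randomization_indep.comp hφ hk').integral_mul_eq_mul_integral
    (hφ.comp measurable_arm).aestronglyMeasurable
    (hk'.comp measurable_baseline).aestronglyMeasurable
  refine (hS.integral_tilt_armBase ht (m := fun z => φ z.1 * k z.2) (by fun_prop) hD).trans
    (Eq.trans ?_ h)
  refine integral_congr_ae (ae_of_all _ fun o => ?_)
  simp [armBase]
  ring

/-- The density does not involve the censoring indicators, so they keep their law and their
independence of the rest. -/
theorem integral_tilt_censor_mul (hS : IsScoreTriple P u v r C) (hP : InModel P)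
    (ht : |t| * (3 * C) ≤ 1 / 2) (φ : Bool × Bool → ℝ) {k : 𝓦 × Bool × 𝓛 × ℝ → ℝ}
    (hk : Measurable k) (hφ1 : ∀ c, |φ c| ≤ 1) (hk1 : ∀ z, |k z| ≤ 1) :
    ∫ o, φ o.2 * k o.1 ∂(tilt P (fullScore u v r) t)
      = (∫ o, φ o.2 ∂(P : Measure (Full 𝓦 𝓛)))
        * ∫ o, k o.1 ∂(tilt P (fullScore u v r) t) := by
  have hφ : Measurable φ := measurable_of_finite _
  have ik : Integrable (fun o : Full 𝓦 𝓛 => k o.1) (P : Measure (Full 𝓦 𝓛)) :=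
    Integrable.of_bound (hk.comp measurable_fst).aestronglyMeasurable 1 (ae_of_all _ fun _ => hk1 _)
  have iφk : Integrable (fun o : Full 𝓦 𝓛 => φ o.2 * k o.1) (P : Measure (Full 𝓦 𝓛)) :=
    ik.bdd_mul (hφ.comp measurable_snd).aestronglyMeasurable (ae_of_all _ fun _ => hφ1 _)
  rw [hS.integral_tilt ht ik, hS.integral_tilt ht iφk, hP.integral_censor_mul φ hk]
  have hm := hS.measurable_fullScore
  have e := hP.integral_censor_mul φ (u := fun z => fullScore u v r z * k z) (by fun_prop)
  have e' : ∀ o : Full 𝓦 𝓛, fullScore u v r o.1 * (φ o.2 * k o.1)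
      = φ o.2 * (fullScore u v r o.1 * k o.1) := fun o => by ring
  simp_rw [e', e]
  ring

theorem inModel_tiltPath (hS : IsScoreTriple P u v r C) (hP : InModel P)
    (ht : |t| * (3 * C) ≤ 1 / 2) : InModel (tiltPath P (fullScore u v r) t) := by
  have hprob := hS.isProbabilityMeasure_tilt ht
  have hmean : ∫ o, (1 : ℝ) * (1 + t * u (baseline o)) ∂(P : Measure (Full 𝓦 𝓛)) = 1 := by
    simp only [one_mul]
    rw [integral_add (integrable_const _) ((hS.memLp_u.integrable le_rfl).const_mul t),
      integral_const_mul, hS.mean_u]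
    simp
  have hb : ∀ φ : Bool → ℝ, (∀ a, |φ a| ≤ 1) →
      ∫ o, φ (arm o) ∂(tilt P (fullScore u v r) t)
        = ∫ o, φ (arm o) ∂(P : Measure (Full 𝓦 𝓛)) := fun φ hφ => by
    have h := hS.integral_tilt_arm_mul hP ht (φ := φ) (k := fun _ => 1) measurable_const (D := 1)
      (by simpa using fun a _ => hφ a)
    rw [hmean] at h
    simpa using h
  constructor
  · rw [hS.tiltPath_eq ht]
    exact hP.outcome_memLp.of_measure_le_smul ENNReal.ofReal_ne_top (hS.tilt_le ht)
  · rw [hS.tiltPath_eq ht]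
    refine indepFun_of_integral_indicator measurable_arm measurable_baseline fun s B _ hB => ?_
    have hk : Measurable (B.indicator (1 : 𝓦 → ℝ)) := measurable_one.indicator hB
    have h1 := hS.integral_tilt_arm_mul hP ht (φ := s.indicator 1) hk (D := 1) (fun z => by
      rw [abs_mul]
      exact mul_le_one₀ (abs_indicator_one_le _ _) (abs_nonneg _) (abs_indicator_one_le _ _))
    have h2 := hS.integral_tilt_arm_mul hP ht (φ := fun _ => 1) hk (D := 1) (fun z => by
      simpa using abs_indicator_one_le B z.2)
    simp only [one_mul, integral_const, probReal_univ, smul_eq_mul] at h2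
    rw [h1, h2, hb _ (abs_indicator_one_le s)]
  · intro a
    rw [hS.tiltPath_eq ht]
    have h := hb (({a} : Set Bool).indicator 1) (abs_indicator_one_le _)
    have e : ∀ μ : Measure (Full 𝓦 𝓛), ∫ o, (({a} : Set Bool).indicator (1 : Bool → ℝ)) (arm o) ∂μ
        = μ.real {o | arm o = a} := fun μ => by
      rw [← integral_indicator_one (measurableSet_arm a)]; rfl
    rw [e, e, hP.randomization_half a] at h
    exact h
  · rw [hS.tiltPath_eq ht]
    refine indepFun_of_integral_indicator (f := fun o : Full 𝓦 𝓛 => o.2)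
      (g := fun o : Full 𝓦 𝓛 => o.1) measurable_snd measurable_fst fun s B _ hB => ?_
    have h1 := hS.integral_tilt_censor_mul hP ht (s.indicator 1) (measurable_one.indicator hB)
      (abs_indicator_one_le _) (abs_indicator_one_le _)
    have h2 := hS.integral_tilt_censor_mul hP ht (s.indicator 1) (k := fun _ => 1) measurable_const
      (abs_indicator_one_le _) (by simp)
    simp only [mul_one, integral_const, probReal_univ, smul_eq_mul] at h2
    rw [h1, h2]
  · rw [hS.tiltPath_eq ht]
    exact (withDensity_absolutelyContinuous _ _).ae_le hP.monotone_censoring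

theorem integral_tilt_sq_outcome_le (hS : IsScoreTriple P u v r C) (hP : InModel P)
    (ht : |t| * (3 * C) ≤ 1 / 2) :
    ∫ o, outcome o ^ 2 ∂(tiltPath P (fullScore u v r) t : Measure (Full 𝓦 𝓛))
      ≤ 3 / 2 * ∫ o, outcome o ^ 2 ∂(P : Measure (Full 𝓦 𝓛)) := by
  have hi := hP.outcome_memLp.integrable_sq
  have hj := (hS.integrable_fullScore_mul hi).const_mul t
  rw [hS.tiltPath_eq ht, hS.integral_tilt ht hi, ← integral_const_mul, ← integral_const_mul,
    ← integral_add hi hj]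
  refine integral_mono (hi.add hj) (hi.const_mul _) fun o => ?_
  have := (hS.one_add_mem ht o.1).2
  simp only
  nlinarith [sq_nonneg (outcome o)]

/-- Given the observed data, the full-data score has the observed-data score as its mean. -/
theorem integral_observe_mul_fullScore (hS : IsScoreTriple P u v r C) (hP : InModel P)
    {β : Obs 𝓦 𝓛 → ℝ} (hβ : Measurable β) (hβ1 : ∀ x, |β x| ≤ 1) :
    ∫ o, β (observe o) * fullScore u v r o.1 ∂(P : Measure (Full 𝓦 𝓛))
      = ∫ o, β (observe o) * obsScore u v r (observe o) ∂(P : Measure (Full 𝓦 𝓛)) := by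
  have hmu := hS.measurable_u
  have hmv := hS.measurable_v
  have hmr := hS.measurable_r
  -- `m₂` and `m₁` are the values of `β` when neither outcome, respectively only `L`, is observed.
  set m₂ : Bool × 𝓦 → ℝ := fun z => β (z.2, z.1, Sum.inr (), Sum.inr ()) with hm₂
  set m₁ : Bool × 𝓛 × 𝓦 → ℝ := fun z => β (z.2.2, z.1, Sum.inl z.2.1, Sum.inr ()) with hm₁
  have mm₂ : Measurable m₂ := by fun_prop
  have mm₁ : Measurable m₁ := by fun_prop
  have L₂ : MemLp (fun o => m₂ (armBase o)) 2 (P : Measure (Full 𝓦 𝓛)) :=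
    MemLp.of_bound (mm₂.comp measurable_armBase).aestronglyMeasurable 1 (ae_of_all _ fun _ => hβ1 _)
  have L₁ : MemLp (fun o => m₁ (armShortBase o)) 2 (P : Measure (Full 𝓦 𝓛)) :=
    MemLp.of_bound (mm₁.comp measurable_armShortBase).aestronglyMeasurable 1
      (ae_of_all _ fun _ => hβ1 _)
  have o1 := hS.ortho_v m₂ mm₂ L₂
  have o2 : ∫ o, r o.1 * m₂ (armBase o) ∂(P : Measure (Full 𝓦 𝓛)) = 0 :=
    hS.ortho_r (fun z => m₂ (z.1, z.2.2)) (by fun_prop) L₂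
  have o3 := hS.ortho_r m₁ mm₁ L₁
  -- The two scores differ by `(1 - C^L) v + (1 - C^Y) r`. If `C^L = 0`, then `β` is a function of
  -- `(A, W)`, orthogonal to `v` and `r`. If only `L` is observed, `β` is a function of `(A, L, W)`,
  -- orthogonal to `r`. Independent censoring separates these cases.
  have z1 : ∫ o, (1 - cL o) * (v (armShortBase o) * m₂ (armBase o))
      ∂(P : Measure (Full 𝓦 𝓛)) = 0 :=
    (hP.integral_censor_mul (fun c => 1 - if c.1 = true then 1 else 0)
      (u := fun z => v (z.2.1, z.2.2.1, z.1) * m₂ (z.2.1, z.1)) (by fun_prop)).trans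
      (mul_eq_zero_of_right _ o1)
  have z2 : ∫ o, ((1 - cY o) * (1 - cL o)) * (r o.1 * m₂ (armBase o))
      ∂(P : Measure (Full 𝓦 𝓛)) = 0 :=
    (hP.integral_censor_mul
      (fun c => (1 - if c.2 = true then 1 else 0) * (1 - if c.1 = true then 1 else 0))
      (u := fun z => r z * m₂ (z.2.1, z.1)) (by fun_prop)).trans
      (mul_eq_zero_of_right _ o2)
  have z3 : ∫ o, ((1 - cY o) * cL o) * (r o.1 * m₁ (armShortBase o))
      ∂(P : Measure (Full 𝓦 𝓛)) = 0 :=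
    (hP.integral_censor_mul
      (fun c => (1 - if c.2 = true then 1 else 0) * (if c.1 = true then 1 else 0))
      (u := fun z => r z * m₁ (z.2.1, z.2.2.1, z.1)) (by fun_prop)).trans
      (mul_eq_zero_of_right _ o3)
  have bd : ∀ {c F : Full 𝓦 𝓛 → ℝ}, Measurable c → (∀ o, |c o| ≤ 1) →
      Integrable F (P : Measure (Full 𝓦 𝓛)) →
      Integrable (fun o => c o * F o) (P : Measure (Full 𝓦 𝓛)) := fun hc h1 hF =>
    hF.bdd_mul hc.aestronglyMeasurable (ae_of_all _ h1)
  have bL : ∀ o : Full 𝓦 𝓛, |1 - cL o| ≤ 1 := fun o => by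
    rcases cL_mem o with h | h <;> simp [h]
  have bY : ∀ o : Full 𝓦 𝓛, |1 - cY o| ≤ 1 := fun o => by
    rcases cY_mem o with h | h <;> simp [h]
  have mL := measurable_cL (𝓦 := 𝓦) (𝓛 := 𝓛)
  have mY := measurable_cY (𝓦 := 𝓦) (𝓛 := 𝓛)
  have i1 := bd (c := fun o => 1 - cL o) (measurable_const.sub mL) bL (integrable_mul_of_memLp_two hS.memLp_v L₂)
  have i2 := bd (c := fun o => (1 - cY o) * (1 - cL o))
    ((measurable_const.sub mY).mul (measurable_const.sub mL)) (fun o => by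
    rw [abs_mul]
    exact mul_le_one₀ (bY o) (abs_nonneg _) (bL o)) (integrable_mul_of_memLp_two hS.memLp_r L₂)
  have i3 := bd (c := fun o => (1 - cY o) * cL o) ((measurable_const.sub mY).mul mL) (fun o => by
    rw [abs_mul]
    exact mul_le_one₀ (bY o) (abs_nonneg _) (abs_cL_le o))
    (integrable_mul_of_memLp_two hS.memLp_r L₁)
  have i0 : Integrable (fun o => β (observe o) * obsScore u v r (observe o))
      (P : Measure (Full 𝓦 𝓛)) := by
    refine bd (hβ.comp measurable_observe) (fun _ => hβ1 _) ?_
    exact Integrable.of_bound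
      (hS.measurable_obsScore.comp measurable_observe).aestronglyMeasurable (3 * C)
      (ae_of_all _ fun _ => hS.abs_obsScore_le _)
  have z := integral_add ((i0.fun_add i1).fun_add i2) i3
  rw [integral_add (i0.fun_add i1) i2, integral_add i0 i1, z1, z2, z3, add_zero, add_zero, add_zero] at z
  rw [← z]
  refine integral_congr_ae ?_
  filter_upwards [obsScore_observe hP u v r, hP.monotone_censoring] with o ho hmon
  rw [ho]
  have hF : fullScore u v r o.1 = u (baseline o) + v (armShortBase o) + r o.1 := rfl
  rw [hF]
  cases hl : seenL o <;> cases hy : seenY o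
  · have e : β (observe o) = m₂ (armBase o) := by simp [observe, hl, hy, hm₂, armBase]
    simp only [e, cL, cY, hl, hy]
    norm_num
    ring
  -- The case `C^L = 0`, `C^Y = 1` contradicts monotone censoring.
  · simp_all
  · have e : β (observe o) = m₁ (armShortBase o) := by
      simp [observe, hl, hy, hm₁, armShortBase]
    simp only [e, cL, cY, hl, hy]
    norm_num
    ring
  · simp only [cL, cY, hl, hy]
    norm_num

end IsScoreTriple

/-! ### Tilted paths as regular submodels -/

variable {𝓦 𝓛 : Type*} [MeasurableSpace 𝓦] [MeasurableSpace 𝓛]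
  {P : ProbabilityMeasure (Full 𝓦 𝓛)}
  {u : 𝓦 → ℝ} {v : Bool × 𝓛 × 𝓦 → ℝ} {r : 𝓦 × Bool × 𝓛 × ℝ → ℝ} {C : ℝ} {t : ℝ}

namespace IsScoreTriple

theorem one_add_obs_nonneg (hS : IsScoreTriple P u v r C) (ht : |t| * (3 * C) ≤ 1 / 2)
    (x : Obs 𝓦 𝓛) : |t * obsScore u v r x| ≤ 1 / 2 := by
  rw [abs_mul]
  exact (mul_le_mul_of_nonneg_left (hS.abs_obsScore_le x) (abs_nonneg t)).trans ht

/-- The observed-data laws of the path have densities `1 + t s`, with `s` the observed-data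
score. -/
theorem obsLaw_tiltPath (hS : IsScoreTriple P u v r C) (hP : InModel P)
    (ht : |t| * (3 * C) ≤ 1 / 2) :
    obsLaw (tiltPath P (fullScore u v r) t)
      = (obsLaw P).withDensity fun x => ENNReal.ofReal (1 + t * obsScore u v r x) := by
  have hm := hS.measurable_obsScore
  have hprob := hS.isProbabilityMeasure_tilt ht
  have hs : Integrable (obsScore u v r) (obsLaw P) :=
    Integrable.of_bound hm.aestronglyMeasurable (3 * C) (ae_of_all _ hS.abs_obsScore_le)
  have hi : Integrable (fun x => 1 + t * obsScore u v r x) (obsLaw P) :=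
    (integrable_const _).add (hs.const_mul t)
  ext B hB
  have hpre := measurable_observe (𝓦 := 𝓦) (𝓛 := 𝓛) hB
  rw [withDensity_apply _ hB, ← ofReal_integral_eq_lintegral_ofReal hi.integrableOn
    (ae_of_all _ fun x => by
      have := hS.one_add_obs_nonneg ht x
      rw [abs_le] at this
      simp only [Pi.zero_apply]
      linarith), obsLaw, Measure.map_apply measurable_observe hB, hS.tiltPath_eq ht,
    ← ENNReal.ofReal_toReal (measure_ne_top (tilt P (fullScore u v r) t) (observe ⁻¹' B))]
  congr 1
  rw [← measureReal_def, ← integral_indicator_one hpre]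
  have iB : Integrable ((observe ⁻¹' B).indicator (1 : Full 𝓦 𝓛 → ℝ))
      (P : Measure (Full 𝓦 𝓛)) := (integrable_const (1 : ℝ)).indicator hpre
  have iB' : Integrable (B.indicator (1 : Obs 𝓦 𝓛 → ℝ)) (obsLaw P) :=
    (integrable_const (1 : ℝ)).indicator hB
  rw [hS.integral_tilt ht iB, ← integral_indicator hB]
  -- The density of an image law is the conditional mean of the density given the image; on
  -- indicators of events this replaces the full-data score by the observed-data score.
  have key := hS.integral_observe_mul_fullScore hP (measurable_one.indicator hB)
    (abs_indicator_one_le B)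
  have e1 : ∫ o, fullScore u v r o.1 * (observe ⁻¹' B).indicator (1 : Full 𝓦 𝓛 → ℝ) o
      ∂(P : Measure (Full 𝓦 𝓛))
      = ∫ x, B.indicator (1 : Obs 𝓦 𝓛 → ℝ) x * obsScore u v r x ∂(obsLaw P) := by
    rw [integral_obsLaw P (f := fun x => B.indicator (1 : Obs 𝓦 𝓛 → ℝ) x * obsScore u v r x)
      ((measurable_one.indicator hB).mul hm), ← key]
    exact integral_congr_ae (ae_of_all _ fun o => mul_comm _ _)
  have e2 : ∫ o, (observe ⁻¹' B).indicator (1 : Full 𝓦 𝓛 → ℝ) o ∂(P : Measure (Full 𝓦 𝓛))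
      = ∫ x, B.indicator (1 : Obs 𝓦 𝓛 → ℝ) x ∂(obsLaw P) := by
    rw [integral_obsLaw P (measurable_one.indicator hB)]
    rfl
  have i2 : Integrable (fun x => B.indicator (1 : Obs 𝓦 𝓛 → ℝ) x * obsScore u v r x) (obsLaw P) :=
    hs.bdd_mul (measurable_one.indicator hB).aestronglyMeasurable
      (ae_of_all _ (abs_indicator_one_le B))
  change _ = ∫ x, B.indicator (fun x => 1 + t * obsScore u v r x) x ∂(obsLaw P)
  rw [e1, e2, ← integral_const_mul, ← integral_add iB' (i2.const_mul t)]
  refine integral_congr_ae (ae_of_all _ fun x => ?_)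
  by_cases h : x ∈ B <;> simp [h]

theorem eventually_abs_le (C : ℝ) : ∀ᶠ t in 𝓝 (0 : ℝ), |t| * (3 * C) ≤ 1 / 2 := by
  have h : Tendsto (fun t : ℝ => |t| * (3 * C)) (𝓝 0) (𝓝 (|0| * (3 * C))) := by
    apply Continuous.tendsto
    fun_prop
  rw [abs_zero, zero_mul] at h
  exact ((tendsto_order.1 h).2 (1 / 2) (by norm_num)).mono fun _ => le_of_lt

/-- The law at `t = 0` serves as dominating measure. As the score is bounded, the remainder `√(1 + t
s) - 1 - t s / 2` is uniformly `O(t²)`. -/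
theorem isDQM_tiltPath (hS : IsScoreTriple P u v r C) (hP : InModel P) :
    IsDQM (tiltPath P (fullScore u v r)) (obsScore u v r) := by
  have hm := hS.measurable_obsScore
  have hmt : ∀ t : ℝ, Measurable fun x => ENNReal.ofReal (1 + t * obsScore u v r x) := fun t => by
    fun_prop
  have hd : ∀ t : ℝ, |t| * (3 * C) ≤ 1 / 2 → ∀ᵐ x ∂(obsLaw P),
      ((obsLaw (tiltPath P (fullScore u v r) t)).rnDeriv (obsLaw P) x).toReal
        = 1 + t * obsScore u v r x := fun t ht => by
    rw [hS.obsLaw_tiltPath hP ht]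
    filter_upwards [Measure.rnDeriv_withDensity (obsLaw P) (hmt t)] with x hx
    have := hS.one_add_obs_nonneg ht x
    rw [abs_le] at this
    rw [hx, ENNReal.toReal_ofReal (by linarith)]
  have hd0 := hd 0 (by norm_num)
  refine ⟨obsLaw P, inferInstance, ?_, ?_⟩
  · filter_upwards [eventually_abs_le C] with t ht
    rw [hS.obsLaw_tiltPath hP ht]
    exact withDensity_absolutelyContinuous _ _
  · have hb : Tendsto (fun t : ℝ => t ^ 2 * (3 * C) ^ 4) (𝓝[≠] 0) (𝓝 0) := by
      have : Tendsto (fun t : ℝ => t ^ 2 * (3 * C) ^ 4) (𝓝 0) (𝓝 (0 ^ 2 * (3 * C) ^ 4)) := by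
        apply Continuous.tendsto
        fun_prop
      simpa using this.mono_left nhdsWithin_le_nhds
    refine squeeze_zero' (Eventually.of_forall fun t => ?_) ?_ hb
    · exact div_nonneg (integral_nonneg fun x => sq_nonneg _) (sq_nonneg t)
    · filter_upwards [nhdsWithin_le_nhds (eventually_abs_le C), self_mem_nhdsWithin] with t ht ht0
      have ht0' : 0 < t ^ 2 := by
        have : t ≠ 0 := ht0
        positivity
      rw [div_le_iff₀ ht0']
      have hle : ∀ᵐ x ∂(obsLaw P),
          (√((obsLaw (tiltPath P (fullScore u v r) t)).rnDeriv (obsLaw P) x).toReal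
            - √((obsLaw (tiltPath P (fullScore u v r) 0)).rnDeriv (obsLaw P) x).toReal
            - t / 2 * obsScore u v r x
              * √((obsLaw (tiltPath P (fullScore u v r) 0)).rnDeriv (obsLaw P) x).toReal) ^ 2
          ≤ t ^ 2 * (3 * C) ^ 4 * t ^ 2 := by
        filter_upwards [hd t ht, hd0] with x hx hx0
        rw [hx, hx0]
        have h1 := sq_sqrt_one_add_sub_le (hS.one_add_obs_nonneg ht x)
        have h2 : obsScore u v r x ^ 4 ≤ (3 * C) ^ 4 := by
          rw [← Even.pow_abs (by decide : Even 4)]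
          exact pow_le_pow_left₀ (abs_nonneg _) (hS.abs_obsScore_le x) 4
        simp only [zero_mul, add_zero, Real.sqrt_one, mul_one]
        refine le_trans (le_of_eq (by ring)) (h1.trans ?_)
        calc (t * obsScore u v r x) ^ 4 = t ^ 4 * obsScore u v r x ^ 4 := by ring
          _ ≤ t ^ 4 * (3 * C) ^ 4 := by gcongr
          _ = t ^ 2 * (3 * C) ^ 4 * t ^ 2 := by ring
      have h := integral_mono_of_nonneg (ae_of_all _ fun x => sq_nonneg _) (integrable_const _) hle
      simpa using h

theorem isRegularSubmodel_tiltPath (hS : IsScoreTriple P u v r C) (hP : InModel P)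
    (hI : 0 < ∫ x, obsScore u v r x ^ 2 ∂(obsLaw P)) :
    IsRegularSubmodel P (tiltPath P (fullScore u v r)) (obsScore u v r) where
  base := tiltPath_zero P _
  mem_model := (eventually_abs_le C).mono fun _ ht => hS.inModel_tiltPath hP ht
  moment := ⟨_, (eventually_abs_le C).mono fun _ ht => hS.integral_tilt_sq_outcome_le hP ht⟩
  score_memLp := MemLp.of_bound hS.measurable_obsScore.aestronglyMeasurable (3 * C)
    (ae_of_all _ hS.abs_obsScore_le)
  information_pos := hI
  dqm := hS.isDQM_tiltPath hP

/-- For small `t` the mean of `Z` is affine in `t`. -/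
theorem hasDerivAt_ate_tiltPath (hS : IsScoreTriple P u v r C) (hP : InModel P) :
    HasDerivAt (fun t => ate (tiltPath P (fullScore u v r) t))
      (∫ o, fullScore u v r o.1 * signedOutcome o ∂(P : Measure (Full 𝓦 𝓛))) 0 := by
  have h : HasDerivAt (fun t : ℝ => (∫ o, signedOutcome o ∂(P : Measure (Full 𝓦 𝓛)))
      + t * ∫ o, fullScore u v r o.1 * signedOutcome o ∂(P : Measure (Full 𝓦 𝓛)))
      (∫ o, fullScore u v r o.1 * signedOutcome o ∂(P : Measure (Full 𝓦 𝓛))) 0 := by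
    simpa using ((hasDerivAt_id (0 : ℝ)).mul_const
      (∫ o, fullScore u v r o.1 * signedOutcome o ∂(P : Measure (Full 𝓦 𝓛)))).const_add
      (∫ o, signedOutcome o ∂(P : Measure (Full 𝓦 𝓛)))
  refine h.congr_of_eventuallyEq ?_
  filter_upwards [eventually_abs_le C] with t ht
  rw [(hS.inModel_tiltPath hP ht).ate_eq_integral_signedOutcome, hS.tiltPath_eq ht,
    hS.integral_tilt ht (hP.memLp_signedOutcome.integrable one_le_two)]

theorem integral_obsScore_sq (hS : IsScoreTriple P u v r C) (hP : InModel P) :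
    ∫ x, obsScore u v r x ^ 2 ∂(obsLaw P)
      = (∫ o, u (baseline o) ^ 2 ∂(P : Measure (Full 𝓦 𝓛)))
        + (∫ o, cL o ∂(P : Measure (Full 𝓦 𝓛)))
          * (∫ o, v (armShortBase o) ^ 2 ∂(P : Measure (Full 𝓦 𝓛)))
        + (∫ o, cY o ∂(P : Measure (Full 𝓦 𝓛)))
          * ∫ o, r o.1 ^ 2 ∂(P : Measure (Full 𝓦 𝓛)) := by
  have hmu := hS.measurable_u
  have hmv := hS.measurable_v
  have h1 := hS.ortho_v (fun z => u z.2) (by fun_prop) hS.memLp_u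
  have h2 := hS.ortho_r (fun z => u z.2.2) (by fun_prop) hS.memLp_u
  have h3 := hS.ortho_r v hmv hS.memLp_v
  rw [← hP.integral_sum_sq hS.measurable_u hS.measurable_v hS.measurable_r hS.memLp_u hS.memLp_v
    hS.memLp_r h1 h2 h3, integral_obsLaw P (hS.measurable_obsScore.pow_const 2)]
  refine integral_congr_ae ?_
  filter_upwards [obsScore_observe hP u v r] with o ho
  rw [ho]

end IsScoreTriple

/-! ### Truncated scores and the lower bound -/

section Projection

variable {α β : Type*} [MeasurableSpace α] [MeasurableSpace β] {μ : Measure α}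

theorem clamp_eq_self {N : ℕ} {x : ℝ} (h : |x| ≤ N) : clamp N x = x := by
  rw [abs_le] at h
  unfold clamp
  rw [min_eq_left h.2, max_eq_right h.1]

/-- A bounded function has a bounded conditional mean given `V`. -/
theorem exists_bounded_projection [IsProbabilityMeasure μ] {V : α → β} (hV : Measurable V)
    {f : α → ℝ} (hf : Measurable f) {N : ℕ} (hN : ∀ x, |f x| ≤ N) :
    ∃ k : β → ℝ, Measurable k ∧ (∀ z, |k z| ≤ N) ∧
      ∀ m : β → ℝ, Measurable m → MemLp (fun x => m (V x)) 2 μ →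
        ∫ x, (f x - k (V x)) * m (V x) ∂μ = 0 := by
  have hfL : MemLp f 2 μ := MemLp.of_bound hf.aestronglyMeasurable N (ae_of_all _ hN)
  obtain ⟨k₀, hk₀, he⟩ := (stronglyMeasurable_condExp (μ := μ)
    (m := MeasurableSpace.comap V inferInstance) (f := f)).exists_eq_measurable_comp
  -- The conditional mean is bounded by `N` only almost surely; clamping the version makes the bound
  -- hold everywhere without changing it almost surely.
  refine ⟨fun z => clamp N (k₀ z), (measurable_clamp N).comp hk₀.measurable,
    fun z => abs_clamp_le N _, fun m hm hmL => ?_⟩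
  rw [← integral_sub_condExp_mul hV.comap_le hfL
    (hm.comp (comap_measurable V)).stronglyMeasurable hmL]
  refine integral_congr_ae ?_
  have hb := ae_bdd_abs_condExp_of_ae_bdd_abs (μ := μ) (m := MeasurableSpace.comap V inferInstance)
    (R := (N : ℝ)) (f := f) (ae_of_all _ hN)
  filter_upwards [hb] with x hx
  rw [he] at hx ⊢
  have : clamp N (k₀ (V x)) = k₀ (V x) := clamp_eq_self (by simpa using hx)
  simp [this]

/-- The hypothesis says that `k` is orthogonal to its residual, as a projection is. Subtracting it
does not increase the second moment, and `clamp_sq_le` bounds the square of the clamp. -/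
theorem integral_clamp_sub_sq_le {N : ℕ} {f k : α → ℝ} (hf : MemLp f 2 μ) (hk : MemLp k 2 μ)
    (h : ∫ x, (clamp N (f x) - k x) * k x ∂μ = 0) :
    ∫ x, (clamp N (f x) - k x) ^ 2 ∂μ ≤ ∫ x, f x * clamp N (f x) ∂μ := by
  have hc : MemLp (fun x => clamp N (f x)) 2 μ :=
    hf.mono ((measurable_clamp N).comp_aemeasurable hf.aestronglyMeasurable.aemeasurable
      ).aestronglyMeasurable (ae_of_all _ fun x => abs_clamp_le_abs N _)
  have hck : MemLp (fun x => clamp N (f x) - k x) 2 μ := hc.sub hk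
  have i1 := integrable_mul_of_memLp_two hf hc
  have i2 := integrable_mul_of_memLp_two hck hk
  have e := integral_sub i1 (i2.const_mul 2)
  rw [integral_const_mul, h, mul_zero, sub_zero] at e
  rw [← e]
  refine integral_mono hck.integrable_sq (integrable_fun_sub i1 (i2.const_mul 2)) fun x => ?_
  have := clamp_sq_le N (f x)
  simp only
  nlinarith [sq_nonneg (k x)]

end Projection

variable {𝓦 𝓛 : Type*} [MeasurableSpace 𝓦] [MeasurableSpace 𝓛]
  {P : ProbabilityMeasure (Full 𝓦 𝓛)}
  {u : 𝓦 → ℝ} {v : Bool × 𝓛 × 𝓦 → ℝ} {r : 𝓦 × Bool × 𝓛 × ℝ → ℝ} {C : ℝ}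
  {G : Bool × 𝓦 → ℝ} {H : Bool × 𝓛 × 𝓦 → ℝ}

/-- In `Z = G + (H - G) + (Z - H)` each summand pairs only with its own part of the score. Averaging
`G` over the arms leaves `effBase + Δ`, and `Δ` drops out because `u` has mean zero. -/
theorem IsScoreTriple.integral_fullScore_mul_signedOutcome (hS : IsScoreTriple P u v r C)
    (hP : InModel P) (hN : IsNuisance P G H) :
    ∫ o, fullScore u v r o.1 * signedOutcome o ∂(P : Measure (Full 𝓦 𝓛))
      = (∫ o, effBase P G (baseline o) * u (baseline o) ∂(P : Measure (Full 𝓦 𝓛)))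
        + (∫ o, (H (armShortBase o) - G (armBase o)) * v (armShortBase o)
          ∂(P : Measure (Full 𝓦 𝓛)))
        + ∫ o, (signedOutcome o - H (armShortBase o)) * r o.1 ∂(P : Measure (Full 𝓦 𝓛)) := by
  have hmu := hS.measurable_u
  have hmG := hN.measurable_left
  have z1 : ∫ o, (signedOutcome o - G (armBase o)) * u (baseline o)
      ∂(P : Measure (Full 𝓦 𝓛)) = 0 :=
    hN.ortho_left (fun z => u z.2) (by fun_prop) hS.memLp_u
  have z2 := hN.ortho_right v hS.measurable_v hS.memLp_v
  have z3 := hS.ortho_v G hN.measurable_left hN.memLp_armBase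
  have z4 := hS.ortho_r H hN.measurable_right hN.memLp_right
  have ia : ∀ a, Integrable (fun o => G (a, baseline o) * u (baseline o))
      (P : Measure (Full 𝓦 𝓛)) := fun a =>
    integrable_mul_of_memLp_two (hN.memLp_left a) hS.memLp_u
  have j0 : Integrable (fun o => effBase P G (baseline o) * u (baseline o))
      (P : Measure (Full 𝓦 𝓛)) := integrable_mul_of_memLp_two hN.memLp_effBase hS.memLp_u
  have z5 : ∫ o, G (armBase o) * u (baseline o) ∂(P : Measure (Full 𝓦 𝓛))
      = ∫ o, effBase P G (baseline o) * u (baseline o) ∂(P : Measure (Full 𝓦 𝓛)) := by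
    refine (hP.integral_armBase (k := fun z => G z * u z.2) (by fun_prop) ia).trans ?_
    rw [← integral_const_mul]
    have e := integral_add j0 ((hS.memLp_u.integrable le_rfl).const_mul (ate P))
    rw [integral_const_mul, hS.mean_u, mul_zero, add_zero] at e
    rw [← e]
    refine integral_congr_ae (ae_of_all _ fun o => ?_)
    simp only [effBase]
    ring
  have i1 := integrable_mul_of_memLp_two (hP.memLp_signedOutcome.sub hN.memLp_armBase)
    (hS.memLp_u (p := 2))
  have i2 := integrable_mul_of_memLp_two (hN.memLp_residual_outcome hP) (hS.memLp_v (p := 2))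
  have i3 := integrable_mul_of_memLp_two (hS.memLp_v (p := 2)) hN.memLp_armBase
  have i4 := integrable_mul_of_memLp_two (hS.memLp_r (p := 2)) hN.memLp_right
  have i5 : Integrable (fun o => G (armBase o) * u (baseline o)) (P : Measure (Full 𝓦 𝓛)) :=
    integrable_mul_of_memLp_two hN.memLp_armBase hS.memLp_u
  have j1 := integrable_mul_of_memLp_two hN.memLp_residual_short (hS.memLp_v (p := 2))
  have j2 := integrable_mul_of_memLp_two (hN.memLp_residual_outcome hP) (hS.memLp_r (p := 2))
  simp only [Pi.sub_apply] at i1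
  have e := integral_add (((i1.fun_add i2).fun_add i3).fun_add i4) ((i5.fun_add j1).fun_add j2)
  rw [integral_add ((i1.fun_add i2).fun_add i3) i4, integral_add (i1.fun_add i2) i3,
    integral_add i1 i2, integral_add (i5.fun_add j1) j2, integral_add i5 j1, z1, z2, z3, z4, z5,
    add_zero, add_zero, add_zero, zero_add] at e
  rw [← e]
  refine integral_congr_ae (ae_of_all _ fun o => ?_)
  simp only [fullScore]
  change (u (baseline o) + v (armShortBase o) + r o.1) * _ = _
  ring

/-- The approximation of the lower bound that is attained with scores truncated at `N`. -/
def truncBound (P : ProbabilityMeasure (Full 𝓦 𝓛)) (G : Bool × 𝓦 → ℝ)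
    (H : Bool × 𝓛 × 𝓦 → ℝ) (N : ℕ) : ℝ :=
  (∫ o, effBase P G (baseline o) * clamp N (effBase P G (baseline o))
      ∂(P : Measure (Full 𝓦 𝓛)))
    + (∫ o, (H (armShortBase o) - G (armBase o)) * clamp N (H (armShortBase o) - G (armBase o))
        ∂(P : Measure (Full 𝓦 𝓛))) / (∫ o, cL o ∂(P : Measure (Full 𝓦 𝓛)))
    + (∫ o, (signedOutcome o - H (armShortBase o)) * clamp N (signedOutcome o - H (armShortBase o))
        ∂(P : Measure (Full 𝓦 𝓛))) / (∫ o, cY o ∂(P : Measure (Full 𝓦 𝓛)))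

theorem tendsto_truncBound (hP : InModel P) (hN : IsNuisance P G H) :
    Tendsto (truncBound P G H) atTop (𝓝 (effBound P G H)) := by
  have h : ∀ {f : Full 𝓦 𝓛 → ℝ}, MemLp f 2 (P : Measure (Full 𝓦 𝓛)) →
      Tendsto (fun N => ∫ o, f o * clamp N (f o) ∂(P : Measure (Full 𝓦 𝓛))) atTop
        (𝓝 (∫ o, f o ^ 2 ∂(P : Measure (Full 𝓦 𝓛)))) := fun hf => by
    simp_rw [sq]
    exact tendsto_integral_mul_clamp hf.aestronglyMeasurable hf.aestronglyMeasurable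
      (integrable_mul_of_memLp_two hf hf)
  exact ((h hN.memLp_effBase).add ((h hN.memLp_residual_short).div_const _)).add
    ((h (hN.memLp_residual_outcome hP)).div_const _)

/-- The triple consists of the truncated components of the efficient influence function, recentred
by their projections. The projections do not affect the derivative, being orthogonal to the
untruncated components, and they can only lower the information. Truncation destroys the equality of
derivative and information, but keeps the inequality in the useful direction. -/
theorem exists_scoreTriple (hP : InModel P) (hN : IsNuisance P G H)
    (hL : 0 < ∫ o, cL o ∂(P : Measure (Full 𝓦 𝓛)))
    (hY : 0 < ∫ o, cY o ∂(P : Measure (Full 𝓦 𝓛))) (N : ℕ) :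
    ∃ u v r C, IsScoreTriple P u v r C ∧
      ∫ o, fullScore u v r o.1 * signedOutcome o ∂(P : Measure (Full 𝓦 𝓛)) = truncBound P G H N ∧
      ∫ x, obsScore u v r x ^ 2 ∂(obsLaw P) ≤ truncBound P G H N := by
  have mG := hN.measurable_left
  have mH := hN.measurable_right
  have mE := hN.measurable_effBase
  have mZ : Measurable fun z : 𝓦 × Bool × 𝓛 × ℝ => 2 * armSign z.2.1 * z.2.2.2 :=
    (measurable_const.mul (measurable_armSign.comp (by fun_prop))).mul (by fun_prop)
  have mc := measurable_clamp N
  set pl := ∫ o, cL o ∂(P : Measure (Full 𝓦 𝓛)) with hpl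
  set py := ∫ o, cY o ∂(P : Measure (Full 𝓦 𝓛)) with hpy
  set F₂ : Bool × 𝓛 × 𝓦 → ℝ := fun z => H z - G (z.1, z.2.2) with hF₂
  set F₃ : 𝓦 × Bool × 𝓛 × ℝ → ℝ :=
    fun z => 2 * armSign z.2.1 * z.2.2.2 - H (z.2.1, z.2.2.1, z.1) with hF₃
  have mF₂ : Measurable F₂ := by fun_prop
  have mF₃ : Measurable F₃ := by fun_prop
  have L₂ : MemLp (fun o => F₂ (armShortBase o)) 2 (P : Measure (Full 𝓦 𝓛)) :=
    hN.memLp_residual_short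
  have L₃ : MemLp (fun o : Full 𝓦 𝓛 => F₃ o.1) 2 (P : Measure (Full 𝓦 𝓛)) :=
    hN.memLp_residual_outcome hP
  set c := ∫ o, clamp N (effBase P G (baseline o)) ∂(P : Measure (Full 𝓦 𝓛)) with hc
  obtain ⟨k₂, mk₂, bk₂, ok₂⟩ := exists_bounded_projection (μ := (P : Measure (Full 𝓦 𝓛)))
    measurable_armBase (f := fun o => clamp N (F₂ (armShortBase o)))
    (mc.comp (mF₂.comp measurable_armShortBase)) (fun o => abs_clamp_le N _)
  obtain ⟨k₃, mk₃, bk₃, ok₃⟩ := exists_bounded_projection (μ := (P : Measure (Full 𝓦 𝓛)))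
    measurable_armShortBase (f := fun o : Full 𝓦 𝓛 => clamp N (F₃ o.1))
    (mc.comp (mF₃.comp measurable_fst)) (fun o => abs_clamp_le N _)
  have Lk₂ : MemLp (fun o => k₂ (armBase o)) 2 (P : Measure (Full 𝓦 𝓛)) :=
    MemLp.of_bound (mk₂.comp measurable_armBase).aestronglyMeasurable N (ae_of_all _ fun _ => bk₂ _)
  have Lk₃ : MemLp (fun o => k₃ (armShortBase o)) 2 (P : Measure (Full 𝓦 𝓛)) :=
    MemLp.of_bound (mk₃.comp measurable_armShortBase).aestronglyMeasurable N
      (ae_of_all _ fun _ => bk₃ _)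
  have ic : Integrable (fun o => clamp N (effBase P G (baseline o))) (P : Measure (Full 𝓦 𝓛)) :=
    Integrable.of_bound (mc.comp (mE.comp measurable_baseline)).aestronglyMeasurable N
      (ae_of_all _ fun _ => abs_clamp_le N _)
  have hcN : |c| ≤ N := by
    have := norm_integral_le_of_norm_le_const (μ := (P : Measure (Full 𝓦 𝓛))) (C := N)
      (f := fun o => clamp N (effBase P G (baseline o))) (ae_of_all _ fun _ => abs_clamp_le N _)
    simpa using this
  have hN0 : (0 : ℝ) ≤ N := Nat.cast_nonneg N
  have hpl' : 0 < pl⁻¹ := inv_pos.2 hL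
  have hpy' : 0 < py⁻¹ := inv_pos.2 hY
  have two : ∀ x y : ℝ, |y| ≤ N → |clamp N x - y| ≤ 2 * N := fun x y hy => by
    have h1 := abs_clamp_le N x
    rw [abs_le] at h1 hy ⊢
    constructor <;> linarith
  have o₂ : ∀ m : Bool × 𝓦 → ℝ, Measurable m →
      MemLp (fun o => m (armBase o)) 2 (P : Measure (Full 𝓦 𝓛)) →
      ∫ o, pl⁻¹ * (clamp N (F₂ (armShortBase o)) - k₂ (armBase o)) * m (armBase o)
        ∂(P : Measure (Full 𝓦 𝓛)) = 0 := fun m hm hmL => by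
    simp only [mul_assoc]
    rw [integral_const_mul, ok₂ m hm hmL, mul_zero]
  have o₃ : ∀ m : Bool × 𝓛 × 𝓦 → ℝ, Measurable m →
      MemLp (fun o => m (armShortBase o)) 2 (P : Measure (Full 𝓦 𝓛)) →
      ∫ o, py⁻¹ * (clamp N (F₃ o.1) - k₃ (armShortBase o)) * m (armShortBase o)
        ∂(P : Measure (Full 𝓦 𝓛)) = 0 := fun m hm hmL => by
    simp only [mul_assoc]
    rw [integral_const_mul, ok₃ m hm hmL, mul_zero]
  have mean0 : ∫ o, (clamp N (effBase P G (baseline o)) - c) ∂(P : Measure (Full 𝓦 𝓛)) = 0 := by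
    rw [integral_sub ic (integrable_const c), ← hc]
    simp
  have hS : IsScoreTriple P (fun w => clamp N (effBase P G w) - c)
      (fun z => pl⁻¹ * (clamp N (F₂ z) - k₂ (z.1, z.2.2)))
      (fun z => py⁻¹ * (clamp N (F₃ z) - k₃ (z.2.1, z.2.2.1, z.1)))
      -- A clamp and its centring are each at most `N`; the last factor covers the weights `1`,
      -- `1/p_l` and `1/p_y` at once.
      (2 * N * (1 + pl⁻¹ + py⁻¹)) :=
    { measurable_u := by fun_prop
      measurable_v := by fun_prop
      measurable_r := by fun_prop
      bound_u := fun z => (two _ _ hcN).trans (le_mul_of_one_le_right (by positivity) (by linarith))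
      bound_v := fun z => by
        rw [abs_mul, abs_of_pos hpl', mul_comm]
        exact mul_le_mul (two _ _ (bk₂ _)) (by linarith) hpl'.le (by positivity)
      bound_r := fun z => by
        rw [abs_mul, abs_of_pos hpy', mul_comm]
        exact mul_le_mul (two _ _ (bk₃ _)) (by linarith) hpy'.le (by positivity)
      mean_u := mean0
      ortho_v := o₂
      ortho_r := o₃ }
  refine ⟨_, _, _, _, hS, ?_, ?_⟩
  · rw [hS.integral_fullScore_mul_signedOutcome hP hN, truncBound, ← hpl, ← hpy]
    have i1 : Integrable (fun o => effBase P G (baseline o) * clamp N (effBase P G (baseline o)))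
        (P : Measure (Full 𝓦 𝓛)) :=
      (hN.memLp_effBase.integrable one_le_two).mul_bdd ic.aestronglyMeasurable
        (ae_of_all _ fun _ => abs_clamp_le N _)
    have i2 : Integrable (fun o => F₂ (armShortBase o) * clamp N (F₂ (armShortBase o)))
        (P : Measure (Full 𝓦 𝓛)) :=
      (L₂.integrable one_le_two).mul_bdd
        (mc.comp (mF₂.comp measurable_armShortBase)).aestronglyMeasurable
        (ae_of_all _ fun _ => abs_clamp_le N _)
    have i3 : Integrable (fun o : Full 𝓦 𝓛 => F₃ o.1 * clamp N (F₃ o.1))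
        (P : Measure (Full 𝓦 𝓛)) :=
      (L₃.integrable one_le_two).mul_bdd (mc.comp (mF₃.comp measurable_fst)).aestronglyMeasurable
        (ae_of_all _ fun _ => abs_clamp_le N _)
    have e1 : ∫ o, effBase P G (baseline o) * (clamp N (effBase P G (baseline o)) - c)
        ∂(P : Measure (Full 𝓦 𝓛))
        = ∫ o, effBase P G (baseline o) * clamp N (effBase P G (baseline o))
          ∂(P : Measure (Full 𝓦 𝓛)) := by
      simp only [mul_sub]
      rw [integral_sub i1 ((hN.memLp_effBase.integrable one_le_two).mul_const c),
        integral_mul_const, hN.integral_effBase hP, zero_mul, sub_zero]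
    have e2 : ∫ o, F₂ (armShortBase o) * (pl⁻¹ * (clamp N (F₂ (armShortBase o)) - k₂ (armBase o)))
        ∂(P : Measure (Full 𝓦 𝓛))
        = (∫ o, F₂ (armShortBase o) * clamp N (F₂ (armShortBase o))
          ∂(P : Measure (Full 𝓦 𝓛))) / pl := by
      have h0 : ∫ o, F₂ (armShortBase o) * k₂ (armBase o) ∂(P : Measure (Full 𝓦 𝓛)) = 0 :=
        hN.ortho_short hP mk₂ Lk₂
      simp only [mul_left_comm _ pl⁻¹, mul_sub]
      rw [integral_sub (i2.const_mul _) ((integrable_mul_of_memLp_two L₂ Lk₂).const_mul _),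
        integral_const_mul, integral_const_mul, h0]
      ring
    have e3 : ∫ o : Full 𝓦 𝓛, F₃ o.1 * (py⁻¹ * (clamp N (F₃ o.1) - k₃ (armShortBase o)))
        ∂(P : Measure (Full 𝓦 𝓛))
        = (∫ o : Full 𝓦 𝓛, F₃ o.1 * clamp N (F₃ o.1) ∂(P : Measure (Full 𝓦 𝓛))) / py := by
      have h0 : ∫ o : Full 𝓦 𝓛, F₃ o.1 * k₃ (armShortBase o) ∂(P : Measure (Full 𝓦 𝓛)) = 0 :=
        hN.ortho_right k₃ mk₃ Lk₃
      simp only [mul_left_comm _ py⁻¹, mul_sub]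
      rw [integral_sub (i3.const_mul _) ((integrable_mul_of_memLp_two L₃ Lk₃).const_mul _),
        integral_const_mul, integral_const_mul, h0]
      ring
    exact congrArg₂ (· + ·) (congrArg₂ (· + ·) e1 e2) e3
  · rw [hS.integral_obsScore_sq hP, truncBound, ← hpl, ← hpy]
    have s1 := integral_clamp_sub_sq_le (N := N) hN.memLp_effBase
      (memLp_const (μ := (P : Measure (Full 𝓦 𝓛))) c) (by
        rw [integral_mul_const, mean0, zero_mul])
    have s2 := integral_clamp_sub_sq_le (N := N) L₂ Lk₂ (ok₂ k₂ mk₂ Lk₂)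
    have s3 := integral_clamp_sub_sq_le (N := N) L₃ Lk₃ (ok₃ k₃ mk₃ Lk₃)
    refine add_le_add (add_le_add s1 ?_) ?_
    · simp only [mul_pow]
      rw [integral_const_mul, ← mul_assoc, sq, ← mul_assoc, mul_inv_cancel₀ hL.ne', one_mul,
        div_eq_inv_mul]
      exact mul_le_mul_of_nonneg_left s2 hpl'.le
    · simp only [mul_pow]
      rw [integral_const_mul, ← mul_assoc, sq, ← mul_assoc, mul_inv_cancel₀ hY.ne', one_mul,
        div_eq_inv_mul]
      exact mul_le_mul_of_nonneg_left s3 hpy'.le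

/-- No number below the second moment of the efficient influence function bounds the Cramér-Rao
bounds from above. -/
theorem effBound_le_of_mem_upperBounds (hP : InModel P) (hN : IsNuisance P G H)
    (hL : 0 < ∫ o, cL o ∂(P : Measure (Full 𝓦 𝓛)))
    (hY : 0 < ∫ o, cY o ∂(P : Measure (Full 𝓦 𝓛))) {b : ℝ} (hb0 : 0 ≤ b)
    (hb : b ∈ upperBounds (cramerRaoBounds P)) : effBound P G H ≤ b := by
  by_contra! hlt
  obtain ⟨N, hNb⟩ := ((tendsto_order.1 (tendsto_truncBound hP hN)).1 b hlt).exists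
  obtain ⟨u, v, r, C, hS, hd, hs⟩ := exists_scoreTriple hP hN hL hY N
  have hpos : 0 < truncBound P G H N := hb0.trans_lt hNb
  -- With zero information `u`, `v`, `r` would vanish almost surely, and with them the derivative of
  -- `Δ`, which equals `truncBound` and is positive.
  have hI : 0 < ∫ x, obsScore u v r x ^ 2 ∂(obsLaw P) := by
    have hI0 : 0 ≤ ∫ x, obsScore u v r x ^ 2 ∂(obsLaw P) := integral_nonneg fun x => sq_nonneg _
    refine lt_of_le_of_ne hI0 fun h0 => ?_
    rw [hS.integral_obsScore_sq hP] at h0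
    have n1 : 0 ≤ ∫ o, u (baseline o) ^ 2 ∂(P : Measure (Full 𝓦 𝓛)) :=
      integral_nonneg fun x => sq_nonneg _
    have n2 : 0 ≤ ∫ o, v (armShortBase o) ^ 2 ∂(P : Measure (Full 𝓦 𝓛)) :=
      integral_nonneg fun x => sq_nonneg _
    have n3 : 0 ≤ ∫ o : Full 𝓦 𝓛, r o.1 ^ 2 ∂(P : Measure (Full 𝓦 𝓛)) :=
      integral_nonneg fun x => sq_nonneg _
    have m2 := mul_nonneg hL.le n2
    have m3 := mul_nonneg hY.le n3
    have q1 : ∫ o, u (baseline o) ^ 2 ∂(P : Measure (Full 𝓦 𝓛)) = 0 := by linarith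
    have q2 : ∫ o, v (armShortBase o) ^ 2 ∂(P : Measure (Full 𝓦 𝓛)) = 0 :=
      (mul_eq_zero.1 (by linarith)).resolve_left hL.ne'
    have q3 : ∫ o : Full 𝓦 𝓛, r o.1 ^ 2 ∂(P : Measure (Full 𝓦 𝓛)) = 0 :=
      (mul_eq_zero.1 (by linarith)).resolve_left hY.ne'
    have w1 := sq_integral_mul_le hN.memLp_effBase (hS.memLp_u (p := 2))
    have w2 := sq_integral_mul_le hN.memLp_residual_short (hS.memLp_v (p := 2))
    have w3 := sq_integral_mul_le (hN.memLp_residual_outcome hP) (hS.memLp_r (p := 2))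
    rw [q1, mul_zero] at w1
    rw [q2, mul_zero] at w2
    rw [q3, mul_zero] at w3
    rw [hS.integral_fullScore_mul_signedOutcome hP hN, sq_nonpos_iff _ |>.1 w1,
      sq_nonpos_iff _ |>.1 w2, sq_nonpos_iff _ |>.1 w3] at hd
    linarith
  have hmem := hb ⟨_, _, _, hS.isRegularSubmodel_tiltPath hP hI, hS.hasDerivAt_ate_tiltPath hP, rfl⟩
  rw [hd, div_le_iff₀ hI] at hmem
  -- With `D = truncBound` and information `I ≤ D`, `D² ≤ b I ≤ b D` forces `D ≤ b`, against the
  -- choice of `N`.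
  nlinarith

/-! ### Limit theorems for independent samples and the delta method -/

section IID

variable {𝓧 : Type*} [MeasurableSpace 𝓧] {ν : Measure 𝓧} [IsProbabilityMeasure ν]

/-- The law of an infinite sequence of independent draws from `ν`. -/
def iidLaw (ν : Measure 𝓧) : Measure (ℕ → 𝓧) := Measure.infinitePi fun _ => ν

instance : IsProbabilityMeasure (iidLaw ν) := by
  unfold iidLaw; infer_instance

/-- Samples of all sizes are realized on one sequence space, where the strong law and the central
limit theorem apply. Convergence in distribution depends on the laws only and can be carried back.
-/
theorem map_iidLaw_fin (n : ℕ) :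
    (iidLaw ν).map (fun ω (i : Fin n) => ω i) = Measure.pi fun _ : Fin n => ν := by
  have h := Measure.map_infinitePi_infinitePi_of_inj (P := fun _ : ℕ => ν)
    (f := fun i : Fin n => (i : ℕ)) Fin.val_injective
  exact h.trans (Measure.infinitePi_eq_pi (μ := fun _ : Fin n => ν))

theorem identDistrib_iidLaw {f : 𝓧 → ℝ} (hf : Measurable f) (i : ℕ) :
    IdentDistrib (fun ω : ℕ → 𝓧 => f (ω i)) f (iidLaw ν) ν where
  aemeasurable_fst := (hf.comp (measurable_pi_apply i)).aemeasurable
  aemeasurable_snd := hf.aemeasurable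
  map_eq := by
    have h : (iidLaw ν).map (fun ω => ω i) = ν := Measure.infinitePi_map_eval (fun _ => ν) i
    conv_rhs => rw [← h]
    rw [Measure.map_map hf (by fun_prop)]
    rfl

theorem iIndepFun_iidLaw {f : 𝓧 → ℝ} (hf : Measurable f) :
    iIndepFun (fun (i : ℕ) (ω : ℕ → 𝓧) => f (ω i)) (iidLaw ν) :=
  iIndepFun_infinitePi (P := fun _ : ℕ => ν) (X := fun _ => f) fun _ => hf

theorem tendsto_average_iidLaw {f : 𝓧 → ℝ} (hf : Measurable f) (hi : Integrable f ν) :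
    ∀ᵐ ω ∂(iidLaw ν), Tendsto (fun n : ℕ => (∑ i ∈ Finset.range n, f (ω i)) / n) atTop
      (𝓝 (∫ x, f x ∂ν)) := by
  have h := strong_law_ae_real (μ := iidLaw ν) (fun i ω => f (ω i))
    ((identDistrib_iidLaw hf 0).integrable_iff.2 hi)
    (fun i j hij => (iIndepFun_iidLaw hf).indepFun hij)
    fun i => (identDistrib_iidLaw hf i).trans (identDistrib_iidLaw hf 0).symm
  rwa [(identDistrib_iidLaw hf 0).integral_eq] at h

theorem tendstoInDistribution_sum_iidLaw {f : 𝓧 → ℝ} (hf : Measurable f) (h2 : MemLp f 2 ν)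
    (h0 : ∫ x, f x ∂ν = 0) :
    TendstoInDistribution
      (fun (n : ℕ) (ω : ℕ → 𝓧) => (√(n : ℝ))⁻¹ * ∑ i ∈ Finset.range n, f (ω i)) atTop
      (id : ℝ → ℝ) (fun _ => iidLaw ν) (gaussianReal 0 (variance f ν).toNNReal) := by
  have e := identDistrib_iidLaw (ν := ν) hf 0
  have hY : HasLaw (id : ℝ → ℝ)
      (gaussianReal 0 (variance (fun ω : ℕ → 𝓧 => f (ω 0)) (iidLaw ν)).toNNReal)
      (gaussianReal 0 (variance f ν).toNNReal) := by
    rw [e.variance_eq]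
    exact HasLaw.id
  have h := tendstoInDistribution_inv_sqrt_mul_sum_sub (X := fun (i : ℕ) (ω : ℕ → 𝓧) => f (ω i))
    hY (e.memLp_iff.2 h2) (iIndepFun_iidLaw hf)
    fun i => (identDistrib_iidLaw hf i).trans e.symm
  simpa only [e.integral_eq, h0, mul_zero, sub_zero] using h

theorem tendstoInDistribution_pi_of_iidLaw {X : ∀ n : ℕ, (Fin n → 𝓧) → ℝ}
    (hX : ∀ n, Measurable (X n)) {v : ℝ≥0}
    (h : TendstoInDistribution (fun n (ω : ℕ → 𝓧) => X n fun i : Fin n => ω i) atTop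
      (id : ℝ → ℝ) (fun _ => iidLaw ν) (gaussianReal 0 v)) :
    TendstoInDistribution X atTop (id : ℝ → ℝ) (fun n => Measure.pi fun _ : Fin n => ν)
      (gaussianReal 0 v) where
  forall_aemeasurable n := (hX n).aemeasurable
  aemeasurable_limit := aemeasurable_id
  tendsto := by
    refine h.tendsto.congr fun n => Subtype.ext (Eq.symm ?_)
    change Measure.map (X n) _ = Measure.map _ (iidLaw ν)
    rw [← map_iidLaw_fin n, Measure.map_map (hX n) (by fun_prop)]
    rfl

theorem tendstoInMeasure_zero_of_tendstoInDistribution {Ω Ω' : Type*} [MeasurableSpace Ω]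
    [MeasurableSpace Ω'] {μ : Measure Ω} [IsProbabilityMeasure μ] {μ' : Measure Ω'}
    [IsProbabilityMeasure μ'] {X : ℕ → Ω → ℝ}
    (h : TendstoInDistribution X atTop (fun _ : Ω' => (0 : ℝ)) (fun _ => μ) μ') :
    TendstoInMeasure μ X atTop fun _ => 0 := by
  rw [tendstoInMeasure_iff_norm]
  intro ε hε
  have hE : MeasurableSet {x : ℝ | ε ≤ |x|} := measurableSet_le measurable_const (by fun_prop)
  have hF : frontier {x : ℝ | ε ≤ |x|} ⊆ {x | ε = |x|} :=
    frontier_le_subset_eq continuous_const continuous_abs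
  have hz : ∀ s : Set ℝ, MeasurableSet s → (0 : ℝ) ∉ s →
      (μ'.map fun _ => (0 : ℝ)) s = 0 := fun s hs h0 => by
    rw [Measure.map_apply measurable_const hs]
    simp [h0]
  have hne : (0 : ℝ) ∉ {x : ℝ | ε = |x|} := by simpa using hε.ne'
  have hne' : (0 : ℝ) ∉ {x : ℝ | ε ≤ |x|} := by simpa using hε
  -- Portmanteau: the frontier of `{ε ≤ |x|}` lies in `{ε = |x|}`, which the point mass at `0` does
  -- not charge.
  have k := ProbabilityMeasure.tendsto_measure_of_null_frontier_of_tendsto' h.tendsto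
    (E := {x : ℝ | ε ≤ |x|})
    (measure_mono_null hF (hz _ (measurableSet_eq_fun measurable_const (by fun_prop)) hne))
  simp only [ProbabilityMeasure.coe_mk] at k
  rw [hz _ hE hne'] at k
  refine k.congr fun n => ?_
  rw [Measure.map_apply_of_aemeasurable (h.forall_aemeasurable n) hE]
  simp

/-- Slutsky: the first factor converges in distribution and the second tends to zero by the strong
law. This is the cost of replacing a random denominator by its limit. -/
theorem tendstoInMeasure_sum_mul_iidLaw {f d : 𝓧 → ℝ} (hf : Measurable f) (h2 : MemLp f 2 ν)
    (h0 : ∫ x, f x ∂ν = 0) (hd : Measurable d) (hdi : Integrable d ν)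
    (hd0 : ∫ x, d x ∂ν ≠ 0) :
    TendstoInMeasure (iidLaw ν)
      (fun (n : ℕ) (ω : ℕ → 𝓧) => ((√(n : ℝ))⁻¹ * ∑ i ∈ Finset.range n, f (ω i))
        * (n / (∑ i ∈ Finset.range n, d (ω i)) - (∫ x, d x ∂ν)⁻¹)) atTop fun _ => 0 := by
  have hm : ∀ n : ℕ, Measurable fun ω : ℕ → 𝓧 =>
      (n : ℝ) / (∑ i ∈ Finset.range n, d (ω i)) - (∫ x, d x ∂ν)⁻¹ := fun n => by fun_prop
  have hc : TendstoInMeasure (iidLaw ν) (fun (n : ℕ) (ω : ℕ → 𝓧) =>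
      (n : ℝ) / (∑ i ∈ Finset.range n, d (ω i)) - (∫ x, d x ∂ν)⁻¹) atTop fun _ => 0 := by
    refine tendstoInMeasure_of_tendsto_ae (fun n => (hm n).aestronglyMeasurable) ?_
    filter_upwards [tendsto_average_iidLaw hd hdi] with ω hω
    have h := (hω.inv₀ hd0).sub_const (∫ x, d x ∂ν)⁻¹
    simpa only [inv_div, sub_self] using h
  have k := (tendstoInDistribution_sum_iidLaw hf h2 h0)
    |>.continuous_comp_prodMk_of_tendstoInMeasure_const (g := fun z : ℝ × ℝ => z.1 * z.2)
      (by fun_prop) hc (fun n => (hm n).aemeasurable)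
  simp only [mul_zero] at k
  exact tendstoInMeasure_zero_of_tendstoInDistribution k

/-- The delta method for a difference of two ratios of sample means. -/
theorem tendstoInDistribution_sub_ratio {s₁ d₁ s₀ d₀ : 𝓧 → ℝ} {m₁ m₀ p₁ p₀ : ℝ}
    (hs₁ : Measurable s₁) (hd₁ : Measurable d₁) (hs₀ : Measurable s₀) (hd₀ : Measurable d₀)
    (ls₁ : MemLp s₁ 2 ν) (ld₁ : MemLp d₁ 2 ν) (ls₀ : MemLp s₀ 2 ν) (ld₀ : MemLp d₀ 2 ν)
    (ep₁ : ∫ x, d₁ x ∂ν = p₁) (ep₀ : ∫ x, d₀ x ∂ν = p₀) (hp₁ : p₁ ≠ 0) (hp₀ : p₀ ≠ 0)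
    (em₁ : ∫ x, s₁ x ∂ν = m₁ * p₁) (em₀ : ∫ x, s₀ x ∂ν = m₀ * p₀) :
    TendstoInDistribution
      (fun (n : ℕ) (x : Fin n → 𝓧) => √(n : ℝ) * ((∑ i, s₁ (x i)) / (∑ i, d₁ (x i))
        - (∑ i, s₀ (x i)) / (∑ i, d₀ (x i)) - (m₁ - m₀))) atTop (id : ℝ → ℝ)
      (fun n => Measure.pi fun _ : Fin n => ν)
      (gaussianReal 0 (variance (fun x => (s₁ x - m₁ * d₁ x) * p₁⁻¹
        - (s₀ x - m₀ * d₀ x) * p₀⁻¹) ν).toNNReal) := by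
  refine tendstoInDistribution_pi_of_iidLaw (fun n => by fun_prop) ?_
  have i₁ : Integrable d₁ ν := ld₁.integrable one_le_two
  have i₀ : Integrable d₀ ν := ld₀.integrable one_le_two
  have j₁ : Integrable s₁ ν := ls₁.integrable one_le_two
  have j₀ : Integrable s₀ ν := ls₀.integrable one_le_two
  have l₁ : MemLp (fun x => s₁ x - m₁ * d₁ x) 2 ν := ls₁.sub (ld₁.const_mul m₁)
  have l₀ : MemLp (fun x => s₀ x - m₀ * d₀ x) 2 ν := ls₀.sub (ld₀.const_mul m₀)
  have z₁ : ∫ x, (s₁ x - m₁ * d₁ x) ∂ν = 0 := by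
    rw [integral_sub j₁ (i₁.const_mul m₁), integral_const_mul, ep₁, em₁, sub_self]
  have z₀ : ∫ x, (s₀ x - m₀ * d₀ x) ∂ν = 0 := by
    rw [integral_sub j₀ (i₀.const_mul m₀), integral_const_mul, ep₀, em₀, sub_self]
  have k₁ := tendstoInMeasure_sum_mul_iidLaw (by fun_prop) l₁ z₁ hd₁ i₁ (ep₁ ▸ hp₁)
  have k₀ := tendstoInMeasure_sum_mul_iidLaw (by fun_prop) l₀ z₀ hd₀ i₀ (ep₀ ▸ hp₀)
  rw [ep₁] at k₁
  rw [ep₀] at k₀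
  have c := tendstoInDistribution_sum_iidLaw
    (f := fun x => (s₁ x - m₁ * d₁ x) * p₁⁻¹ - (s₀ x - m₀ * d₀ x) * p₀⁻¹) (by fun_prop)
    ((l₁.mul_const p₁⁻¹).sub (l₀.mul_const p₀⁻¹)) (by
      rw [integral_sub ((l₁.mul_const p₁⁻¹).integrable one_le_two)
        ((l₀.mul_const p₀⁻¹).integrable one_le_two), integral_mul_const, integral_mul_const,
        z₁, z₀]
      ring)
  have c₁ := c.add_of_tendstoInMeasure_const k₁ (fun n => by fun_prop)
  have k₀' : TendstoInMeasure (iidLaw ν) (fun (n : ℕ) (ω : ℕ → 𝓧) =>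
      -(((√(n : ℝ))⁻¹ * ∑ i ∈ Finset.range n, (s₀ (ω i) - m₀ * d₀ (ω i)))
        * (n / (∑ i ∈ Finset.range n, d₀ (ω i)) - p₀⁻¹))) atTop fun _ => 0 := by
    rw [tendstoInMeasure_iff_norm] at k₀ ⊢
    simpa only [sub_zero, norm_neg] using k₀
  have c₂ := c₁.add_of_tendstoInMeasure_const k₀' (fun n => by fun_prop)
  simp only [add_zero] at c₂
  -- The linear term plus the two correction terms equals the normalized estimation error exactly
  -- once both denominators are nonzero, which almost surely holds for all large `n`.
  refine tendstoInDistribution_of_tendstoInMeasure_sub _ _ c₂ ?_ (fun n => by fun_prop)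
  refine tendstoInMeasure_of_tendsto_ae (fun n => by
    simp only [Pi.sub_def, Pi.add_def]
    fun_prop) ?_
  filter_upwards [tendsto_average_iidLaw hd₁ i₁, tendsto_average_iidLaw hd₀ i₀] with ω h₁ h₀
  rw [ep₁] at h₁
  rw [ep₀] at h₀
  refine tendsto_const_nhds.congr' ?_
  filter_upwards [h₁.eventually_ne hp₁, h₀.eventually_ne hp₀] with n e₁ e₀
  have n₁ : (∑ i ∈ Finset.range n, d₁ (ω i)) ≠ 0 := fun h => e₁ (by rw [h, zero_div])
  have n₀ : (∑ i ∈ Finset.range n, d₀ (ω i)) ≠ 0 := fun h => e₀ (by rw [h, zero_div])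
  -- For `n = 0` the average would be `0` by division by zero, which `e₁` excludes.
  have hn : √(n : ℝ) ≠ 0 := fun h => e₁ (by
    rw [Real.sqrt_eq_zero (Nat.cast_nonneg n)] at h
    rw [h, div_zero])
  have hsq : (n : ℝ) = √(n : ℝ) * √(n : ℝ) := (Real.mul_self_sqrt (Nat.cast_nonneg n)).symm
  simp only [Pi.sub_apply, Pi.add_apply, Pi.zero_apply, Finset.sum_sub_distrib,
    ← Finset.mul_sum, ← Finset.sum_mul, Fin.sum_univ_eq_sum_range (fun i => s₁ (ω i)),
    Fin.sum_univ_eq_sum_range (fun i => s₀ (ω i)), Fin.sum_univ_eq_sum_range (fun i => d₁ (ω i)),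
    Fin.sum_univ_eq_sum_range (fun i => d₀ (ω i))]
  generalize (∑ i ∈ Finset.range n, d₁ (ω i)) = D₁ at *
  generalize (∑ i ∈ Finset.range n, d₀ (ω i)) = D₀ at *
  generalize (∑ i ∈ Finset.range n, s₁ (ω i)) = S₁
  generalize (∑ i ∈ Finset.range n, s₀ (ω i)) = S₀
  generalize √(n : ℝ) = r at *
  rw [hsq]
  field_simp
  ring

end IID

/-! ### Observation proportions and the unadjusted estimator -/

section Unadjusted

variable {𝓦 𝓛 : Type*}

theorem indAC_eq (a : Bool) (x : Obs 𝓦 𝓛) : indAC a x = if x.2.1 = a then obsCY x else 0 := rfl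

theorem indACY_eq (a : Bool) (x : Obs 𝓦 𝓛) : indACY a x = if x.2.1 = a then obsY x else 0 := rfl

theorem indAC_observe (a : Bool) (o : Full 𝓦 𝓛) :
    indAC a (observe o) = cY o * if arm o = a then 1 else 0 := by
  rw [indAC_eq, obsCY_observe, mul_ite, mul_one, mul_zero]
  rfl

theorem indACY_observe (a : Bool) (o : Full 𝓦 𝓛) :
    indACY a (observe o) = cY o * if arm o = a then outcome o else 0 := by
  rw [indACY_eq, obsY_observe, mul_ite, mul_zero]
  rfl

variable [MeasurableSpace 𝓦] [MeasurableSpace 𝓛]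
  {P : ProbabilityMeasure (Full 𝓦 𝓛)}

/-- The strong law provides another limit in probability of the same proportions, and such limits
are unique. -/
theorem HasLimitProportion.eq_measureReal {S : Set (Obs 𝓦 𝓛)} {p : ℝ} (hS : MeasurableSet S)
    (h : HasLimitProportion P S p) : p = (obsLaw P).real S := by
  have hf : Measurable (S.indicator fun _ => (1 : ℝ)) := measurable_const.indicator hS
  have e1 : ∫ x, S.indicator (fun _ => (1 : ℝ)) x ∂(obsLaw P) = (obsLaw P).real S :=
    integral_indicator_one hS
  have hm : ∀ n : ℕ, Measurable fun ω : ℕ → Obs 𝓦 𝓛 =>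
      (∑ i ∈ Finset.range n, S.indicator (fun _ => (1 : ℝ)) (ω i)) / (n : ℝ) :=
    fun n => by fun_prop
  have k1 : TendstoInMeasure (iidLaw (obsLaw P)) (fun (n : ℕ) (ω : ℕ → Obs 𝓦 𝓛) =>
      (∑ i ∈ Finset.range n, S.indicator (fun _ => (1 : ℝ)) (ω i)) / (n : ℝ)) atTop
      fun _ => (obsLaw P).real S := by
    refine tendstoInMeasure_of_tendsto_ae (fun n => (hm n).aestronglyMeasurable) ?_
    rw [← e1]
    exact tendsto_average_iidLaw hf ((integrable_const _).indicator hS)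
  have k2 : TendstoInMeasure (iidLaw (obsLaw P)) (fun (n : ℕ) (ω : ℕ → Obs 𝓦 𝓛) =>
      (∑ i ∈ Finset.range n, S.indicator (fun _ => (1 : ℝ)) (ω i)) / (n : ℝ)) atTop
      fun _ => p := by
    rw [tendstoInMeasure_iff_measureReal_norm]
    intro ε hε
    refine (h ε hε).congr fun n => ?_
    unfold sampleLaw
    rw [← map_iidLaw_fin n, map_measureReal_apply (by fun_prop)
      (measurableSet_le measurable_const (by fun_prop))]
    congr 1
    ext ω
    simp only [Set.mem_preimage, Set.mem_ofPred_eq, Real.norm_eq_abs,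
      Fin.sum_univ_eq_sum_range (fun i => S.indicator (fun _ => (1 : ℝ)) (ω i))]
  obtain ⟨ω, hω⟩ := (tendstoInMeasure_ae_unique k2 k1).exists
  exact hω

theorem HasLimitProportion.eq_integral_cL {p : ℝ} (h : HasLimitProportion P observedL p) :
    p = ∫ o, cL o ∂(P : Measure (Full 𝓦 𝓛)) := by
  have e : (observedL : Set (Obs 𝓦 𝓛)) = obsCL ⁻¹' {1} := by
    ext x
    rcases hx : x.2.2.1 with l | l <;> simp [observedL, obsCL, hx]
  have hS : MeasurableSet (observedL : Set (Obs 𝓦 𝓛)) :=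
    e ▸ measurable_obsCL (measurableSet_singleton 1)
  rw [h.eq_measureReal hS, ← integral_obsCL, ← integral_indicator_one hS]
  refine integral_congr_ae (ae_of_all _ fun x => ?_)
  rcases hx : x.2.2.1 with l | l <;> simp [observedL, obsCL, hx, Set.indicator]

theorem HasLimitProportion.eq_integral_cY {p : ℝ} (h : HasLimitProportion P observedY p) :
    p = ∫ o, cY o ∂(P : Measure (Full 𝓦 𝓛)) := by
  have e : (observedY : Set (Obs 𝓦 𝓛)) = obsCY ⁻¹' {1} := by
    ext x
    rcases hx : x.2.2.2 with l | l <;> simp [observedY, obsCY, hx]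
  have hS : MeasurableSet (observedY : Set (Obs 𝓦 𝓛)) :=
    e ▸ measurable_obsCY (measurableSet_singleton 1)
  rw [h.eq_measureReal hS, ← integral_obsCY, ← integral_indicator_one hS]
  refine integral_congr_ae (ae_of_all _ fun x => ?_)
  rcases hx : x.2.2.2 with l | l <;> simp [observedY, obsCY, hx, Set.indicator]

theorem InModel.integral_cY_le (hP : InModel P) :
    ∫ o, cY o ∂(P : Measure (Full 𝓦 𝓛)) ≤ ∫ o, cL o ∂(P : Measure (Full 𝓦 𝓛)) := by
  refine integral_mono_ae
    (.of_bound measurable_cY.aestronglyMeasurable 1 (ae_of_all _ abs_cY_le))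
    (.of_bound measurable_cL.aestronglyMeasurable 1 (ae_of_all _ abs_cL_le)) ?_
  filter_upwards [hP.cY_mul_cL] with o ho
  rcases cY_mem o with h | h <;> rcases cL_mem o with h' | h' <;> simp_all

theorem measurable_indAC (a : Bool) : Measurable (indAC a : Obs 𝓦 𝓛 → ℝ) :=
  Measurable.ite ((measurable_snd.fst) (measurableSet_singleton a)) measurable_obsCY
    measurable_const

theorem measurable_indACY (a : Bool) : Measurable (indACY a : Obs 𝓦 𝓛 → ℝ) :=
  Measurable.ite ((measurable_snd.fst) (measurableSet_singleton a)) measurable_obsY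
    measurable_const

theorem InModel.integral_cY_mul_ite_arm (hP : InModel P) (a : Bool)
    {u : 𝓦 × Bool × 𝓛 × ℝ → ℝ} (hu : Measurable u) :
    ∫ o, cY o * (if arm o = a then u o.1 else 0) ∂(P : Measure (Full 𝓦 𝓛))
      = (∫ o, cY o ∂(P : Measure (Full 𝓦 𝓛))) / 2 * ∫ o, u o.1 ∂(armLaw P a) := by
  have hm : Measurable fun z : 𝓦 × Bool × 𝓛 × ℝ => if z.2.1 = a then u z else 0 :=
    Measurable.ite ((measurable_snd.fst) (measurableSet_singleton a)) hu measurable_const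
  refine (hP.integral_cY_mul hm).trans ?_
  rw [hP.integral_armLaw]
  unfold arm
  ring

theorem InModel.integral_indAC (hP : InModel P) (a : Bool) :
    ∫ x, indAC a x ∂(obsLaw P) = (∫ o, cY o ∂(P : Measure (Full 𝓦 𝓛))) / 2 := by
  have := hP.isProbabilityMeasure_armLaw a
  rw [integral_obsLaw P (measurable_indAC a)]
  simp only [indAC_observe]
  rw [hP.integral_cY_mul_ite_arm a (u := fun _ => 1) measurable_const]
  simp

theorem InModel.integral_indACY (hP : InModel P) (a : Bool) :
    ∫ x, indACY a x ∂(obsLaw P)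
      = (∫ o, outcome o ∂(armLaw P a)) * ((∫ o, cY o ∂(P : Measure (Full 𝓦 𝓛))) / 2) := by
  rw [integral_obsLaw P (measurable_indACY a)]
  simp only [indACY_observe]
  refine (hP.integral_cY_mul_ite_arm a (u := fun z => z.2.2.2) (by fun_prop)).trans ?_
  rw [mul_comm]
  rfl

theorem memLp_indAC (P : ProbabilityMeasure (Full 𝓦 𝓛)) (a : Bool) :
    MemLp (indAC a) 2 (obsLaw P) :=
  .of_bound (measurable_indAC a).aestronglyMeasurable 1 (ae_of_all _ fun x => by
    rw [indAC_eq]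
    split_ifs
    · exact abs_obsCY_le x
    · simp)

theorem InModel.memLp_indACY (hP : InModel P) (a : Bool) : MemLp (indACY a) 2 (obsLaw P) := by
  rw [memLp_obsLaw (measurable_indACY a)]
  refine hP.outcome_memLp.mono ((measurable_indACY a).comp measurable_observe).aestronglyMeasurable
    (ae_of_all _ fun o => ?_)
  rw [indACY_observe]
  rcases cY_mem o with h | h <;> split_ifs <;> simp [h]

/-- The variance of the influence function of the unadjusted estimator. -/
theorem InModel.variance_influence_unadjusted (hP : InModel P) {q m₁ m₀ : ℝ}
    (hq : q = (∫ o, cY o ∂(P : Measure (Full 𝓦 𝓛))) / 2) (hq0 : q ≠ 0)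
    (hm₁ : m₁ = ∫ o, outcome o ∂(armLaw P true)) (hm₀ : m₀ = ∫ o, outcome o ∂(armLaw P false)) :
    variance (fun x : Obs 𝓦 𝓛 => (indACY true x - m₁ * indAC true x) * q⁻¹
      - (indACY false x - m₀ * indAC false x) * q⁻¹) (obsLaw P) = totalVar P / q := by
  have l : ∀ (m : ℝ) (a : Bool), MemLp (fun x => (indACY a x - m * indAC a x) * q⁻¹) 2 (obsLaw P) :=
    fun m a => ((hP.memLp_indACY a).sub ((memLp_indAC P a).const_mul m)).mul_const q⁻¹
  have z : ∀ (m : ℝ) (a : Bool), m = ∫ o, outcome o ∂(armLaw P a) →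
      ∫ x, (indACY a x - m * indAC a x) * q⁻¹ ∂(obsLaw P) = 0 := fun m a hm => by
    rw [integral_mul_const, integral_sub ((hP.memLp_indACY a).integrable one_le_two)
      (((memLp_indAC P a).integrable one_le_two).const_mul m), integral_const_mul,
      hP.integral_indAC, hP.integral_indACY, hm, sub_self, zero_mul]
  have hMeas : ∀ (m : ℝ) (a : Bool),
      Measurable fun x : Obs 𝓦 𝓛 => (indACY a x - m * indAC a x) * q⁻¹ := fun m a =>
    ((measurable_indACY a).sub ((measurable_indAC a).const_mul m)).mul_const _
  have v : ∀ (m : ℝ) (a : Bool), m = ∫ o, outcome o ∂(armLaw P a) →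
      ∫ x, ((indACY a x - m * indAC a x) * q⁻¹) ^ 2 ∂(obsLaw P)
        = variance outcome (armLaw P a) / q := fun m a hm => by
    rw [integral_obsLaw P ((hMeas m a).pow_const 2),
      variance_eq_integral measurable_outcome.aemeasurable, ← hm]
    have e : ∀ o : Full 𝓦 𝓛,
        ((indACY a (observe o) - m * indAC a (observe o)) * q⁻¹) ^ 2
          = (cY o * if arm o = a then (o.1.2.2.2 - m) ^ 2 else 0) * (q⁻¹) ^ 2 := fun o => by
      rw [indACY_observe, indAC_observe]
      unfold outcome
      rcases cY_mem o with h | h <;> rw [h] <;> split_ifs <;> ring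
    simp only [e]
    rw [integral_mul_const,
      hP.integral_cY_mul_ite_arm a (u := fun z => (z.2.2.2 - m) ^ 2) (by fun_prop), ← hq]
    unfold outcome
    field_simp
  rw [variance_of_integral_eq_zero
    (X := fun x : Obs 𝓦 𝓛 => (indACY true x - m₁ * indAC true x) * q⁻¹
      - (indACY false x - m₀ * indAC false x) * q⁻¹)
    ((l m₁ true).sub (l m₀ false)).aemeasurable (by
    rw [integral_sub ((l m₁ true).integrable one_le_two) ((l m₀ false).integrable one_le_two),
      z m₁ true hm₁, z m₀ false hm₀, sub_self])]
  -- The two terms are supported on different arms, so the cross term vanishes.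
  have e : ∀ x : Obs 𝓦 𝓛, ((indACY true x - m₁ * indAC true x) * q⁻¹
      - (indACY false x - m₀ * indAC false x) * q⁻¹) ^ 2
      = ((indACY true x - m₁ * indAC true x) * q⁻¹) ^ 2
        + ((indACY false x - m₀ * indAC false x) * q⁻¹) ^ 2 := fun x => by
    simp only [indAC_eq, indACY_eq]
    cases x.2.1 <;> simp
  simp only [e]
  rw [integral_add (l m₁ true).integrable_sq (l m₀ false).integrable_sq, v m₁ true hm₁,
    v m₀ false hm₀, totalVar, Fintype.sum_bool, add_div]

theorem InModel.hasAVar_unadjusted (hP : InModel P)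
    (hY : 0 < ∫ o, cY o ∂(P : Measure (Full 𝓦 𝓛))) :
    HasAVar unadjusted P (2 / (∫ o, cY o ∂(P : Measure (Full 𝓦 𝓛))) * totalVar P).toNNReal := by
  -- `q = p_y / 2` is the probability of being in a given arm with `Y` observed.
  set q := (∫ o, cY o ∂(P : Measure (Full 𝓦 𝓛))) / 2 with hq
  have hq0 : q ≠ 0 := by positivity
  have h := tendstoInDistribution_sub_ratio (ν := obsLaw P)
    (m₁ := ∫ o, outcome o ∂(armLaw P true)) (m₀ := ∫ o, outcome o ∂(armLaw P false))
    (measurable_indACY true) (measurable_indAC true) (measurable_indACY false)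
    (measurable_indAC false) (hP.memLp_indACY true) (memLp_indAC P true) (hP.memLp_indACY false)
    (memLp_indAC P false) (hP.integral_indAC true) (hP.integral_indAC false) hq0 hq0
    (hP.integral_indACY true) (hP.integral_indACY false)
  rw [hP.variance_influence_unadjusted hq hq0 rfl rfl] at h
  have e : 2 / (∫ o, cY o ∂(P : Measure (Full 𝓦 𝓛))) * totalVar P = totalVar P / q := by
    rw [hq]
    field_simp
  unfold HasAVar
  rw [e]
  exact h

end Unadjusted

end Trial

end

/-! ### The asymptotic relative efficiency -/

theorem theorem1 {𝓦 𝓛 : Type*} [MeasurableSpace 𝓦] [MeasurableSpace 𝓛]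
    (P : ProbabilityMeasure (Trial.Full 𝓦 𝓛)) (hP : Trial.InModel P)
    (hvar : 0 < Trial.totalVar P)
    (pl py : ℝ) (hpl : Trial.HasLimitProportion P Trial.observedL pl)
    (hpy : Trial.HasLimitProportion P Trial.observedY py) (hpos : 0 < py)
    (T : Trial.Estimator 𝓦 𝓛) (hT : Trial.IsEfficient T P) :
    Trial.HasARE T Trial.unadjusted P
      (1 / (1 + py / 2 * Trial.heterogeneity P - Trial.rSqW P
        - (1 - py / pl) * Trial.rSqLW P)) := by
  obtain rfl := hpl.eq_integral_cL
  obtain rfl := hpy.eq_integral_cY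
  have hL := hpos.trans_le hP.integral_cY_le
  obtain ⟨v, hv, hlub⟩ := hT.attains
  choose g hg hgm using Trial.exists_meanW_eq P
  choose h hh hhm using Trial.exists_meanLW_eq P
  have hN := Trial.isNuisance_of_mean hP hg hh hgm hhm
  have e := (hlub.2 (Trial.effBound_mem_upperBounds hP hN hL hpos)).antisymm
    (Trial.effBound_le_of_mem_upperBounds hP hN hL hpos v.2 hlub.1)
  rw [Trial.effBound_of_mean hP hvar hg hh hgm hhm hL hpos] at e
  refine ⟨v, _, hv, hP.hasAVar_unadjusted hpos, ?_⟩
  -- Only the prefactor `(2/p_y) (Var_1 Y + Var_0 Y)` has to be nonzero for the cancellation. If the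
  -- other factor is zero, both quotients are `0`.
  rw [Real.coe_toNNReal _ (by positivity), e, one_div, div_mul_cancel_left₀ (by positivity)]
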